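/- Let $\mathbb T=\mathbb R/\mathbb Z$, identified with $[0,1)$ with Lebesgue measure. For $k\ge 0$ let $r_k(x)=(-1)^{\lfloor 2^{k+1}x\rfloor}$ be the $k$-th Rademacher function, and for $n=\sum_k \varepsilon_k 2^k$ with $\varepsilon_k\in\{0,1\}$ let $W_n=\prod_{k:\varepsilon_k=1} r_k$ be the $n$-th Walsh function (Paley order). For $f\in L^1(\mathbb T)$ (complex-valued) let $$\mathrm W_nf(x)=\sum_{k<n}\Big(\int_{\mathbb T} f\,W_k\Big)W_k(x),\qquad \mathrm Wf(x)=\sup_{n\in\mathbb N}|\mathrm W_nf(x)| .$$ Write $\|g\|_{p,\infty}=\sup_{t>0}t\,|\{x\in\mathbb T:|g(x)|>t\}|^{1/p}$. 1. There is an absolute constant $c>0$ such that, for all $1<p\le 2$ and all $f\in L^p(\mathbb T)$, $$\|\mathrm Wf\|_{p,\infty}\le \frac{c}{p-1}\,\|f\|_{p},$$ that is, $\|\mathrm W\|_{L^p(\mathbb T)\to L^{p,\infty}(\mathbb T)}\le \frac{c}{p-1}$ for all $1<p\le2$. 2. Consequently, there is an absolute constant $c>0$ such that, for all $f\in L^\infty(\mathbb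 T)$, $$\|\mathrm Wf\|_{1,\infty}\le c\,\|f\|_1\log\Big(e+\frac{\|f\|_\infty}{\|f\|_1}\Big)$$ (the right-hand side being read as $0$ if $\|f\|_1=0$). 3. Consequently, with $\Phi(t)=t\log(e+t)\log\log\log(e^{e^e}+t)$ and the Luxemburg norm $\|f\|_{L^\Phi}=\inf\{\lambda>0:\int_{\mathbb T}\Phi(|f|/\lambda)\le1\}$, there is an absolute constant $c>0$ such that $\|\mathrm Wf\|_{1,\infty}\le c\,\|f\|_{L^\Phi}$ for all measurable $f:\mathbb T\to\mathbb C$ with $\|f\|_{L^\Phi}<\infty$. -/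

import Mathlib

open MeasureTheory Set
open scoped ENNReal NNReal

noncomputable section

namespace WalshCarleson

/-- The torus `𝕋 = ℝ / ℤ` as a probability space: functions on `𝕋` are functions on `[0, 1)`,
equipped with Lebesgue measure. Only the values on `[0, 1)` (up to null sets) matter below. -/
def torus : Measure ℝ := volume.restrict (Ico (0 : ℝ) 1)

/-- The `k`-th Rademacher function: `(-1) ^ ε` where `ε` is the `(k + 1)`-st binary digit
(after the point) of `x`. It is `1`-periodic. -/
def rademacher (k : ℕ) (x : ℝ) : ℝ :=
  if Even ⌊(2 : ℝ) ^ (k + 1) * x⌋ then 1 else -1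

/-- The `n`-th Walsh character (in the Paley order): the product of the Rademacher functions
`rademacher k` over the binary digits `k` of `n` which are `1`. Equivalently `W₀ = 1`,
`W_{2n}(x) = W_n(2x)` and `W_{2n+1}(x) = rademacher 0 x * W_n(2x)`. -/
def walsh (n : ℕ) (x : ℝ) : ℝ :=
  ∏ k ∈ Finset.range n.size, if n.testBit k then rademacher k x else 1

/-- The `k`-th Walsh-Fourier coefficient `⟨f, W_k⟩ = ∫_𝕋 f W_k`. -/
def walshCoeff (f : ℝ → ℂ) (k : ℕ) : ℂ :=
  ∫ y, f y * (walsh k y : ℂ) ∂torus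

/-- The `n`-th partial Walsh-Fourier sum `W_n f(x) = ∑_{k < n} ⟨f, W_k⟩ W_k(x)`. -/
def walshPartialSum (n : ℕ) (f : ℝ → ℂ) (x : ℝ) : ℂ :=
  ∑ k ∈ Finset.range n, walshCoeff f k * (walsh k x : ℂ)

/-- The Walsh-Carleson maximal operator `W f(x) = sup_n |W_n f(x)|`, with values in `[0, ∞]`. -/
def walshMaximal (f : ℝ → ℂ) (x : ℝ) : ℝ≥0∞ :=
  ⨆ n : ℕ, ‖walshPartialSum n f x‖ₑ

/-- The weak `L^p` quasi-norm `sup_{t > 0} t |{x : t < g(x)}| ^ (1 / p)` of a nonnegative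
function `g`. -/
def weakNorm {α : Type*} [MeasurableSpace α] (g : α → ℝ≥0∞) (p : ℝ) (μ : Measure α) : ℝ≥0∞ :=
  ⨆ t : ℝ≥0, (t : ℝ≥0∞) * μ {x | (t : ℝ≥0∞) < g x} ^ (1 / p)

/-- The Luxemburg norm `inf {l > 0 : ∫ Φ(|f| / l) ≤ 1}` of the Orlicz space `L^Φ`; it is `∞` when
there is no such `l`. -/
def luxemburgNorm {α : Type*} [MeasurableSpace α] (Φ : ℝ → ℝ) (f : α → ℂ) (μ : Measure α) :
    ℝ≥0∞ :=
  ⨅ (l : ℝ≥0) (_ : 0 < l) (_ : ∫⁻ x, ENNReal.ofReal (Φ (‖f x‖ / (l : ℝ))) ∂μ ≤ 1), (l : ℝ≥0∞)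

/-- Antonov's Orlicz function `Φ(t) = t log(e + t) log log log(e ^ (e ^ e) + t)`. -/
def antonovΦ (t : ℝ) : ℝ :=
  t * Real.log (Real.exp 1 + t) *
    Real.log (Real.log (Real.log (Real.exp (Real.exp (Real.exp 1)) + t)))

end WalshCarleson

end

/-!
The heart of the matter is the weak `L ^ p` bound; the other two bounds follow from it by
extrapolation.

**Discretisation.** Partial sums of order less than `2 ^ N` see only the averages of `f` over dyadic
intervals of length `2 ^ (-N)`, so the maximal operator may be studied on the finite cube of `N`
binary digits, with a chosen order `n x` at each point (`walshPartialSum_eq`). Grouping the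
frequencies below `n x` according to the binary digits of `n x` writes the partial sum as a sum over
bitiles, that is over the scales `k` at which `n x` lies in the upper half of its frequency interval
(`sum_range_coeff_mul_char`).

**Time-frequency analysis.** Collections of bitiles are measured by their size, which bounds wave
packet coefficients in mean square over trees, and by their density, which bounds the proportion of
points whose chosen frequency lies in the bitiles above. On a tree the sum is, up to a single term,
a truncated martingale, and Doob's inequality bounds it by density times size times the length of
the tree (`form_tree_le`). Bitiles of large size form a forest whose total length is controlled by
the `L²` norm through Bessel's inequality (`exists_size_decomposition`); bitiles of density about
`δ` form a forest of total length at most about `|G| / δ`, `|G|` being the measure of the set `G` on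
which the operator is tested (`exists_density_forest`). Balancing the two gives a bound
`δ ^ (1 / 2) ‖f‖₂ |G| ^ (1 / 2)` (`form_le_of_density`). In the selection lemmas the time sets of
trees are arbitrary sets instead of intervals: the set that maximises a supermodular functional then
replaces the usual maximal intervals.

**Passing to `L ^ p`.** For fixed density, `f` is replaced by a good function with the same
coefficients at the relevant bitiles: on each maximal interval where the `L ^ p` average of `f` is
large, `f` is projected onto the frequencies of the trees above that interval. Projecting onto `m`
frequencies loses only `m ^ (1 / p - 1 / 2)` in passing from `L ^ p` to `L²` (`sum_sq_avg_le`), so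
that the class of density `2 ^ (-i)` contributes `2 ^ (-i (1 - 1 / p))` (`form_density_class_le`).
The sum over `i` is of order `1 / (p - 1)`.

**Extrapolation.** With `p - 1` the reciprocal of the logarithm, interpolation of the `L ^ p` norm
between `L¹` and `L ^ ∞` gives the mixed bound. For the Orlicz bound, `f` is cut into bands of
doubly exponential height, the `j`-th band is estimated with `p - 1 = exp (-(j + 1))`, and the bands
are added up by the logarithmic convexity of weak `L¹` (`weakNorm_le_tsum`), whose weights of size
`log j` account for the triple logarithm.
-/

noncomputable section

namespace WalshCarleson

open Finset (range)

section Discrete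

open scoped Classical

variable {N : ℕ}

/-! ### Dyadic frequencies -/

theorem div_two_pow_eq_of_le {n m j k : ℕ} (hjk : j ≤ k) (h : n / 2 ^ j = m / 2 ^ j) :
    n / 2 ^ k = m / 2 ^ k := by
  obtain ⟨d, rfl⟩ := Nat.exists_eq_add_of_le hjk
  rw [pow_add, ← Nat.div_div_eq_div_mul, ← Nat.div_div_eq_div_mul, h]

theorem testBit_eq_of_div_eq {n m k i : ℕ} (h : n / 2 ^ k = m / 2 ^ k) (hi : k ≤ i) :
    n.testBit i = m.testBit i := by
  obtain ⟨d, rfl⟩ := Nat.exists_eq_add_of_le' hi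
  rw [← Nat.testBit_div_two_pow, ← Nat.testBit_div_two_pow, h]

theorem div_eq_of_testBit_eq {n m k : ℕ} (h : ∀ i, k ≤ i → n.testBit i = m.testBit i) :
    n / 2 ^ k = m / 2 ^ k := by
  apply Nat.eq_of_testBit_eq
  intro i
  rw [Nat.testBit_div_two_pow, Nat.testBit_div_two_pow]
  exact h _ (by omega)

theorem div_eq_of_succ {n m k : ℕ} (h : n / 2 ^ (k + 1) = m / 2 ^ (k + 1))
    (hk : n.testBit k = m.testBit k) : n / 2 ^ k = m / 2 ^ k := by
  apply div_eq_of_testBit_eq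
  intro i hi
  rcases hi.eq_or_lt with rfl | hi
  · exact hk
  · exact testBit_eq_of_div_eq h hi

/-- The frequency `n` with its binary digits of index at most `k` erased: the left end of the dyadic
frequency interval of length `2 ^ (k + 1)` that contains `n`. -/
def hi (k n : ℕ) : ℕ := n / 2 ^ (k + 1) * 2 ^ (k + 1)

theorem hi_le (k n : ℕ) : hi k n ≤ n := Nat.div_mul_le_self _ _

theorem hi_div (k n : ℕ) : hi k n / 2 ^ (k + 1) = n / 2 ^ (k + 1) :=
  Nat.mul_div_cancel _ (by positivity)

theorem hi_congr {k n m : ℕ} (h : n / 2 ^ (k + 1) = m / 2 ^ (k + 1)) : hi k n = hi k m := by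
  simp [hi, h]

theorem hi_testBit_of_le {k n i : ℕ} (h : i ≤ k) : (hi k n).testBit i = false := by
  simp [hi, Nat.testBit_mul_two_pow]; omega

/-! ### The dyadic cube and its cylinders -/

/-- The discrete model of `[0, 1)`: a point is the list of its first `N` binary digits. -/
abbrev Cube (N : ℕ) := Fin N → Bool


/-- Change the `i`-th digit. -/
def flip (i : Fin N) (x : Cube N) : Cube N := Function.update x i (!x i)

@[simp] theorem flip_flip (i : Fin N) (x : Cube N) : flip i (flip i x) = x := by
  simp [flip]

@[simp] theorem flip_self (i : Fin N) (x : Cube N) : flip i x i = !x i := by simp [flip]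

theorem flip_of_ne {i j : Fin N} (h : j ≠ i) (x : Cube N) : flip i x j = x j := by
  simp [flip, h]

theorem flip_bijective (i : Fin N) : Function.Bijective (flip i : Cube N → Cube N) :=
  Function.Involutive.bijective (flip_flip i)

theorem sum_flip {M : Type*} [AddCommMonoid M] (i : Fin N) (φ : Cube N → M) :
    ∑ x, φ (flip i x) = ∑ x, φ x :=
  (flip_bijective i).sum_comp φ

/-- The dyadic interval of length `2 ^ (-k)` containing `x`: the points with the same first `k`
digits. -/
def cyl (k : ℕ) (x : Cube N) : Finset (Cube N) :=
  Finset.univ.filter fun y => ∀ i : Fin N, (i : ℕ) < k → y i = x i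

theorem mem_cyl {k : ℕ} {x y : Cube N} : y ∈ cyl k x ↔ ∀ i : Fin N, (i : ℕ) < k → y i = x i := by
  simp [cyl]

@[simp] theorem self_mem_cyl (k : ℕ) (x : Cube N) : x ∈ cyl k x := by simp [mem_cyl]

theorem mem_cyl_comm {k : ℕ} {x y : Cube N} : y ∈ cyl k x ↔ x ∈ cyl k y := by
  simp only [mem_cyl]; constructor <;> intro h i hi <;> exact (h i hi).symm

theorem cyl_eq_of_mem {k : ℕ} {x y : Cube N} (h : y ∈ cyl k x) : cyl k y = cyl k x := by
  rw [mem_cyl] at h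
  ext z; simp only [mem_cyl]
  exact forall₂_congr fun i hi => by rw [h i hi]

theorem cyl_eq_iff_mem {k : ℕ} {x y : Cube N} : cyl k y = cyl k x ↔ y ∈ cyl k x :=
  ⟨fun h => h ▸ self_mem_cyl k y, cyl_eq_of_mem⟩

theorem cyl_anti {j k : ℕ} (h : j ≤ k) (x : Cube N) : cyl k x ⊆ cyl j x := by
  intro y; simp only [mem_cyl]; exact fun hy i hi => hy i (by omega)

theorem card_cyl_pos (k : ℕ) (x : Cube N) : 0 < (cyl k x).card :=
  Finset.card_pos.2 ⟨x, self_mem_cyl k x⟩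

theorem cyl_zero (x : Cube N) : cyl 0 x = Finset.univ := by ext; simp [mem_cyl]

theorem cyl_top (x : Cube N) : cyl N x = {x} := by
  ext y; simp only [mem_cyl, Finset.mem_singleton]
  exact ⟨fun h => funext fun i => h i i.2, fun h => by simp [h]⟩

theorem flip_mem_cyl {k : ℕ} {i : Fin N} (hi : k ≤ i) (x : Cube N) : flip i x ∈ cyl k x := by
  rw [mem_cyl]; intro j hj
  exact flip_of_ne (by rintro rfl; omega) x

theorem card_cyl_eq (k : ℕ) (hk : k < N) (x : Cube N) :
    (cyl k x).card = 2 * (cyl (k + 1) x).card := by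
  have h : cyl k x = cyl (k + 1) x ∪ (cyl (k + 1) x).image (flip ⟨k, hk⟩) := by
    ext y
    simp only [Finset.mem_union, Finset.mem_image]
    constructor
    · intro hy
      by_cases hb : y ⟨k, hk⟩ = x ⟨k, hk⟩
      · left
        rw [mem_cyl] at hy ⊢
        intro i hi
        rcases (Nat.lt_succ_iff.1 hi).eq_or_lt with h | h
        · have : i = ⟨k, hk⟩ := Fin.ext h
          rw [this, hb]
        · exact hy i h
      · right
        refine ⟨flip ⟨k, hk⟩ y, ?_, flip_flip _ _⟩
        rw [mem_cyl] at hy ⊢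
        intro i hi
        rcases (Nat.lt_succ_iff.1 hi).eq_or_lt with h | h
        · have : i = ⟨k, hk⟩ := Fin.ext h
          rw [this, flip_self]
          revert hb; cases y ⟨k, hk⟩ <;> cases x ⟨k, hk⟩ <;> simp
        · rw [flip_of_ne (by intro e; rw [e] at h; simp at h), hy i h]
    · rintro (hy | ⟨z, hz, rfl⟩)
      · exact cyl_anti (Nat.le_succ k) x hy
      · rw [← cyl_eq_of_mem (cyl_anti (Nat.le_succ k) x hz)]
        exact flip_mem_cyl le_rfl _
  rw [h, Finset.card_union_of_disjoint, Finset.card_image_of_injective _ (flip_bijective _).1,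
    two_mul]
  rw [Finset.disjoint_left]
  intro y hy hy'
  obtain ⟨z, hz, rfl⟩ := Finset.mem_image.1 hy'
  rw [mem_cyl] at hy hz
  have h1 := hy ⟨k, hk⟩ (by simp)
  have h2 := hz ⟨k, hk⟩ (by simp)
  rw [flip_self, h2] at h1
  simp at h1

/-! ### Walsh characters on the cube -/

/-- The Walsh character of frequency `n`; on the cube the `i`-th Rademacher function is
`(-1) ^ (x i)`. -/
def char (n : ℕ) (x : Cube N) : ℂ := ∏ i : Fin N, if n.testBit i && x i then -1 else 1

theorem char_mul_self (n : ℕ) (x : Cube N) : char n x * char n x = 1 := by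
  rw [char, ← Finset.prod_mul_distrib]
  apply Finset.prod_eq_one
  intro i _; split_ifs <;> simp

@[simp] theorem norm_char (n : ℕ) (x : Cube N) : ‖char n x‖ = 1 := by
  rw [char, norm_prod]
  apply Finset.prod_eq_one
  intro i _; split_ifs <;> simp

@[simp] theorem conj_char (n : ℕ) (x : Cube N) : (starRingEnd ℂ) (char n x) = char n x := by
  rw [char, map_prod]
  apply Finset.prod_congr rfl
  intro i _; split_ifs <;> simp

theorem char_flip (n : ℕ) (i : Fin N) (x : Cube N) :
    char n (flip i x) = (if n.testBit i then -1 else 1) * char n x := by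
  rw [char, char, ← Finset.mul_prod_erase Finset.univ _ (Finset.mem_univ i),
    ← Finset.mul_prod_erase Finset.univ (fun j : Fin N => if n.testBit j && x j then (-1 : ℂ) else 1)
      (Finset.mem_univ i), ← mul_assoc]
  congr 1
  · rw [flip_self]
    cases n.testBit i <;> cases x i <;> simp
  · apply Finset.prod_congr rfl
    intro j hj
    rw [flip_of_ne (Finset.ne_of_mem_erase hj)]

/-- Two characters whose frequencies agree in the digits of index at least `k` differ by a factor
that depends only on the first `k` digits of the point. -/
theorem char_mul_char_congr {n m k : ℕ} (h : n / 2 ^ k = m / 2 ^ k) {x y : Cube N}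
    (hy : y ∈ cyl k x) : char n y * char m y = char n x * char m x := by
  simp only [char]
  rw [← Finset.prod_mul_distrib, ← Finset.prod_mul_distrib]
  apply Finset.prod_congr rfl
  intro i _
  by_cases hi : (i : ℕ) < k
  · rw [mem_cyl.1 hy i hi]
  · rw [testBit_eq_of_div_eq h (not_lt.1 hi)]
    split_ifs <;> simp

/-- The function `φ` depends only on the first `k` digits. -/
def DependsOn {α : Type*} (k : ℕ) (φ : Cube N → α) : Prop := ∀ x y, y ∈ cyl k x → φ y = φ x

theorem DependsOn.mono {α : Type*} {j k : ℕ} (hjk : j ≤ k) {φ : Cube N → α}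
    (h : DependsOn j φ) : DependsOn k φ := fun x y hy => h x y (cyl_anti hjk x hy)

theorem exists_testBit_ne {k u v : ℕ} (hu : u < 2 ^ N) (hv : v < 2 ^ N)
    (h : u / 2 ^ k ≠ v / 2 ^ k) : ∃ i : Fin N, k ≤ i ∧ u.testBit i ≠ v.testBit i := by
  by_contra! hc
  apply h
  apply div_eq_of_testBit_eq
  intro i hi
  by_cases hN : i < N
  · exact hc ⟨i, hN⟩ hi
  · have : 2 ^ N ≤ 2 ^ i := Nat.pow_le_pow_right (by norm_num) (not_lt.1 hN)
    rw [Nat.testBit_lt_two_pow (hu.trans_le this), Nat.testBit_lt_two_pow (hv.trans_le this)]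

/-- Orthogonality of two characters on the intervals of length `2 ^ (-k)`. -/
theorem sum_char_mul_char_eq_zero {k u v : ℕ} (hu : u < 2 ^ N) (hv : v < 2 ^ N)
    (h : u / 2 ^ k ≠ v / 2 ^ k) {φ : Cube N → ℂ} (hφ : DependsOn k φ) :
    ∑ x, φ x * (char u x * char v x) = 0 := by
  obtain ⟨i, hki, hne⟩ := exists_testBit_ne hu hv h
  have h1 : ∑ x, φ x * (char u x * char v x) = ∑ x, -(φ x * (char u x * char v x)) := by
    rw [← sum_flip i]
    apply Finset.sum_congr rfl
    intro x _
    rw [hφ x _ (flip_mem_cyl hki x), char_flip, char_flip]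
    cases hb : u.testBit i <;> cases hb' : v.testBit i <;> simp_all
  rw [Finset.sum_neg_distrib] at h1
  exact self_eq_neg.1 h1

/-- Averages over the dyadic intervals of length `2 ^ (-k)`. -/
def avg (k : ℕ) (f : Cube N → ℂ) (x : Cube N) : ℂ := (∑ y ∈ cyl k x, f y) / (cyl k x).card

theorem dependsOn_avg (k : ℕ) (f : Cube N → ℂ) : DependsOn k (avg k f) := by
  intro x y h; simp only [avg, cyl_eq_of_mem h]

theorem sum_cyl_swap {M : Type*} [AddCommMonoid M] (k : ℕ) (F : Cube N → Cube N → M) :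
    ∑ x, ∑ y ∈ cyl k x, F x y = ∑ y, ∑ x ∈ cyl k y, F x y := by
  rw [Finset.sum_comm' (t' := Finset.univ) (s' := fun y => cyl k y)]
  intro x y; simp only [Finset.mem_univ, true_and, and_true]; exact mem_cyl_comm

/-- Averaging is self-adjoint: a function of the first `k` digits does not see the difference
between a function and its averages. -/
theorem sum_mul_sum_cyl_div {𝕜 : Type*} [Field 𝕜] [CharZero 𝕜] (k : ℕ) {φ : Cube N → 𝕜}
    (hφ : DependsOn k φ) (f : Cube N → 𝕜) :
    ∑ x, φ x * ((∑ y ∈ cyl k x, f y) / (cyl k x).card) = ∑ x, φ x * f x := by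
  simp only [Finset.sum_div, Finset.mul_sum]
  rw [sum_cyl_swap]
  apply Finset.sum_congr rfl
  intro y _
  have : ∀ x ∈ cyl k y, φ x * (f y / (cyl k x).card) = φ y * (f y / (cyl k y).card) := by
    intro x hx; rw [hφ y x hx, cyl_eq_of_mem hx]
  rw [Finset.sum_congr rfl this, Finset.sum_const, nsmul_eq_mul]
  have : ((cyl k y).card : 𝕜) ≠ 0 := by exact_mod_cast (card_cyl_pos k y).ne'
  field_simp

theorem sum_mul_avg (k : ℕ) {φ : Cube N → ℂ} (hφ : DependsOn k φ) (f : Cube N → ℂ) :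
    ∑ x, φ x * avg k f x = ∑ x, φ x * f x :=
  sum_mul_sum_cyl_div k hφ f

/-- Bessel's inequality for wave packets: the `i`-th family consists of the packets of frequency
`u i` on the intervals of length `2 ^ (-k i)` making up `V i`, and packets on overlapping
intervals have disjoint frequency intervals. -/
theorem bessel {ι : Type*} [DecidableEq ι] (s : Finset ι) (k u : ι → ℕ) (V : ι → Set (Cube N))
    [∀ i, DecidablePred (· ∈ V i)]
    (hu : ∀ i ∈ s, u i < 2 ^ N) (hV : ∀ i ∈ s, DependsOn (k i) (· ∈ V i))
    (hd : ∀ i ∈ s, ∀ j ∈ s, i ≠ j → k i ≤ k j → ∀ x, x ∈ V i → x ∈ V j →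
      u i / 2 ^ k j ≠ u j / 2 ^ k j) (f : Cube N → ℂ) :
    ∑ i ∈ s, ∑ x, (if x ∈ V i then ‖avg (k i) (fun y => f y * char (u i) y) x‖ ^ 2 else 0) ≤
      ∑ x, ‖f x‖ ^ 2 := by
  set C : ι → Cube N → ℂ := fun i x =>
    if x ∈ V i then avg (k i) (fun y => f y * char (u i) y) x else 0 with hC
  have hCd : ∀ i ∈ s, DependsOn (k i) (C i) := by
    intro i hi x y hy
    have h1 := hV i hi x y hy
    simp only [eq_iff_iff] at h1
    simp only [hC, h1, dependsOn_avg (k i) _ x y hy]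
  set B : ℝ := ∑ i ∈ s, ∑ x, ‖C i x‖ ^ 2 with hB
  have hB' : ∑ i ∈ s, ∑ x,
      (if x ∈ V i then ‖avg (k i) (fun y => f y * char (u i) y) x‖ ^ 2 else 0) = B := by
    simp only [hB, hC]
    refine Finset.sum_congr rfl fun i _ => Finset.sum_congr rfl fun x _ => ?_
    split_ifs <;> simp
  rw [hB']
  set h : Cube N → ℂ := fun x => ∑ i ∈ s, C i x * char (u i) x with hh
  have hsq : ∀ z : ℂ, ((‖z‖ ^ 2 : ℝ) : ℂ) = (starRingEnd ℂ) z * z := by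
    intro z; rw [mul_comm, Complex.mul_conj, Complex.normSq_eq_norm_sq]
  have hfh : ∑ x, (starRingEnd ℂ) (h x) * f x = (B : ℂ) := by
    simp only [hh, map_sum, map_mul, conj_char, Finset.sum_mul]
    rw [Finset.sum_comm]
    simp only [hB, Complex.ofReal_sum]
    refine Finset.sum_congr rfl fun i hi => ?_
    have h2 := sum_mul_avg (k i) (φ := fun x => (starRingEnd ℂ) (C i x))
      (fun x y hy => by simp only [hCd i hi x y hy]) (fun y => f y * char (u i) y)
    rw [show ∑ x, (starRingEnd ℂ) (C i x) * char (u i) x * f x =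
      ∑ x, (starRingEnd ℂ) (C i x) * (f x * char (u i) x) from
        Finset.sum_congr rfl fun x _ => by ring, ← h2]
    refine Finset.sum_congr rfl fun x _ => ?_
    rw [hsq]
    simp only [hC]
    split_ifs <;> simp
  have hcross : ∀ i ∈ s, ∀ j ∈ s, i ≠ j → k i ≤ k j →
      ∑ x, (starRingEnd ℂ) (C i x) * C j x * (char (u i) x * char (u j) x) = 0 := by
    intro i hi j hj hij hk
    by_cases hx : ∃ x, x ∈ V i ∧ x ∈ V j
    · obtain ⟨x, hx1, hx2⟩ := hx
      refine sum_char_mul_char_eq_zero (hu i hi) (hu j hj) (hd i hi j hj hij hk x hx1 hx2) ?_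
      intro x y hy
      simp only [hCd j hj x y hy, hCd i hi x y (cyl_anti hk x hy)]
    · apply Finset.sum_eq_zero
      intro x _
      push Not at hx
      by_cases h1 : x ∈ V i
      · simp [hC, hx x h1]
      · simp [hC, h1]
  have hhh : ∑ x, (starRingEnd ℂ) (h x) * h x = (B : ℂ) := by
    have e1 : ∀ x, (starRingEnd ℂ) (h x) * h x = ∑ i ∈ s, ∑ j ∈ s,
        (starRingEnd ℂ) (C i x) * C j x * (char (u i) x * char (u j) x) := by
      intro x
      simp only [hh, map_sum, map_mul, conj_char, Finset.sum_mul_sum]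
      refine Finset.sum_congr rfl fun i _ => Finset.sum_congr rfl fun j _ => by ring
    simp only [e1]
    rw [Finset.sum_comm]
    simp only [hB, Complex.ofReal_sum]
    refine Finset.sum_congr rfl fun i hi => ?_
    rw [Finset.sum_comm, Finset.sum_eq_single_of_mem i hi]
    · refine Finset.sum_congr rfl fun x _ => ?_
      rw [hsq, char_mul_self, mul_one]
    · intro j hj hji
      rcases le_total (k i) (k j) with hk | hk
      · exact hcross i hi j hj hji.symm hk
      · have := congrArg (starRingEnd ℂ) (hcross j hj i hi hji hk)
        rw [map_zero, map_sum] at this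
        rw [← this]
        refine Finset.sum_congr rfl fun x _ => ?_
        simp only [map_mul, conj_char, Complex.conj_conj]; ring
  have hhB : ∑ x, ‖h x‖ ^ 2 = B := by
    have : ((∑ x, ‖h x‖ ^ 2 : ℝ) : ℂ) = (B : ℂ) := by
      rw [← hhh, Complex.ofReal_sum]
      exact Finset.sum_congr rfl fun x _ => hsq _
    exact_mod_cast this
  have hBle : B ≤ ∑ x, ‖h x‖ * ‖f x‖ := by
    calc B ≤ ‖(B : ℂ)‖ := by rw [Complex.norm_real]; exact le_abs_self _
      _ = ‖∑ x, (starRingEnd ℂ) (h x) * f x‖ := by rw [hfh]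
      _ ≤ ∑ x, ‖(starRingEnd ℂ) (h x) * f x‖ := norm_sum_le _ _
      _ = _ := by simp
  have h3 : ∑ x, ‖h x‖ * ‖f x‖ ≤ ∑ x, (‖h x‖ ^ 2 + ‖f x‖ ^ 2) / 2 :=
    Finset.sum_le_sum fun x _ => by nlinarith [sq_nonneg (‖h x‖ - ‖f x‖)]
  rw [← Finset.sum_div, Finset.sum_add_distrib, hhB] at h3
  linarith

/-! ### Doob's maximal inequality on the cube -/

/-- The running maximum of the absolute values of a sequence of functions. -/
def runMax (S : ℕ → Cube N → ℂ) : ℕ → Cube N → ℝ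
  | 0, x => ‖S 0 x‖
  | K + 1, x => max (runMax S K x) ‖S (K + 1) x‖

theorem norm_le_runMax (S : ℕ → Cube N → ℂ) {j K : ℕ} (h : j ≤ K) (x : Cube N) :
    ‖S j x‖ ≤ runMax S K x := by
  induction K with
  | zero => rw [Nat.le_zero.1 h]; exact le_rfl
  | succ K ih =>
    rcases Nat.le_succ_iff.1 h with h | rfl
    · exact (ih h).trans (le_max_left _ _)
    · exact le_max_right _ _

theorem runMax_nonneg (S : ℕ → Cube N → ℂ) (K : ℕ) (x : Cube N) : 0 ≤ runMax S K x :=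
  (norm_nonneg _).trans (norm_le_runMax S le_rfl x)

theorem runMax_congr (S : ℕ → Cube N → ℂ) {x y : Cube N} {K : ℕ}
    (h : ∀ j ≤ K, S j y = S j x) : runMax S K y = runMax S K x := by
  induction K with
  | zero => simp [runMax, h]
  | succ K ih => rw [runMax, runMax, ih fun j hj => h j (by omega), h _ le_rfl]

/-- A sequence of martingale differences: `d k` depends on the first `k + 1`
digits and is odd in the last of them. -/
structure IsMartingaleDiff (d : ℕ → Cube N → ℂ) : Prop where
  dependsOn : ∀ k, DependsOn (k + 1) (d k)
  flip_neg : ∀ k : Fin N, ∀ x, d k (flip k x) = -d k x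

namespace IsMartingaleDiff

variable {d : ℕ → Cube N → ℂ}

theorem dependsOn_sum (hd : IsMartingaleDiff d) (K : ℕ) :
    DependsOn K (fun x => ∑ k ∈ range K, d k x) := by
  intro x y hy
  refine Finset.sum_congr rfl fun k hk => ?_
  exact (hd.dependsOn k).mono (Finset.mem_range.1 hk) x y hy

theorem sum_sq (hd : IsMartingaleDiff d) {K : ℕ} (hK : K ≤ N) :
    ∑ x, ‖∑ k ∈ range K, d k x‖ ^ 2 = ∑ k ∈ range K, ∑ x, ‖d k x‖ ^ 2 := by
  induction K with
  | zero => simp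
  | succ K ih =>
    rw [Finset.sum_range_succ, ← ih (by omega)]
    set i : Fin N := ⟨K, hK⟩
    have h1 := sum_flip i (fun x => ‖∑ k ∈ range (K + 1), d k x‖ ^ 2)
    have h2 : ∀ x, ‖∑ k ∈ range (K + 1), d k (flip i x)‖ ^ 2 +
        ‖∑ k ∈ range (K + 1), d k x‖ ^ 2 =
        2 * (‖∑ k ∈ range K, d k x‖ ^ 2 + ‖d K x‖ ^ 2) := by
      intro x
      have h0 : ∑ k ∈ range K, d k (flip i x) = ∑ k ∈ range K, d k x :=
        hd.dependsOn_sum K x _ (flip_mem_cyl (i := i) le_rfl x)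
      rw [Finset.sum_range_succ, Finset.sum_range_succ, h0, hd.flip_neg i x]
      have := parallelogram_law_with_norm ℝ (∑ k ∈ range K, d k x) (d K x)
      rw [sub_eq_add_neg] at this
      simp only [sq]; linarith
    have h3 := Finset.sum_congr (rfl : (Finset.univ : Finset (Cube N)) = Finset.univ)
      (fun x _ => h2 x)
    rw [Finset.sum_add_distrib, h1, ← Finset.mul_sum, Finset.sum_add_distrib] at h3
    linarith

theorem sum_runMax_sq_sub_le (hd : IsMartingaleDiff d) {K : ℕ} (hK : K ≤ N) :
    ∑ x, (runMax (fun K x => ∑ k ∈ range K, d k x) K x ^ 2 -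
      2 * ‖∑ k ∈ range K, d k x‖ * runMax (fun K x => ∑ k ∈ range K, d k x) K x) ≤ 0 := by
  induction K with
  | zero => simp [runMax]
  | succ K ih =>
    refine le_trans ?_ (ih (by omega))
    set S : ℕ → Cube N → ℂ := fun K x => ∑ k ∈ range K, d k x with hS
    set i : Fin N := ⟨K, hK⟩
    have hSd : ∀ j ≤ K, ∀ x, S j (flip i x) = S j x := fun j hj x =>
      hd.dependsOn_sum j x _ (flip_mem_cyl (i := i) hj x)
    have hM : ∀ x, runMax S K (flip i x) = runMax S K x := fun x =>
      runMax_congr S fun j hj => hSd j hj x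
    have h1 : ∀ x, runMax S (K + 1) x ^ 2 - 2 * ‖S (K + 1) x‖ * runMax S (K + 1) x ≤
        runMax S K x ^ 2 - 2 * ‖S (K + 1) x‖ * runMax S K x := by
      intro x
      rw [runMax]
      rcases le_total (runMax S K x) ‖S (K + 1) x‖ with h | h
      · rw [max_eq_right h]; nlinarith [sq_nonneg (‖S (K + 1) x‖ - runMax S K x)]
      · rw [max_eq_left h]
    refine (Finset.sum_le_sum fun x _ => h1 x).trans ?_
    rw [Finset.sum_sub_distrib, Finset.sum_sub_distrib]
    have h2 : ∑ x, 2 * ‖S K x‖ * runMax S K x ≤ ∑ x, 2 * ‖S (K + 1) x‖ * runMax S K x := by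
      have h3 := sum_flip i (fun x => ‖S (K + 1) x‖ * runMax S K x)
      have h4 : ∑ x, 2 * ‖S K x‖ * runMax S K x ≤
          ∑ x, (‖S (K + 1) (flip i x)‖ * runMax S K (flip i x) +
            ‖S (K + 1) x‖ * runMax S K x) := by
        refine Finset.sum_le_sum fun x _ => ?_
        rw [hM, ← add_mul]
        refine mul_le_mul_of_nonneg_right ?_ (runMax_nonneg S K x)
        have e : (2 : ℂ) * S K x = S (K + 1) (flip i x) + S (K + 1) x := by
          have h5 : S (K + 1) x = S K x + d K x := by
            simp only [hS, Finset.sum_range_succ]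
          have h6 : S (K + 1) (flip i x) = S K (flip i x) + d K (flip i x) := by
            simp only [hS, Finset.sum_range_succ]
          rw [h5, h6, hSd K le_rfl, hd.flip_neg i x]; ring
        calc 2 * ‖S K x‖ = ‖(2 : ℂ) * S K x‖ := by simp
          _ ≤ _ := by rw [e]; exact norm_add_le _ _
      rw [Finset.sum_add_distrib, h3] at h4
      simp only [mul_assoc, ← Finset.mul_sum] at h4 ⊢
      linarith
    linarith

/-- Doob's maximal inequality in `L²`. -/
theorem sum_runMax_sq_le (hd : IsMartingaleDiff d) :
    ∑ x, runMax (fun K x => ∑ k ∈ range K, d k x) N x ^ 2 ≤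
      4 * ∑ k ∈ range N, ∑ x, ‖d k x‖ ^ 2 := by
  rw [← hd.sum_sq le_rfl]
  have h := hd.sum_runMax_sq_sub_le le_rfl
  set M := runMax (fun K x => ∑ k ∈ range K, d k x) N
  have h1 : ∑ x, M x ^ 2 ≤ ∑ x, 4 * ‖∑ k ∈ range N, d k x‖ ^ 2 +
      2 * ∑ x, (M x ^ 2 - 2 * ‖∑ k ∈ range N, d k x‖ * M x) := by
    rw [Finset.mul_sum, ← Finset.sum_add_distrib]
    refine Finset.sum_le_sum fun x _ => ?_
    nlinarith [sq_nonneg (M x - 2 * ‖∑ k ∈ range N, d k x‖)]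
  rw [← Finset.mul_sum] at h1
  linarith

end IsMartingaleDiff

/-! ### Bitiles, size, density and trees -/

/-- A bitile is recorded as `(k, I, a)`: its time interval `I` has length `2 ^ (-k)` and its
frequency interval is `[a 2 ^ (k + 1), (a + 1) 2 ^ (k + 1))`, the lower half of which carries the
wave packet. -/
abbrev Bitile (N : ℕ) := ℕ × Finset (Cube N) × ℕ

/-- The bitile of scale `k` that contains the phase space point `(x, n)`. -/
def tile (k : ℕ) (x : Cube N) (n : ℕ) : Bitile N := (k, cyl k x, n / 2 ^ (k + 1))

theorem tile_congr {k n m : ℕ} (x : Cube N) (h : n / 2 ^ (k + 1) = m / 2 ^ (k + 1)) :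
    tile k x n = tile k x m := by simp [tile, h]

theorem tile_congr_cyl {k : ℕ} (n : ℕ) {x y : Cube N} (h : y ∈ cyl k x) :
    tile k y n = tile k x n := by simp [tile, cyl_eq_of_mem h]

/-- The wave packet coefficient of `f` at the bitile `tile k x n`, normalised to be the average
over the time interval. -/
def coef (f : Cube N → ℂ) (k n : ℕ) (x : Cube N) : ℂ := avg k (fun y => f y * char (hi k n) y) x

theorem dependsOn_coef (f : Cube N → ℂ) (k n : ℕ) : DependsOn k (coef f k n) := dependsOn_avg _ _

theorem coef_congr (f : Cube N → ℂ) {k n m : ℕ} (h : n / 2 ^ (k + 1) = m / 2 ^ (k + 1)) :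
    coef f k n = coef f k m := by unfold coef; rw [hi_congr h]

/-- The part of the Carleson sum, linearised by the frequency function `n`, that runs over the
bitiles in `P`. -/
def carlesonSum (f : Cube N → ℂ) (n : Cube N → ℕ) (P : Set (Bitile N)) (x : Cube N) : ℂ :=
  ∑ k ∈ range N, if (n x).testBit k ∧ tile k x (n x) ∈ P then
    char (hi k (n x)) x * coef f k (n x) x else 0

/-- The `L¹` norm on `G` of the Carleson sum over `P`. -/
def form (f : Cube N → ℂ) (n : Cube N → ℕ) (G : Finset (Cube N)) (P : Set (Bitile N)) : ℝ :=
  ∑ x ∈ G, ‖carlesonSum f n P x‖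

/-- The squared wave packet coefficients, summed over the bitiles of `P` with time interval inside
`A` and whose upper frequency half contains `m`. The sum over bitiles is written as a sum over
scales and points, which weights a bitile by the number of points in its time interval. -/
def energy (f : Cube N → ℂ) (P : Set (Bitile N)) (m : ℕ) (A : Finset (Cube N)) : ℝ :=
  ∑ k ∈ range N, ∑ x, if m.testBit k ∧ tile k x m ∈ P ∧ cyl k x ⊆ A then ‖coef f k m x‖ ^ 2 else 0

/-- `P` has size at most `σ`. The set `A` is not required to be an interval. -/
def SizeLE (f : Cube N → ℂ) (P : Set (Bitile N)) (σ : ℝ) : Prop :=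
  ∀ m < 2 ^ N, ∀ A : Finset (Cube N), energy f P m A ≤ σ ^ 2 * A.card

/-- The points of `G` in the time interval of `tile k x m` whose chosen frequency lies in the
frequency interval of that bitile. -/
def occupied (G : Finset (Cube N)) (n : Cube N → ℕ) (k : ℕ) (x : Cube N) (m : ℕ) :
    Finset (Cube N) :=
  (cyl k x).filter fun y => y ∈ G ∧ n y / 2 ^ (k + 1) = m / 2 ^ (k + 1)

/-- `P` has density at most `δ`: the bitiles above those of `P` are occupied in proportion at most
`δ`. -/
def DensityLE (G : Finset (Cube N)) (n : Cube N → ℕ) (P : Set (Bitile N)) (δ : ℝ) : Prop :=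
  ∀ k < N, ∀ x m, tile k x m ∈ P → ∀ j ≤ k, ∀ m', m' / 2 ^ (k + 1) = m / 2 ^ (k + 1) →
    ((occupied G n j x m').card : ℝ) ≤ δ * (cyl j x).card

/-- All bitiles of `P` have a time interval inside `A` and a frequency interval containing `m`. The
set `A` is not required to be an interval, so this is a union of trees with common top frequency. -/
def IsTree (P : Set (Bitile N)) (m : ℕ) (A : Finset (Cube N)) : Prop :=
  ∀ k < N, ∀ x n, tile k x n ∈ P → n / 2 ^ (k + 1) = m / 2 ^ (k + 1) ∧ cyl k x ⊆ A

theorem energy_mono (f : Cube N → ℂ) {P Q : Set (Bitile N)} (h : P ⊆ Q) (m : ℕ)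
    (A : Finset (Cube N)) : energy f P m A ≤ energy f Q m A := by
  refine Finset.sum_le_sum fun k _ => Finset.sum_le_sum fun x _ => ?_
  by_cases h1 : m.testBit k ∧ tile k x m ∈ P ∧ cyl k x ⊆ A
  · rw [if_pos h1, if_pos ⟨h1.1, h h1.2.1, h1.2.2⟩]
  · rw [if_neg h1]; split_ifs <;> positivity

theorem SizeLE.mono {f : Cube N → ℂ} {P Q : Set (Bitile N)} {σ : ℝ} (h : P ⊆ Q)
    (hQ : SizeLE f Q σ) : SizeLE f P σ := fun m hm A => (energy_mono f h m A).trans (hQ m hm A)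

theorem DensityLE.mono {G : Finset (Cube N)} {n : Cube N → ℕ} {P Q : Set (Bitile N)} {δ : ℝ}
    (h : P ⊆ Q) (hQ : DensityLE G n Q δ) : DensityLE G n P δ :=
  fun k hk x m hm => hQ k hk x m (h hm)

/-- The size controls each single coefficient. -/
theorem SizeLE.norm_coef_le {f : Cube N → ℂ} {P : Set (Bitile N)} {σ : ℝ} (hσ : 0 ≤ σ)
    (h : SizeLE f P σ) {k n : ℕ} (hk : k < N) {x : Cube N} (hn : n < 2 ^ N)
    (hb : n.testBit k) (ht : tile k x n ∈ P) : ‖coef f k n x‖ ≤ σ := by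
  have h1 := h n hn (cyl k x)
  have h2 : ∑ y ∈ cyl k x, ‖coef f k n x‖ ^ 2 ≤ energy f P n (cyl k x) := by
    calc ∑ y ∈ cyl k x, ‖coef f k n x‖ ^ 2
        = ∑ y ∈ cyl k x, if n.testBit k ∧ tile k y n ∈ P ∧ cyl k y ⊆ cyl k x then
            ‖coef f k n y‖ ^ 2 else 0 := by
          refine Finset.sum_congr rfl fun y hy => ?_
          rw [if_pos ⟨hb, by rwa [tile_congr_cyl n hy], (cyl_eq_of_mem hy).subset⟩,
            dependsOn_coef f k n x y hy]
      _ ≤ ∑ y, if n.testBit k ∧ tile k y n ∈ P ∧ cyl k y ⊆ cyl k x then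
            ‖coef f k n y‖ ^ 2 else 0 :=
          Finset.sum_le_sum_of_subset_of_nonneg (Finset.subset_univ _)
            fun _ _ _ => by split_ifs <;> positivity
      _ ≤ _ := Finset.single_le_sum (f := fun j => ∑ y, if n.testBit j ∧ tile j y n ∈ P ∧
            cyl j y ⊆ cyl k x then ‖coef f j n y‖ ^ 2 else 0)
          (fun _ _ => Finset.sum_nonneg fun _ _ => by split_ifs <;> positivity)
          (Finset.mem_range.2 hk)
  rw [Finset.sum_const, nsmul_eq_mul] at h2
  have hc : (0 : ℝ) < (cyl k x).card := by exact_mod_cast card_cyl_pos k x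
  have h3 : ‖coef f k n x‖ ^ 2 ≤ σ ^ 2 := by
    refine le_of_mul_le_mul_left ?_ hc
    linarith
  exact abs_le_of_sq_le_sq' h3 hσ |>.2

/-- A weighted counting estimate: if `J` partitions `D` into pieces on which `φ` is constant and
each of which meets `S` in proportion at most `c`, then passing from `S` to `D` gains `c`. -/
theorem sum_le_mul_sum_of_partition {X : Type*} [DecidableEq X] {S D : Finset X}
    (J : X → Finset X) {φ : X → ℝ} {c : ℝ} (hSD : S ⊆ D) (hφ : ∀ x, 0 ≤ φ x)
    (hself : ∀ x, x ∈ J x)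
    (hJ : ∀ x ∈ D, ∀ y ∈ J x, y ∈ D ∧ J y = J x ∧ φ y = φ x)
    (hc : ∀ x ∈ D, ((S ∩ J x).card : ℝ) ≤ c * (J x).card) :
    ∑ x ∈ S, φ x ≤ c * ∑ x ∈ D, φ x := by
  have hpos : ∀ x, (0 : ℝ) < (J x).card := fun x => by
    exact_mod_cast Finset.card_pos.2 ⟨x, hself x⟩
  calc ∑ x ∈ S, φ x = ∑ x ∈ S, ∑ y ∈ J x, φ y / (J y).card := by
        refine Finset.sum_congr rfl fun x hx => ?_
        have : ∀ y ∈ J x, φ y / (J y).card = φ x / (J x).card := by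
          intro y hy
          obtain ⟨-, h1, h2⟩ := hJ x (hSD hx) y hy
          rw [h1, h2]
        rw [Finset.sum_congr rfl this, Finset.sum_const, nsmul_eq_mul]
        have := (hpos x).ne'
        field_simp
    _ = ∑ y ∈ D, ∑ x ∈ S ∩ J y, φ y / (J y).card := by
        refine Finset.sum_comm' ?_
        intro x y
        constructor
        · rintro ⟨hx, hy⟩
          obtain ⟨h0, h1, -⟩ := hJ x (hSD hx) y hy
          exact ⟨Finset.mem_inter.2 ⟨hx, h1 ▸ hself x⟩, h0⟩
        · rintro ⟨hx, hy⟩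
          obtain ⟨hx, hxy⟩ := Finset.mem_inter.1 hx
          obtain ⟨-, h1, -⟩ := hJ y hy x hxy
          exact ⟨hx, h1 ▸ hself y⟩
    _ ≤ ∑ y ∈ D, c * φ y := by
        refine Finset.sum_le_sum fun y hy => ?_
        rw [Finset.sum_const, nsmul_eq_mul, mul_div_assoc', div_le_iff₀ (hpos y)]
        nlinarith [mul_le_mul_of_nonneg_right (hc y hy) (hφ y)]
    _ = _ := by rw [Finset.mul_sum]

/-- The martingale differences attached to the part of a tree with top frequency `m` for which `m`
lies in the upper halves of the frequency intervals. -/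
def treeDiff (f : Cube N → ℂ) (T : Set (Bitile N)) (m k : ℕ) (x : Cube N) : ℂ :=
  if m.testBit k ∧ tile k x m ∈ T then char m x * char (hi k m) x * coef f k m x else 0

theorem isMartingaleDiff_treeDiff (f : Cube N → ℂ) (T : Set (Bitile N)) (m : ℕ) :
    IsMartingaleDiff (treeDiff f T m) where
  dependsOn k x y hy := by
    have hy' := cyl_anti (Nat.le_succ k) x hy
    simp only [treeDiff]
    rw [tile_congr_cyl m hy', dependsOn_coef f k m x y hy',
      char_mul_char_congr (hi_div k m).symm hy]
  flip_neg k x := by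
    have hy' : flip k x ∈ cyl k x := flip_mem_cyl le_rfl x
    simp only [treeDiff]
    rw [tile_congr_cyl m hy', dependsOn_coef f k m x _ hy', char_flip, char_flip,
      hi_testBit_of_le le_rfl]
    split_ifs <;> simp_all

/-- On a tree, the Carleson sum is controlled by the size and by the maximal function of the
martingale attached to the tree. -/
theorem norm_carlesonSum_le {f : Cube N → ℂ} {n : Cube N → ℕ} {T : Set (Bitile N)}
    {σ : ℝ} {m : ℕ} {A : Finset (Cube N)} (hn : ∀ x, n x < 2 ^ N) (hσ : 0 ≤ σ)
    (hT : IsTree T m A) (hs : SizeLE f T σ) (x : Cube N) :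
    ‖carlesonSum f n T x‖ ≤
      σ + 2 * runMax (fun K x => ∑ k ∈ range K, treeDiff f T m k x) N x := by
  -- Bitiles whose lower half contains `m`: at most one of them contributes at `x`.
  set D : ℕ → Prop := fun k => ((n x).testBit k ∧ tile k x (n x) ∈ T) ∧ ¬ m.testBit k with hD
  have hDuniq : ∀ j k, j < N → k < N → D j → D k → ¬ j < k := by
    intro j k hj hk h1 h2 hjk
    have h3 := (hT j hj x _ h1.1.2).1
    have h4 := testBit_eq_of_div_eq h3 (show j + 1 ≤ k from hjk)
    rw [h2.1.1] at h4
    exact h2.2 h4.symm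
  have hsplit : carlesonSum f n T x =
      (∑ k ∈ range N, if D k then char (hi k (n x)) x * coef f k (n x) x else 0) +
      ∑ k ∈ range N, (if ((n x).testBit k ∧ tile k x (n x) ∈ T) ∧ m.testBit k then
        char (hi k (n x)) x * coef f k (n x) x else 0) := by
    rw [carlesonSum, ← Finset.sum_add_distrib]
    refine Finset.sum_congr rfl fun k _ => ?_
    by_cases h1 : (n x).testBit k ∧ tile k x (n x) ∈ T <;> by_cases h2 : m.testBit k <;>
      simp [hD, h1, h2]
  rw [hsplit]
  refine (norm_add_le _ _).trans (add_le_add ?_ ?_)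
  · by_cases h : ∃ j < N, D j
    · obtain ⟨j, hj, hDj⟩ := h
      rw [Finset.sum_eq_single_of_mem j (Finset.mem_range.2 hj), if_pos hDj, norm_mul, norm_char,
        one_mul]
      · exact hs.norm_coef_le hσ hj (hn x) hDj.1.1 hDj.1.2
      · intro k hk hkj
        have hk := Finset.mem_range.1 hk
        rw [if_neg]
        intro hDk
        rcases lt_or_gt_of_ne hkj with h | h
        · exact hDuniq k j hk hj hDk hDj h
        · exact hDuniq j k hj hk hDj hDk h
    · push Not at h
      rw [Finset.sum_eq_zero]
      · simpa using hσ
      · intro k hk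
        rw [if_neg (h k (Finset.mem_range.1 hk))]
  · -- The remaining scales are those above the first scale from which `n x` and `m` agree.
    set d := treeDiff f T m with hd
    have hex : ∃ k0, ∀ k, k0 ≤ k ↔ n x / 2 ^ k = m / 2 ^ k := by
      have h0 : ∃ k, n x / 2 ^ k = m / 2 ^ k := by
        refine ⟨n x + m, ?_⟩
        have e1 := (Nat.lt_two_pow_self (n := n x + m))
        rw [Nat.div_eq_of_lt (by omega), Nat.div_eq_of_lt (by omega)]
      refine ⟨Nat.find h0, fun k => ⟨fun h => div_two_pow_eq_of_le h (Nat.find_spec h0),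
        fun h => Nat.find_min' h0 h⟩⟩
    obtain ⟨k0, hk0⟩ := hex
    have hterm : ∀ k ∈ range N,
        (if ((n x).testBit k ∧ tile k x (n x) ∈ T) ∧ m.testBit k then
          char (hi k (n x)) x * coef f k (n x) x else 0) =
        char m x * if k0 ≤ k then d k x else 0 := by
      intro k hk
      have hk := Finset.mem_range.1 hk
      by_cases h : k0 ≤ k
      · have e := (hk0 k).1 h
        have e' := div_two_pow_eq_of_le (Nat.le_succ k) e
        rw [if_pos h, hd, treeDiff, testBit_eq_of_div_eq e le_rfl, tile_congr x e', hi_congr e',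
          coef_congr f e']
        by_cases h1 : m.testBit k <;> by_cases h2 : tile k x m ∈ T <;> simp [h1, h2]
        rw [← mul_assoc, ← mul_assoc, char_mul_self, one_mul]
      · rw [if_neg h, mul_zero, if_neg]
        rintro ⟨⟨h1, h2⟩, h3⟩
        refine h ((hk0 k).2 (div_eq_of_succ (hT k hk x _ h2).1 (by rw [h1, h3])))
    rw [Finset.sum_congr rfl hterm, ← Finset.mul_sum, norm_mul, norm_char, one_mul]
    have hmin : ∑ k ∈ range N, (if k0 ≤ k then d k x else 0) =
        ∑ k ∈ range N, d k x - ∑ k ∈ range (min k0 N), d k x := by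
      have e : range (min k0 N) = (range N).filter fun k => ¬ k0 ≤ k := by
        ext k; simp; omega
      rw [eq_sub_iff_add_eq, e, ← Finset.sum_filter]
      exact Finset.sum_filter_add_sum_filter_not _ _ _
    rw [hmin]
    refine (norm_sub_le _ _).trans ?_
    have h1 := norm_le_runMax (fun K x => ∑ k ∈ range K, d k x) (le_refl N) x
    have h2 := norm_le_runMax (fun K x => ∑ k ∈ range K, d k x) (min_le_right k0 N) x
    linarith

theorem carlesonSum_eq_zero {f : Cube N → ℂ} {n : Cube N → ℕ} {P : Set (Bitile N)} {x : Cube N}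
    (h : ¬ ∃ k < N, tile k x (n x) ∈ P) : carlesonSum f n P x = 0 := by
  refine Finset.sum_eq_zero fun k hk => if_neg fun h' => h ⟨k, Finset.mem_range.1 hk, h'.2⟩

/-- The tree estimate. -/
theorem form_tree_le {f : Cube N → ℂ} {n : Cube N → ℕ} {G : Finset (Cube N)} {T : Set (Bitile N)}
    {σ δ : ℝ} {m : ℕ} {A : Finset (Cube N)} (hn : ∀ x, n x < 2 ^ N) (hm : m < 2 ^ N)
    (hσ : 0 ≤ σ) (hδ : 0 ≤ δ) (hT : IsTree T m A) (hs : SizeLE f T σ)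
    (hdens : DensityLE G n T δ) :
    form f n G T ≤ 10 * δ * σ * A.card := by
  set S : Finset (Cube N) := G.filter fun x => ∃ k < N, tile k x (n x) ∈ T with hS
  -- `Q k x`: the interval of scale `k` around `x` lies in `A` and contains the time interval
  -- of a bitile of the tree.
  set Q : ℕ → Cube N → Prop := fun k x => k < N ∧ cyl k x ⊆ A ∧
    ∃ j, k ≤ j ∧ j < N ∧ ∃ y ∈ cyl k x, tile j y m ∈ T with hQ
  set D : Finset (Cube N) := Finset.univ.filter fun x => ∃ k, Q k x with hDdef
  set L : Cube N → ℕ := fun x => Nat.findGreatest (fun k => Q k x) N with hL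
  have hLspec : ∀ x ∈ D, Q (L x) x := by
    intro x hx
    obtain ⟨k, hk⟩ := (Finset.mem_filter.1 hx).2
    exact Nat.findGreatest_spec (P := fun k => Q k x) hk.1.le hk
  have hLge : ∀ x k, Q k x → k ≤ L x := fun x k hk => Nat.le_findGreatest hk.1.le hk
  have hcongr : ∀ x ∈ D, ∀ y ∈ cyl (L x + 1) x, y ∈ D ∧ L y = L x := by
    intro x hx y hy
    have hyL : y ∈ cyl (L x) x := cyl_anti (Nat.le_succ _) x hy
    have h1 : Q (L x) y := by
      have := hLspec x hx
      simp only [hQ, cyl_eq_of_mem hyL] at this ⊢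
      exact this
    have hyD : y ∈ D := Finset.mem_filter.2 ⟨Finset.mem_univ _, _, h1⟩
    refine ⟨hyD, le_antisymm ?_ (hLge y _ h1)⟩
    by_contra! hlt
    obtain ⟨e1, -, j, e2, e3, z, hz, hzT⟩ := hLspec y hyD
    have : Q (L x + 1) x := by
      refine ⟨by omega, (cyl_anti (Nat.le_succ _) x).trans (hLspec x hx).2.1, j, by omega, e3, z,
        ?_, hzT⟩
      rw [← cyl_eq_of_mem hy]
      exact cyl_anti (by omega) y hz
    have := hLge x _ this
    omega
  set M : Cube N → ℝ := runMax (fun K x => ∑ k ∈ range K, treeDiff f T m k x) N with hM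
  have hMnn : ∀ x, 0 ≤ M x := fun x => runMax_nonneg _ _ _
  have hTQ : ∀ x k, k < N → tile k x m ∈ T → Q k x := fun x k hk h =>
    ⟨hk, (hT k hk x m h).2, k, le_rfl, hk, x, self_mem_cyl k x, h⟩
  have hMcongr : ∀ x ∈ D, ∀ y ∈ cyl (L x + 1) x, M y = M x := by
    intro x hx y hy
    refine runMax_congr _ fun K hK => ?_
    refine Finset.sum_congr rfl fun k hk => ?_
    have hkN : k < N := (Finset.mem_range.1 hk).trans_le hK
    rcases le_or_gt k (L x) with h | h
    · exact ((isMartingaleDiff_treeDiff f T m).dependsOn k) x y (cyl_anti (by omega) x hy)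
    · have hz : ∀ z, L z = L x → treeDiff f T m k z = 0 := by
        intro z hz
        refine if_neg fun h' => ?_
        have := hLge z k (hTQ z k hkN h'.2)
        omega
      rw [hz y (hcongr x hx y hy).2, hz x rfl]
  have hSQ : ∀ x ∈ S, ∃ k, Q k x ∧ n x / 2 ^ (k + 1) = m / 2 ^ (k + 1) := by
    intro x hx
    obtain ⟨-, k, hk, hkT⟩ := Finset.mem_filter.1 hx
    have e := (hT k hk x _ hkT).1
    exact ⟨k, hTQ x k hk (by rwa [← tile_congr x e]), e⟩
  have hSD : S ⊆ D := by
    intro x hx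
    obtain ⟨k, hk, -⟩ := hSQ x hx
    exact Finset.mem_filter.2 ⟨Finset.mem_univ _, k, hk⟩
  have hDA : D ⊆ A := fun x hx => (hLspec x hx).2.1 (self_mem_cyl _ x)
  have h1 : form f n G T ≤ ∑ x ∈ S, (σ + 2 * M x) := by
    rw [form, hS, Finset.sum_filter]
    refine Finset.sum_le_sum fun x _ => ?_
    split_ifs with h
    · exact norm_carlesonSum_le hn hσ hT hs x
    · rw [carlesonSum_eq_zero h, norm_zero]
  have h2 : ∑ x ∈ S, (σ + 2 * M x) ≤ (2 * δ) * ∑ x ∈ D, (σ + 2 * M x) := by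
    refine sum_le_mul_sum_of_partition (fun x => cyl (L x + 1) x) hSD
      (fun x => by have := hMnn x; positivity) (fun x => self_mem_cyl _ x) ?_ ?_
    · intro x hx y hy
      obtain ⟨a, b⟩ := hcongr x hx y hy
      exact ⟨a, by rw [b, cyl_eq_of_mem hy], by rw [hMcongr x hx y hy]⟩
    · intro x hx
      obtain ⟨e1, -, j, e2, e3, z, hz, hzT⟩ := hLspec x hx
      have h3 := hdens j e3 z m hzT (L x) e2 m rfl
      rw [cyl_eq_of_mem hz, card_cyl_eq (L x) e1 x] at h3
      have h4 : S ∩ cyl (L x + 1) x ⊆ occupied G n (L x) z m := by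
        intro y hy
        obtain ⟨hyS, hyc⟩ := Finset.mem_inter.1 hy
        obtain ⟨k, hk, hke⟩ := hSQ y hyS
        have hkL := hLge y k hk
        rw [(hcongr x hx y hyc).2] at hkL
        refine Finset.mem_filter.2 ⟨?_, (Finset.mem_filter.1 hyS).1,
          div_two_pow_eq_of_le (by omega) hke⟩
        rw [cyl_eq_of_mem hz]
        exact cyl_anti (Nat.le_succ _) x hyc
      have h5 : ((S ∩ cyl (L x + 1) x).card : ℝ) ≤ (occupied G n (L x) z m).card := by
        exact_mod_cast Finset.card_le_card h4
      push_cast at h3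
      linarith
  have h3 : ∑ x ∈ D, (σ + 2 * M x) ≤ ∑ x ∈ A, (σ + 2 * M x) :=
    Finset.sum_le_sum_of_subset_of_nonneg hDA fun x _ _ => by have := hMnn x; positivity
  have h4 : ∑ x ∈ A, M x ≤ 2 * σ * A.card := by
    have e1 : ∑ x, M x ^ 2 ≤ 4 * (σ ^ 2 * A.card) := by
      refine ((isMartingaleDiff_treeDiff f T m).sum_runMax_sq_le).trans ?_
      refine mul_le_mul_of_nonneg_left ((le_of_eq ?_).trans (hs m hm A)) (by norm_num)
      refine Finset.sum_congr rfl fun k hk => Finset.sum_congr rfl fun x _ => ?_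
      by_cases h : m.testBit k ∧ tile k x m ∈ T
      · rw [treeDiff, if_pos h, if_pos ⟨h.1, h.2, (hT k (Finset.mem_range.1 hk) x m h.2).2⟩]
        simp
      · rw [treeDiff, if_neg h, if_neg fun h' => h ⟨h'.1, h'.2.1⟩]; simp
    have e2 : ∑ x ∈ A, M x ^ 2 ≤ 4 * (σ ^ 2 * A.card) :=
      (Finset.sum_le_sum_of_subset_of_nonneg (Finset.subset_univ _)
        fun _ _ _ => sq_nonneg _).trans e1
    have e3 := sq_sum_le_card_mul_sum_sq (s := A) (f := M)
    have e4 : (∑ x ∈ A, M x) ^ 2 ≤ (2 * σ * A.card) ^ 2 := by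
      have : (A.card : ℝ) * ∑ x ∈ A, M x ^ 2 ≤ A.card * (4 * (σ ^ 2 * A.card)) :=
        mul_le_mul_of_nonneg_left e2 (Nat.cast_nonneg _)
      nlinarith
    exact (abs_le_of_sq_le_sq' e4 (by positivity)).2
  have h5 : ∑ x ∈ A, (σ + 2 * M x) ≤ 5 * σ * A.card := by
    rw [Finset.sum_add_distrib, ← Finset.mul_sum, Finset.sum_const, nsmul_eq_mul]
    linarith
  calc form f n G T ≤ (2 * δ) * (5 * σ * A.card) :=
        h1.trans (h2.trans (mul_le_mul_of_nonneg_left (h3.trans h5) (by positivity)))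
    _ = _ := by ring

/-! ### Decomposition into forests according to size -/

theorem energy_nonneg (f : Cube N → ℂ) (P : Set (Bitile N)) (m : ℕ) (A : Finset (Cube N)) :
    0 ≤ energy f P m A :=
  Finset.sum_nonneg fun _ _ => Finset.sum_nonneg fun _ _ => by split_ifs <;> positivity

/-- The bitiles with time interval inside `A` whose frequency interval contains `m`. -/
def below (m : ℕ) (A : Finset (Cube N)) : Set (Bitile N) :=
  {s | s.2.2 = m / 2 ^ (s.1 + 1) ∧ s.2.1 ⊆ A}

theorem tile_mem_below {k n m : ℕ} {x : Cube N} {A : Finset (Cube N)} :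
    tile k x n ∈ below m A ↔ n / 2 ^ (k + 1) = m / 2 ^ (k + 1) ∧ cyl k x ⊆ A := Iff.rfl

/-- One step of the size selection: `A` maximises the supermodular functional
`energy f P m A - σ ^ 2 * A.card`. If the second bound failed for some `B`, then `A ∪ B` would be
better than `A`. -/
theorem exists_energy_max (f : Cube N → ℂ) (σ : ℝ) (P : Set (Bitile N)) (m : ℕ) :
    ∃ A : Finset (Cube N), σ ^ 2 * A.card ≤ energy f P m A ∧
      ∀ B : Finset (Cube N), energy f (P \ below m A) m B ≤ σ ^ 2 * B.card := by
  obtain ⟨A, -, hA⟩ := Finset.exists_max_image (Finset.univ : Finset (Finset (Cube N)))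
    (fun A => energy f P m A - σ ^ 2 * A.card) ⟨∅, Finset.mem_univ _⟩
  refine ⟨A, ?_, fun B => ?_⟩
  · have h1 := hA ∅ (Finset.mem_univ _)
    have h2 := energy_nonneg f P m ∅
    simp only [Finset.card_empty, Nat.cast_zero, mul_zero, sub_zero] at h1
    linarith
  · have h1 := hA (A ∪ B) (Finset.mem_univ _)
    have h2 : energy f P m A + energy f (P \ below m A) m B ≤ energy f P m (A ∪ B) := by
      simp only [energy]
      rw [← Finset.sum_add_distrib]
      refine Finset.sum_le_sum fun k _ => ?_
      rw [← Finset.sum_add_distrib]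
      refine Finset.sum_le_sum fun x _ => ?_
      have hp := sq_nonneg ‖coef f k m x‖
      by_cases c1 : m.testBit k ∧ tile k x m ∈ P ∧ cyl k x ⊆ A
      · rw [if_pos c1, if_neg, if_pos ⟨c1.1, c1.2.1, c1.2.2.trans Finset.subset_union_left⟩,
          add_zero]
        exact fun h => h.2.1.2 (tile_mem_below.2 ⟨rfl, c1.2.2⟩)
      · rw [if_neg c1, zero_add]
        by_cases c2 : m.testBit k ∧ tile k x m ∈ P \ below m A ∧ cyl k x ⊆ B
        · rw [if_pos c2, if_pos ⟨c2.1, c2.2.1.1, c2.2.2.trans Finset.subset_union_right⟩]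
        · rw [if_neg c2]; split_ifs <;> positivity
    have h3 : ((A ∪ B).card : ℝ) ≤ A.card + B.card := by exact_mod_cast Finset.card_union_le A B
    have h4 := mul_le_mul_of_nonneg_left h3 (sq_nonneg σ)
    linarith

/-- `P` is covered by trees with top frequencies `m < 2 ^ N` and time sets `A m`. -/
def IsForest (P : Set (Bitile N)) (A : ℕ → Finset (Cube N)) : Prop :=
  ∀ k < N, ∀ x n, tile k x n ∈ P →
    ∃ m < 2 ^ N, n / 2 ^ (k + 1) = m / 2 ^ (k + 1) ∧ cyl k x ⊆ A m

theorem IsForest.mono {P Q : Set (Bitile N)} {A : ℕ → Finset (Cube N)} (h : P ⊆ Q)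
    (hQ : IsForest Q A) : IsForest P A := fun k hk x n hn => hQ k hk x n (h hn)

/-- The bitiles of large size form a forest with controlled total top length. Top frequencies are
processed in increasing order, which makes the selected wave packets orthogonal. -/
theorem exists_size_decomposition (f : Cube N → ℂ) (P : Set (Bitile N)) (σ : ℝ) :
    ∃ P' ⊆ P, ∃ A : ℕ → Finset (Cube N), SizeLE f P' σ ∧ IsForest (P \ P') A ∧
      σ ^ 2 * ∑ m ∈ range (2 ^ N), ((A m).card : ℝ) ≤ ∑ x, ‖f x‖ ^ 2 := by
  choose bad hbad1 hbad2 using exists_energy_max f σ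
  set R : ℕ → Set (Bitile N) := fun m => Nat.rec P (fun m Q => Q \ below m (bad Q m)) m with hR
  have hRsucc : ∀ m, R (m + 1) = R m \ below m (bad (R m) m) := fun m => rfl
  have hRanti : Antitone R := antitone_nat_of_succ_le fun m => by
    rw [hRsucc]; exact sdiff_subset
  set A : ℕ → Finset (Cube N) := fun m => bad (R m) m with hA
  refine ⟨R (2 ^ N), hRanti (Nat.zero_le _), A, ?_, ?_, ?_⟩
  · intro m hm B
    exact (energy_mono f (hRanti (Nat.succ_le_of_lt hm)) m B).trans (hbad2 (R m) m B)
  · intro k _ x n hn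
    by_contra! hc
    refine hn.2 ?_
    have : ∀ m ≤ 2 ^ N, tile k x n ∈ R m := by
      intro m
      induction m with
      | zero => exact fun _ => hn.1
      | succ m ih =>
        intro hm
        rw [hRsucc]
        exact ⟨ih (by omega), fun h => hc m (by omega) h.1 h.2⟩
    exact this _ le_rfl
  · set V : ℕ × ℕ → Set (Cube N) := fun i =>
      {x | i.1.testBit i.2 ∧ tile i.2 x i.1 ∈ R i.1 ∧ cyl i.2 x ⊆ A i.1} with hV
    -- A bitile selected with top frequency `m` is removed from all later collections.
    have hlater : ∀ k x m m', tile k x m ∈ below m (A m) → m < m' → tile k x m ∉ R m' := by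
      intro k x m m' h hlt h'
      exact (hRanti (Nat.succ_le_of_lt hlt) h').2 h
    have key := bessel (range (2 ^ N) ×ˢ range N) (fun i => i.2) (fun i => hi i.2 i.1) V
      (fun i hi' => (hi_le _ _).trans_lt
        (Finset.mem_range.1 (Finset.mem_product.1 hi').1))
      (fun i _ x y hy => by
        simp only [hV, mem_ofPred_eq, tile_congr_cyl i.1 hy, cyl_eq_of_mem hy]) ?_ f
    · refine le_trans ?_ key
      rw [Finset.mul_sum, Finset.sum_product]
      exact Finset.sum_le_sum fun m _ => hbad1 (R m) m
    · rintro ⟨m, k⟩ hi1 ⟨m', k'⟩ hj1 hne hkk x ⟨b1, t1, c1⟩ ⟨b2, t2, c2⟩ heq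
      simp only at b1 t1 c1 b2 t2 c2 hkk heq
      rcases hkk.eq_or_lt with rfl | hlt
      · -- Same scale: the two bitiles coincide, so the earlier top frequency would remove it.
        have hmm : m / 2 ^ (k + 1) = m' / 2 ^ (k + 1) := by
          rw [← hi_div k m, ← hi_div k m']
          exact div_two_pow_eq_of_le (Nat.le_succ k) heq
        have hne' : m ≠ m' := fun h => hne (by rw [h])
        rcases lt_or_gt_of_ne hne' with h | h
        · exact hlater k x m m' ⟨rfl, c1⟩ h (by rwa [tile_congr x hmm])
        · exact hlater k x m' m ⟨rfl, c2⟩ h (by rwa [← tile_congr x hmm])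
      · -- Nested time intervals: the top frequency of the smaller one is the larger.
        have e1 : m / 2 ^ k' = hi k' m' / 2 ^ k' := by
          rw [← heq]
          exact div_two_pow_eq_of_le (show k + 1 ≤ k' from hlt) (hi_div k m).symm
        have e2 : m / 2 ^ (k' + 1) = m' / 2 ^ (k' + 1) := by
          rw [← hi_div k' m']
          exact div_two_pow_eq_of_le (Nat.le_succ k') e1
        have b3 : m.testBit k' = false := by
          rw [testBit_eq_of_div_eq e1 le_rfl, hi_testBit_of_le le_rfl]
        have hmm : m < m' :=
          Nat.lt_of_testBit k' b3 b2 fun j hj => testBit_eq_of_div_eq e2 hj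
        refine hlater k' x m m' ⟨rfl, (cyl_anti hlt.le x).trans c1⟩ hmm ?_
        rwa [tile_congr x e2]

/-! ### The `L²` estimate for forests -/

theorem form_le_sum {f : Cube N → ℂ} {n : Cube N → ℕ} {G : Finset (Cube N)} {P : Set (Bitile N)}
    {M : ℕ} {T : ℕ → Set (Bitile N)} (hT : ∀ m < M, T m ⊆ P)
    (hex : ∀ k < N, ∀ x n, tile k x n ∈ P → ∃ m < M, tile k x n ∈ T m)
    (hu : ∀ i < M, ∀ j < M, i ≠ j → Disjoint (T i) (T j)) :
    form f n G P ≤ ∑ m ∈ range M, form f n G (T m) := by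
  simp only [form]
  rw [Finset.sum_comm]
  refine Finset.sum_le_sum fun x _ => ?_
  have : carlesonSum f n P x = ∑ m ∈ range M, carlesonSum f n (T m) x := by
    simp only [carlesonSum]
    rw [Finset.sum_comm]
    refine Finset.sum_congr rfl fun k hk => ?_
    have hk := Finset.mem_range.1 hk
    by_cases h : (n x).testBit k ∧ tile k x (n x) ∈ P
    · obtain ⟨m, hm, hmT⟩ := hex k hk x _ h.2
      rw [if_pos h, Finset.sum_eq_single_of_mem m (Finset.mem_range.2 hm), if_pos ⟨h.1, hmT⟩]
      intro j hj hjm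
      refine if_neg fun h' => ?_
      exact Set.disjoint_left.1 (hu j (Finset.mem_range.1 hj) m hm hjm) h'.2 hmT
    · rw [if_neg h, Finset.sum_eq_zero]
      intro m hm
      exact if_neg fun h' => h ⟨h'.1, hT m (Finset.mem_range.1 hm) h'.2⟩
  rw [this]
  exact norm_sum_le _ _

theorem form_le_add_diff (f : Cube N → ℂ) (n : Cube N → ℕ) (G : Finset (Cube N))
    {P P' : Set (Bitile N)} (h : P' ⊆ P) :
    form f n G P ≤ form f n G P' + form f n G (P \ P') := by
  have := form_le_sum (f := f) (n := n) (G := G) (P := P) (M := 2)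
    (T := fun m => if m = 0 then P' else P \ P') ?_ ?_ ?_
  · simpa [Finset.sum_range_succ] using this
  · intro m _; split_ifs
    · exact h
    · exact sdiff_subset
  · intro k _ x n hx
    by_cases h' : tile k x n ∈ P'
    · exact ⟨0, by norm_num, by simpa using h'⟩
    · exact ⟨1, by norm_num, by simpa using ⟨hx, h'⟩⟩
  · intro i hi j hj hij
    have : (i = 0 ∧ j = 1) ∨ (i = 1 ∧ j = 0) := by omega
    rcases this with ⟨rfl, rfl⟩ | ⟨rfl, rfl⟩
    · simpa using disjoint_sdiff_right
    · simpa using disjoint_sdiff_left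

theorem form_forest_le {f : Cube N → ℂ} {n : Cube N → ℕ} {G : Finset (Cube N)}
    {P : Set (Bitile N)} {σ δ : ℝ} {A : ℕ → Finset (Cube N)} (hn : ∀ x, n x < 2 ^ N)
    (hσ : 0 ≤ σ) (hδ : 0 ≤ δ) (hA : IsForest P A) (hs : SizeLE f P σ) (hd : DensityLE G n P δ) :
    form f n G P ≤ 10 * δ * σ * ∑ m ∈ range (2 ^ N), ((A m).card : ℝ) := by
  -- Each bitile is assigned to the first tree that contains it.
  set T : ℕ → Set (Bitile N) := fun m =>
    {s | s ∈ P ∧ s ∈ below m (A m) ∧ ∀ j < m, s ∉ below j (A j)} with hT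
  have hTP : ∀ m, T m ⊆ P := fun m s hs => hs.1
  have h1 : form f n G P ≤ ∑ m ∈ range (2 ^ N), form f n G (T m) := by
    refine form_le_sum (fun m _ => hTP m) ?_ ?_
    · intro k hk x n hx
      have hex : ∃ m, tile k x n ∈ below m (A m) := by
        obtain ⟨m, -, h⟩ := hA k hk x n hx
        exact ⟨m, h⟩
      obtain ⟨m, hm, h⟩ := hA k hk x n hx
      exact ⟨Nat.find hex, (Nat.find_min' hex h).trans_lt hm, hx, Nat.find_spec hex,
        fun j hj => Nat.find_min hex hj⟩
    · intro i _ j _ hij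
      rw [Set.disjoint_left]
      rintro s ⟨-, h1, h2⟩ ⟨-, h3, h4⟩
      rcases lt_or_gt_of_ne hij with h | h
      · exact h4 i h h1
      · exact h2 j h h3
  refine h1.trans ?_
  rw [Finset.mul_sum]
  refine Finset.sum_le_sum fun m hm => ?_
  exact form_tree_le hn (Finset.mem_range.1 hm) hσ hδ (fun k _ x n h => h.2.1)
    (hs.mono (hTP m)) (hd.mono (hTP m))

theorem exists_sizeLE (f : Cube N → ℂ) (P : Set (Bitile N)) {σ : ℝ} (hσ : 0 < σ) :
    ∃ i : ℕ, SizeLE f P (2 ^ i * σ) := by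
  set E : ℝ := ∑ m ∈ range (2 ^ N), energy f P m Finset.univ with hE
  obtain ⟨i, hi⟩ := pow_unbounded_of_one_lt ((E + 1) / σ) (one_lt_two)
  refine ⟨i, fun m hm A => ?_⟩
  have hE0 : 0 ≤ E := Finset.sum_nonneg fun m _ => energy_nonneg _ _ _ _
  have h1 : E + 1 ≤ 2 ^ i * σ := by rw [div_lt_iff₀ hσ] at hi; exact hi.le
  have h2 : E ≤ (2 ^ i * σ) ^ 2 := by nlinarith
  rcases A.eq_empty_or_nonempty with rfl | hne
  · rw [energy, Finset.sum_eq_zero]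
    · simp
    · intro k _
      refine Finset.sum_eq_zero fun x _ => if_neg fun h => ?_
      simpa using h.2.2 (self_mem_cyl k x)
  · have h3 : (1 : ℝ) ≤ A.card := by exact_mod_cast Finset.card_pos.2 hne
    have h4 : energy f P m A ≤ energy f P m Finset.univ := by
      refine Finset.sum_le_sum fun k _ => Finset.sum_le_sum fun x _ => ?_
      by_cases h : m.testBit k ∧ tile k x m ∈ P ∧ cyl k x ⊆ A
      · rw [if_pos h, if_pos ⟨h.1, h.2.1, Finset.subset_univ _⟩]
      · rw [if_neg h]; split_ifs <;> positivity
    have h5 : energy f P m Finset.univ ≤ E :=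
      Finset.single_le_sum (f := fun m => energy f P m Finset.univ)
        (fun m _ => energy_nonneg _ _ _ _) (Finset.mem_range.2 hm)
    have h6 : 0 ≤ (2 ^ i * σ) ^ 2 := sq_nonneg _
    nlinarith

/-- For bitiles of density at most `δ` covered by a forest of total top length `B`, large sizes are
handled by the size selection and small sizes by the given forest; `σ` is the threshold. -/
theorem form_le_of_density {f : Cube N → ℂ} {n : Cube N → ℕ} {G : Finset (Cube N)}
    {P : Set (Bitile N)} {σ δ B : ℝ} {A : ℕ → Finset (Cube N)} (hn : ∀ x, n x < 2 ^ N)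
    (hσ : 0 < σ) (hδ : 0 ≤ δ) (hA : IsForest P A) (hd : DensityLE G n P δ)
    (hB : ∑ m ∈ range (2 ^ N), ((A m).card : ℝ) ≤ B) :
    form f n G P ≤ 10 * δ * σ * B + 40 * δ * (∑ x, ‖f x‖ ^ 2) / σ := by
  set F : ℝ := ∑ x, ‖f x‖ ^ 2 with hF
  have hF0 : 0 ≤ F := Finset.sum_nonneg fun _ _ => sq_nonneg _
  have key : ∀ i : ℕ, ∀ P' ⊆ P, SizeLE f P' (2 ^ i * σ) →
      form f n G P' ≤ 10 * δ * σ * B + 40 * δ * F / σ * (1 - (1 / 2) ^ i) := by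
    intro i
    induction i with
    | zero =>
      intro P' hP' hs
      rw [pow_zero, one_mul] at hs
      refine (form_forest_le hn hσ.le hδ (hA.mono hP') hs (hd.mono hP')).trans ?_
      have : 0 ≤ 10 * δ * σ := by positivity
      have := mul_le_mul_of_nonneg_left hB this
      simpa using this
    | succ i ih =>
      intro P' hP' hs
      obtain ⟨Q, hQ, A', h1, h2, h3⟩ := exists_size_decomposition f P' (2 ^ i * σ)
      have h4 := ih Q (hQ.trans hP') h1
      have hsub : P' \ Q ⊆ P' := sdiff_subset
      have h5 := form_forest_le hn (by positivity) hδ h2 (hs.mono hsub)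
        (hd.mono (hsub.trans hP'))
      have h6 := form_le_add_diff f n G hQ
      have hpos : (0 : ℝ) < 2 ^ i * σ := by positivity
      have h7 : ∑ m ∈ range (2 ^ N), ((A' m).card : ℝ) ≤ F / (2 ^ i * σ) ^ 2 := by
        rw [le_div_iff₀ (by positivity)]; linarith
      have h8 : 10 * δ * (2 ^ (i + 1) * σ) * ∑ m ∈ range (2 ^ N), ((A' m).card : ℝ) ≤
          10 * δ * (2 ^ (i + 1) * σ) * (F / (2 ^ i * σ) ^ 2) :=
        mul_le_mul_of_nonneg_left h7 (by positivity)
      have h9 : 10 * δ * (2 ^ (i + 1) * σ) * (F / (2 ^ i * σ) ^ 2) =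
          40 * δ * F / σ * ((1 / 2) ^ i - (1 / 2) ^ (i + 1)) := by
        rw [one_div, inv_pow, inv_pow, pow_succ]
        field_simp
        ring
      linarith
  obtain ⟨i, hi⟩ := exists_sizeLE f P hσ
  refine (key i P subset_rfl hi).trans ?_
  have h1 : 0 ≤ 40 * δ * F / σ := by positivity
  have h2 : (0 : ℝ) ≤ (1 / 2) ^ i := by positivity
  nlinarith

/-! ### The forest of bitiles of given density -/

/-- The bitiles of density at most `δ`. -/
def light (G : Finset (Cube N)) (n : Cube N → ℕ) (δ : ℝ) : Set (Bitile N) :=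
  {s | ∀ k x m, tile k x m = s → ∀ j ≤ k, ∀ m', m' / 2 ^ (k + 1) = m / 2 ^ (k + 1) →
    ((occupied G n j x m').card : ℝ) ≤ δ * (cyl j x).card}

theorem densityLE_of_subset_light {G : Finset (Cube N)} {n : Cube N → ℕ} {δ : ℝ}
    {P : Set (Bitile N)} (h : P ⊆ light G n δ) : DensityLE G n P δ :=
  fun k _ x m hm j hj m' hm' => h hm k x m rfl j hj m' hm'

theorem light_mono (G : Finset (Cube N)) (n : Cube N → ℕ) {δ δ' : ℝ} (h : δ ≤ δ') :
    light G n δ ⊆ light G n δ' := fun _ hs k x m e j hj m' hm' =>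
  (hs k x m e j hj m' hm').trans (mul_le_mul_of_nonneg_right h (Nat.cast_nonneg _))

theorem light_one (G : Finset (Cube N)) (n : Cube N → ℕ) : light G n 1 = Set.univ := by
  refine Set.eq_univ_of_forall fun s k x m _ j _ m' _ => ?_
  rw [one_mul]
  exact_mod_cast Finset.card_le_card (Finset.filter_subset _ _)

theorem occupied_congr (G : Finset (Cube N)) (n : Cube N → ℕ) {k m m' : ℕ} {x y : Cube N}
    (hy : y ∈ cyl k x) (hm : m' / 2 ^ (k + 1) = m / 2 ^ (k + 1)) :
    occupied G n k y m' = occupied G n k x m := by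
  simp [occupied, cyl_eq_of_mem hy, hm]

/-- Bitiles that are not light lie below a maximal heavily occupied bitile. The occupying sets of
the maximal ones are disjoint, which bounds their total length. -/
theorem exists_density_forest {G : Finset (Cube N)} {n : Cube N → ℕ} {δ : ℝ}
    (hn : ∀ x, n x < 2 ^ N) (hδ : 0 < δ) {P : Set (Bitile N)} (hP : Disjoint P (light G n δ)) :
    ∃ A : ℕ → Finset (Cube N), IsForest P A ∧
      ∑ m ∈ range (2 ^ N), ((A m).card : ℝ) ≤ G.card / δ := by
  set heavy : ℕ → Cube N → ℕ → Prop := fun k x m =>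
    δ * (cyl k x).card < (occupied G n k x m).card with hheavy
  have hcongr : ∀ k x y m m', y ∈ cyl k x → m' / 2 ^ (k + 1) = m / 2 ^ (k + 1) →
      (heavy k y m' ↔ heavy k x m) := by
    intro k x y m m' hy hm
    simp only [hheavy, occupied_congr G n hy hm, cyl_eq_of_mem hy]
  set hmax : ℕ → Cube N → ℕ → Prop := fun k x m => heavy k x m ∧
    ∀ j < k, ∀ m', m' / 2 ^ (k + 1) = m / 2 ^ (k + 1) → ¬ heavy j x m' with hhmax
  have hmaxd : ∀ k m, ∀ x, ∀ y ∈ cyl k x, (hmax k y m ↔ hmax k x m) := by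
    intro k m x y hy
    simp only [hhmax]
    rw [hcongr k x y m m hy rfl]
    refine and_congr Iff.rfl (forall₄_congr fun j hj m' _ => ?_)
    rw [hcongr j x y m' m' (cyl_anti hj.le x hy) rfl]
  set A : ℕ → Finset (Cube N) := fun m =>
    Finset.univ.filter fun x => ∃ k < N, hi k m = m ∧ hmax k x m with hA
  refine ⟨A, ?_, ?_⟩
  · intro k hk x n' hx
    have h1 : ∃ j ≤ k, ∃ m', m' / 2 ^ (k + 1) = n' / 2 ^ (k + 1) ∧ heavy j x m' := by
      have := Set.disjoint_left.1 hP hx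
      simp only [light, mem_ofPred_eq, not_forall, not_le] at this
      obtain ⟨k', x', m, he, j, hj, m', hm', h⟩ := this
      simp only [tile, Prod.mk.injEq] at he
      obtain ⟨rfl, he2, he3⟩ := he
      exact ⟨j, hj, m', hm'.trans he3,
        (hcongr j x x' m' m' (cyl_anti hj x (cyl_eq_iff_mem.1 he2)) rfl).1 h⟩
    obtain ⟨hj, m', hm', hh⟩ := Nat.find_spec h1
    set j := Nat.find h1
    have hmin : ∀ i < j, ∀ m'', m'' / 2 ^ (k + 1) = n' / 2 ^ (k + 1) → ¬ heavy i x m'' :=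
      fun i hij m'' h h' => Nat.find_min h1 hij ⟨hij.le.trans hj, m'', h, h'⟩
    have hlt : hi j m' < 2 ^ N := by
      have h0 : 0 < (occupied G n j x m').card := by
        have : (0 : ℝ) < (occupied G n j x m').card := lt_of_le_of_lt (by positivity) hh
        exact_mod_cast this
      obtain ⟨y, hy⟩ := Finset.card_pos.1 h0
      rw [← hi_congr (Finset.mem_filter.1 hy).2.2]
      exact (hi_le _ _).trans_lt (hn y)
    refine ⟨hi j m', hlt, ?_, ?_⟩
    · rw [← hm']
      exact (div_two_pow_eq_of_le (by omega) (hi_div j m')).symm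
    · intro y hy
      refine Finset.mem_filter.2 ⟨Finset.mem_univ _, j, by omega, hi_congr (hi_div j m'), ?_⟩
      rw [hmaxd j _ x y (cyl_anti hj x hy)]
      refine ⟨(hcongr j x x _ _ (self_mem_cyl _ _) (hi_div j m')).2 hh, fun i hij m'' h => ?_⟩
      refine hmin i hij m'' ?_
      rw [← hm']
      exact div_two_pow_eq_of_le (by omega) (h.trans (hi_div j m'))
  · rw [le_div_iff₀ hδ, Finset.sum_mul]
    set q : ℕ → ℕ → Cube N → ℝ := fun m k x => if hi k m = m ∧ hmax k x m then 1 else 0 with hq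
    set o : ℕ → ℕ → Cube N → ℝ := fun m k x =>
      if x ∈ G ∧ n x / 2 ^ (k + 1) = m / 2 ^ (k + 1) then 1 else 0 with ho
    have hqd : ∀ m k, DependsOn k (q m k) := by
      intro m k x y hy
      simp only [hq, hmaxd k m x y hy]
    have hq0 : ∀ m k x, 0 ≤ q m k x := fun m k x => by simp only [hq]; split_ifs <;> norm_num
    have hocc : ∀ m k x, ∑ y ∈ cyl k x, o m k y = (occupied G n k x m).card := by
      intro m k x
      simp only [ho, occupied, Finset.card_filter]
      push_cast
      rfl
    have h1 : ∀ m, ((A m).card : ℝ) * δ ≤ ∑ k ∈ range N, ∑ x, q m k x * o m k x := by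
      intro m
      have e : ∑ k ∈ range N, ∑ x, q m k x * o m k x = ∑ k ∈ range N, ∑ x,
          q m k x * ((∑ y ∈ cyl k x, o m k y) / (cyl k x).card) :=
        Finset.sum_congr rfl fun k _ => (sum_mul_sum_cyl_div k (hqd m k) (o m k)).symm
      rw [e, Finset.sum_comm, ← nsmul_eq_mul, ← Finset.sum_const]
      have hterm : ∀ x k, 0 ≤ q m k x * ((∑ y ∈ cyl k x, o m k y) / (cyl k x).card) := by
        intro x k
        rw [hocc]; have := hq0 m k x; positivity
      refine le_trans (Finset.sum_le_sum fun x hx => ?_)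
        (Finset.sum_le_sum_of_subset_of_nonneg (Finset.subset_univ (A m))
          fun x _ _ => Finset.sum_nonneg fun k _ => hterm x k)
      obtain ⟨-, k, hk, h2, h3⟩ := Finset.mem_filter.1 hx
      refine le_trans ?_ (Finset.single_le_sum (f := fun k =>
        q m k x * ((∑ y ∈ cyl k x, o m k y) / (cyl k x).card)) (fun k _ => hterm x k)
        (Finset.mem_range.2 hk))
      simp only [hq, if_pos (And.intro h2 h3), hocc, one_mul]
      rw [le_div_iff₀ (by exact_mod_cast card_cyl_pos k x)]
      exact h3.1.le
    refine (Finset.sum_le_sum fun m _ => h1 m).trans ?_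
    have h2 : ∀ m, ∑ k ∈ range N, ∑ x, q m k x * o m k x =
        ∑ x, ∑ k ∈ range N, q m k x * o m k x := fun m => Finset.sum_comm
    simp only [h2]
    rw [Finset.sum_comm]
    have h3 : ∀ x, ∑ m ∈ range (2 ^ N), ∑ k ∈ range N, q m k x * o m k x ≤
        if x ∈ G then 1 else 0 := by
      intro x
      rw [← Finset.sum_product']
      have e : ∀ i : ℕ × ℕ, q i.1 i.2 x * o i.1 i.2 x =
          if (hi i.2 i.1 = i.1 ∧ hmax i.2 x i.1) ∧
            (x ∈ G ∧ n x / 2 ^ (i.2 + 1) = i.1 / 2 ^ (i.2 + 1)) then 1 else 0 := by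
        intro i
        simp only [hq, ho]
        rw [ite_zero_mul_ite_zero, mul_one]
      simp only [e]
      split_ifs with hx
      · rw [Finset.sum_boole]
        have : ∀ s : Finset (ℕ × ℕ), s.card ≤ 1 → (s.card : ℝ) ≤ 1 := fun s hs => by
          exact_mod_cast hs
        refine this _ (Finset.card_le_one.2 ?_)
        have hnot : ∀ m k m' k', hmax k x m → n x / 2 ^ (k + 1) = m / 2 ^ (k + 1) →
            hmax k' x m' → n x / 2 ^ (k' + 1) = m' / 2 ^ (k' + 1) → ¬ k < k' := by
          intro m k m' k' a1 a2 b1 b2 hlt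
          refine b1.2 k hlt m ?_ a1.1
          rw [← b2]
          exact div_two_pow_eq_of_le (by omega) a2.symm
        rintro ⟨m, k⟩ ha ⟨m', k'⟩ hb
        obtain ⟨-, ⟨a1, a2⟩, -, a3⟩ := Finset.mem_filter.1 ha
        obtain ⟨-, ⟨b1, b2⟩, -, b3⟩ := Finset.mem_filter.1 hb
        simp only at a1 a2 a3 b1 b2 b3
        have hk : k = k' := le_antisymm (not_lt.1 (hnot m' k' m k b2 b3 a2 a3))
          (not_lt.1 (hnot m k m' k' a2 a3 b2 b3))
        subst hk
        have : m = m' := by rw [← a1, ← b1]; exact hi_congr (a3.symm.trans b3)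
        rw [this]
      · rw [Finset.sum_eq_zero]
        intro i _
        exact if_neg fun h => hx h.2.1
    refine (Finset.sum_le_sum fun x _ => h3 x).trans ?_
    simp

/-! ### The multi-frequency Calderón–Zygmund decomposition -/

theorem sum_cyl_char_mul_char {k u v : ℕ} (hu : u < 2 ^ N) (hv : v < 2 ^ N)
    (h : u / 2 ^ k ≠ v / 2 ^ k) (x : Cube N) : ∑ y ∈ cyl k x, char u y * char v y = 0 := by
  have := sum_char_mul_char_eq_zero hu hv h (φ := fun y => if y ∈ cyl k x then 1 else 0) ?_
  · simpa only [ite_mul, one_mul, zero_mul, Finset.sum_ite_mem, Finset.univ_inter] using this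
  · intro y z hz
    have : z ∈ cyl k x ↔ y ∈ cyl k x := by
      rw [← cyl_eq_iff_mem, ← cyl_eq_iff_mem, cyl_eq_of_mem hz]
    simp only [this]

/-- On one dyadic interval, the projection of `f` onto `F.card` frequencies is controlled in `L²`
by the `L ^ p` average of `f`, with a loss that is a power of `F.card`. -/
theorem sum_sq_avg_le {p h : ℝ} (hp1 : 1 < p) (hp2 : p ≤ 2) (hh : 0 < h) {K : ℕ} {x : Cube N}
    {f : Cube N → ℂ} {F : Finset ℕ} (hF : ∀ u ∈ F, u < 2 ^ N)
    (hinj : Set.InjOn (fun u => u / 2 ^ K) (F : Set ℕ))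
    (hf : ∑ y ∈ cyl K x, ‖f y‖ ^ p ≤ 2 * h ^ p * (cyl K x).card) :
    (∑ y ∈ cyl K x, ‖∑ u ∈ F, avg K (fun z => f z * char u z) x * char u y‖ ^ 2) ≤
      (12 * h ^ 2 * (F.card : ℝ) ^ (2 / p - 1)) * (cyl K x).card := by
  set a : ℕ → ℂ := fun u => avg K (fun z => f z * char u z) x with ha
  set g : Cube N → ℂ := fun y => ∑ u ∈ F, a u * char u y with hg
  set c : ℝ := ((cyl K x).card : ℝ) with hc
  have hcpos : 0 < c := by rw [hc]; exact_mod_cast card_cyl_pos K x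
  set C : ℝ := ∑ u ∈ F, ‖a u‖ ^ 2 with hC
  have hC0 : 0 ≤ C := Finset.sum_nonneg fun _ _ => sq_nonneg _
  have hsq : ∀ z : ℂ, ((‖z‖ ^ 2 : ℝ) : ℂ) = (starRingEnd ℂ) z * z := by
    intro z; rw [mul_comm, Complex.mul_conj, Complex.normSq_eq_norm_sq]
  have havg : ∀ u, ∑ y ∈ cyl K x, f y * char u y = a u * c := by
    intro u
    simp only [ha, avg, hc]
    have : ((cyl K x).card : ℂ) ≠ 0 := by exact_mod_cast (card_cyl_pos K x).ne'
    push_cast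
    field_simp
  have hgg : ∑ y ∈ cyl K x, ‖g y‖ ^ 2 = C * c := by
    have : ((∑ y ∈ cyl K x, ‖g y‖ ^ 2 : ℝ) : ℂ) = ((C * c : ℝ) : ℂ) := by
      rw [Complex.ofReal_sum]
      simp only [hsq, hg, map_sum, map_mul, conj_char, Finset.sum_mul_sum]
      rw [Finset.sum_comm, hC, Complex.ofReal_mul, Complex.ofReal_sum, Finset.sum_mul]
      refine Finset.sum_congr rfl fun u hu => ?_
      rw [Finset.sum_comm, Finset.sum_eq_single_of_mem u hu]
      · rw [hsq, hc, Complex.ofReal_natCast, mul_comm, ← nsmul_eq_mul, ← Finset.sum_const]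
        refine Finset.sum_congr rfl fun y _ => ?_
        calc _ = (starRingEnd ℂ) (a u) * a u * (char u y * char u y) := by ring
          _ = _ := by rw [char_mul_self, mul_one]
      · intro v hv hvu
        have h1 := sum_cyl_char_mul_char (hF u hu) (hF v hv)
          (fun e => hvu (hinj hv hu e.symm)) x
        calc _ = ∑ y ∈ cyl K x, (starRingEnd ℂ) (a u) * a v * (char u y * char v y) :=
              Finset.sum_congr rfl fun y _ => by ring
          _ = 0 := by rw [← Finset.mul_sum, h1, mul_zero]
    exact_mod_cast this
  have hfg : C * c ≤ ∑ y ∈ cyl K x, ‖f y‖ * ‖g y‖ := by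
    have : ∑ y ∈ cyl K x, (starRingEnd ℂ) (g y) * f y = ((C * c : ℝ) : ℂ) := by
      simp only [hg, map_sum, map_mul, conj_char, Finset.sum_mul]
      rw [Finset.sum_comm, hC, Complex.ofReal_mul, Complex.ofReal_sum, Finset.sum_mul]
      refine Finset.sum_congr rfl fun u hu => ?_
      rw [hsq, mul_assoc, ← havg, Finset.mul_sum]
      exact Finset.sum_congr rfl fun y _ => by ring
    calc C * c ≤ ‖((C * c : ℝ) : ℂ)‖ := by rw [Complex.norm_real]; exact le_abs_self _
      _ ≤ _ := by
        rw [← this]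
        refine (norm_sum_le _ _).trans (le_of_eq ?_)
        exact Finset.sum_congr rfl fun y _ => by rw [norm_mul, RCLike.norm_conj, mul_comm]
  rw [hgg]
  refine mul_le_mul_of_nonneg_right ?_ hcpos.le
  rcases F.eq_empty_or_nonempty with hFe | hFne
  · have : C = 0 := by simp [hC, hFe]
    rw [this]; positivity
  set n : ℝ := (F.card : ℝ) with hn
  have hn1 : 1 ≤ n := by rw [hn]; exact_mod_cast Finset.card_pos.2 hFne
  have hn0 : 0 < n := by linarith
  -- The supremum of `g` is controlled by its `L²` norm and the number of frequencies.
  set w : ℝ := Real.sqrt (n * C) with hw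
  have hw2 : w ^ 2 = n * C := Real.sq_sqrt (by positivity)
  have hw0 : 0 ≤ w := Real.sqrt_nonneg _
  have hgw : ∀ y, ‖g y‖ ≤ w := by
    intro y
    refine Real.le_sqrt_of_sq_le ?_
    have h1 : ‖g y‖ ≤ ∑ u ∈ F, ‖a u‖ := by
      refine (norm_sum_le _ _).trans (le_of_eq ?_)
      exact Finset.sum_congr rfl fun u _ => by rw [norm_mul, norm_char, mul_one]
    exact (pow_le_pow_left₀ (norm_nonneg _) h1 2).trans sq_sum_le_card_mul_sum_sq
  -- Splitting `f` at this height balances the two contributions.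
  set τ : ℝ := h * n ^ (1 / p) with hτ
  have hτ0 : 0 < τ := by positivity
  have hτ1 : τ ^ (2 - p) * h ^ p = h ^ 2 * n ^ (2 / p - 1) := by
    rw [hτ, Real.mul_rpow hh.le (by positivity), ← Real.rpow_mul hn0.le, mul_right_comm,
      ← Real.rpow_add hh]
    congr 1
    · rw [show 2 - p + p = (2 : ℕ) by push_cast; ring, Real.rpow_natCast]
    · congr 1; field_simp
  set s : ℝ := τ ^ (1 - p) * h ^ p with hs
  have hs2 : s ^ 2 * n = h ^ 2 * n ^ (2 / p - 1) := by
    have e1 : s = h * n ^ (1 / p - 1) := by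
      rw [hs, hτ, Real.mul_rpow hh.le (by positivity), ← Real.rpow_mul hn0.le, mul_right_comm,
        ← Real.rpow_add hh]
      congr 1
      · rw [show 1 - p + p = 1 by ring, Real.rpow_one]
      · congr 1; field_simp
    rw [e1, mul_pow, ← Real.rpow_natCast (n ^ (1 / p - 1)) 2, ← Real.rpow_mul hn0.le, mul_assoc]
    congr 1
    nth_rewrite 2 [← Real.rpow_one n]
    rw [← Real.rpow_add hn0]
    congr 1; push_cast; ring
  have hs0 : 0 ≤ s := by positivity
  have hpt : ∀ y, ‖f y‖ * ‖g y‖ ≤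
      (τ ^ (2 - p) + τ ^ (1 - p) * w) * ‖f y‖ ^ p + ‖g y‖ ^ 2 / 4 := by
    intro y
    have hf0 := norm_nonneg (f y)
    have hp0 : 0 ≤ ‖f y‖ ^ p := Real.rpow_nonneg hf0 _
    have hg0 := norm_nonneg (g y)
    rcases hf0.eq_or_lt with h0 | hfpos
    · rw [← h0, zero_mul]; positivity
    rcases le_total ‖f y‖ τ with hle | hle
    · have h1 : ‖f y‖ ^ 2 ≤ τ ^ (2 - p) * ‖f y‖ ^ p := by
        have : ‖f y‖ ^ 2 = ‖f y‖ ^ (2 - p) * ‖f y‖ ^ p := by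
          rw [← Real.rpow_add hfpos, ← Real.rpow_natCast]; congr 1; push_cast; ring
        rw [this]
        exact mul_le_mul_of_nonneg_right
          (Real.rpow_le_rpow hf0 hle (by linarith)) hp0
      have h2 : 0 ≤ τ ^ (1 - p) * w * ‖f y‖ ^ p := by positivity
      nlinarith [sq_nonneg (‖f y‖ - ‖g y‖ / 2)]
    · have h1 : ‖f y‖ ≤ τ ^ (1 - p) * ‖f y‖ ^ p := by
        have : ‖f y‖ = ‖f y‖ ^ (1 - p) * ‖f y‖ ^ p := by
          rw [← Real.rpow_add hfpos]; simp
        calc ‖f y‖ = ‖f y‖ ^ (1 - p) * ‖f y‖ ^ p := this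
          _ ≤ _ := mul_le_mul_of_nonneg_right
            (Real.rpow_le_rpow_of_nonpos hτ0 hle (by linarith)) hp0
      have h2 : ‖f y‖ * ‖g y‖ ≤ τ ^ (1 - p) * ‖f y‖ ^ p * w :=
        mul_le_mul h1 (hgw y) hg0 (by positivity)
      have h3 : 0 ≤ τ ^ (2 - p) * ‖f y‖ ^ p := by positivity
      nlinarith [sq_nonneg ‖g y‖]
  have hsum := hfg.trans (Finset.sum_le_sum fun y _ => hpt y)
  rw [Finset.sum_add_distrib, ← Finset.mul_sum, ← Finset.sum_div, hgg] at hsum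
  have h1 : (τ ^ (2 - p) + τ ^ (1 - p) * w) * ∑ y ∈ cyl K x, ‖f y‖ ^ p ≤
      (τ ^ (2 - p) + τ ^ (1 - p) * w) * (2 * h ^ p * c) :=
    mul_le_mul_of_nonneg_left hf (by positivity)
  have h2 : (τ ^ (2 - p) + τ ^ (1 - p) * w) * (2 * h ^ p * c) =
      (2 * (τ ^ (2 - p) * h ^ p) + 2 * s * w) * c := by rw [hs]; ring
  rw [h2, hτ1] at h1
  have h3 : 3 / 4 * C ≤ 2 * (h ^ 2 * n ^ (2 / p - 1)) + 2 * s * w := by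
    refine le_of_mul_le_mul_right ?_ hcpos
    linarith
  have h4 : 2 * s * w ≤ 4 * (s ^ 2 * n) + C / 4 := by
    have : 0 ≤ (4 * s * n - w) ^ 2 := sq_nonneg _
    have h5 : 2 * s * w * (4 * n) ≤ (4 * (s ^ 2 * n) + C / 4) * (4 * n) := by
      nlinarith
    exact le_of_mul_le_mul_right h5 (by positivity)
  rw [hs2] at h4
  nlinarith

theorem sum_eq_sum_avg_of_partition {X 𝕜 : Type*} [Field 𝕜] [CharZero 𝕜] {D : Finset X}
    (J : X → Finset X) (hself : ∀ x ∈ D, x ∈ J x) (hJ : ∀ x ∈ D, ∀ y ∈ J x, y ∈ D ∧ J y = J x)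
    (φ : X → 𝕜) : ∑ x ∈ D, φ x = ∑ x ∈ D, (∑ y ∈ J x, φ y) / (J x).card := by
  have : ∑ x ∈ D, (∑ y ∈ J x, φ y) / (J x).card =
      ∑ y ∈ D, ∑ x ∈ J y, φ y / (J x).card := by
    simp only [Finset.sum_div]
    refine Finset.sum_comm' fun x y => ?_
    constructor
    · rintro ⟨hx, hy⟩
      obtain ⟨h1, h2⟩ := hJ x hx y hy
      exact ⟨h2 ▸ hself x hx, h1⟩
    · rintro ⟨hx, hy⟩
      obtain ⟨h1, h2⟩ := hJ y hy x hx
      exact ⟨h1, h2 ▸ hself y hy⟩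
  rw [this]
  refine Finset.sum_congr rfl fun y hy => ?_
  have h1 : ∀ x ∈ J y, φ y / (J x).card = φ y / (J y).card := fun x hx => by
    rw [(hJ y hy x hx).2]
  rw [Finset.sum_congr rfl h1, Finset.sum_const, nsmul_eq_mul]
  have : ((J y).card : 𝕜) ≠ 0 := by
    exact_mod_cast (Finset.card_pos.2 ⟨y, hself y hy⟩).ne'
  field_simp

/-- The `L ^ p` average of `f` over the dyadic interval of length `2 ^ (-k)` around `x`
exceeds `h`. -/
def BigAvg (f : Cube N → ℂ) (p h : ℝ) (k : ℕ) (x : Cube N) : Prop :=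
  h ^ p * (cyl k x).card < ∑ y ∈ cyl k x, ‖f y‖ ^ p

theorem bigAvg_congr (f : Cube N → ℂ) (p h : ℝ) {k : ℕ} {x y : Cube N} (hy : y ∈ cyl k x) :
    BigAvg f p h k y ↔ BigAvg f p h k x := by simp only [BigAvg, cyl_eq_of_mem hy]

/-- The set where the dyadic `L ^ p` maximal function of `f` exceeds `h`. -/
def bigSet (f : Cube N → ℂ) (p h : ℝ) : Finset (Cube N) :=
  Finset.univ.filter fun x => ∃ k ≤ N, BigAvg f p h k x

/-- The scale of the maximal dyadic interval around `x` inside the set where the maximal function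
is large. -/
def stopScale (f : Cube N → ℂ) (p h : ℝ) (x : Cube N) : ℕ := sInf {k | k ≤ N ∧ BigAvg f p h k x}

section Stopping

variable {f : Cube N → ℂ} {p h : ℝ} {x y : Cube N}

theorem stopScale_spec (hx : x ∈ bigSet f p h) : stopScale f p h x ≤ N ∧ BigAvg f p h (stopScale f p h x) x :=
  Nat.sInf_mem (s := {k | k ≤ N ∧ BigAvg f p h k x}) (Finset.mem_filter.1 hx).2

theorem stopScale_le {k : ℕ} (hk : k ≤ N) (h' : BigAvg f p h k x) : stopScale f p h x ≤ k :=
  Nat.sInf_le (show k ∈ {k | k ≤ N ∧ BigAvg f p h k x} from ⟨hk, h'⟩)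

theorem stopScale_congr (hx : x ∈ bigSet f p h) (hy : y ∈ cyl (stopScale f p h x) x) :
    y ∈ bigSet f p h ∧ stopScale f p h y = stopScale f p h x := by
  obtain ⟨h1, h2⟩ := stopScale_spec hx
  have h3 := (bigAvg_congr f p h hy).2 h2
  have hy' : y ∈ bigSet f p h := Finset.mem_filter.2 ⟨Finset.mem_univ _, _, h1, h3⟩
  refine ⟨hy', le_antisymm (stopScale_le h1 h3) ?_⟩
  obtain ⟨h4, h5⟩ := stopScale_spec hy'
  exact stopScale_le h4 ((bigAvg_congr f p h (cyl_anti (stopScale_le h1 h3) x hy)).1 h5)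

theorem stopScale_partition : ∀ x ∈ bigSet f p h, ∀ y ∈ cyl (stopScale f p h x) x,
    y ∈ bigSet f p h ∧ cyl (stopScale f p h y) y = cyl (stopScale f p h x) x := fun x hx y hy => by
  obtain ⟨h1, h2⟩ := stopScale_congr hx hy
  exact ⟨h1, by rw [h2, cyl_eq_of_mem hy]⟩

theorem card_bigSet_le : h ^ p * (bigSet f p h).card ≤ ∑ x, ‖f x‖ ^ p := by
  calc h ^ p * (bigSet f p h).card = ∑ x ∈ bigSet f p h, h ^ p := by
        rw [Finset.sum_const, nsmul_eq_mul, mul_comm]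
    _ ≤ ∑ x ∈ bigSet f p h, (∑ y ∈ cyl (stopScale f p h x) x, ‖f y‖ ^ p) /
          (cyl (stopScale f p h x) x).card := by
        refine Finset.sum_le_sum fun x hx => ?_
        rw [le_div_iff₀ (by exact_mod_cast card_cyl_pos _ x)]
        exact (stopScale_spec hx).2.le
    _ = ∑ x ∈ bigSet f p h, ‖f x‖ ^ p :=
        (sum_eq_sum_avg_of_partition (fun x => cyl (stopScale f p h x) x)
          (fun x _ => self_mem_cyl _ x) stopScale_partition fun x => ‖f x‖ ^ p).symm
    _ ≤ _ := Finset.sum_le_sum_of_subset_of_nonneg (Finset.subset_univ _)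
        fun _ _ _ => by positivity

theorem norm_le_of_notMem_bigSet (hp : 0 < p) (hh : 0 ≤ h) (hx : x ∉ bigSet f p h) :
    ‖f x‖ ≤ h := by
  have h1 : ¬ BigAvg f p h N x := fun h' =>
    hx (Finset.mem_filter.2 ⟨Finset.mem_univ _, N, le_rfl, h'⟩)
  simp only [BigAvg, cyl_top, Finset.card_singleton, Nat.cast_one, mul_one,
    Finset.sum_singleton, not_lt] at h1
  exact (Real.rpow_le_rpow_iff (norm_nonneg _) hh hp).1 h1

theorem sum_cyl_stopScale_le (h0 : ∀ x, ¬ BigAvg f p h 0 x) (hx : x ∈ bigSet f p h) :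
    ∑ y ∈ cyl (stopScale f p h x) x, ‖f y‖ ^ p ≤ 2 * h ^ p * (cyl (stopScale f p h x) x).card := by
  obtain ⟨h1, h2⟩ := stopScale_spec hx
  obtain ⟨k, hk⟩ : ∃ k, stopScale f p h x = k + 1 := by
    refine Nat.exists_eq_succ_of_ne_zero fun h => ?_
    rw [h] at h2
    exact h0 x h2
  have h3 : ¬ BigAvg f p h k x := fun h' => by
    have := stopScale_le (by omega) h'
    omega
  rw [hk] at h1 ⊢
  have h4 := card_cyl_eq k h1 x
  simp only [BigAvg, not_lt, h4] at h3
  refine (Finset.sum_le_sum_of_subset_of_nonneg (cyl_anti (Nat.le_succ k) x)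
    fun _ _ _ => by positivity).trans (h3.trans (le_of_eq ?_))
  push_cast; ring

end Stopping

/-- The frequencies, at the resolution of the stopping interval around `x`, of the trees whose
time sets contain that interval. -/
def freqs (f : Cube N → ℂ) (p h : ℝ) (A : ℕ → Finset (Cube N)) (x : Cube N) : Finset ℕ :=
  ((range (2 ^ N)).filter fun m => cyl (stopScale f p h x) x ⊆ A m).image
    fun m => m / 2 ^ stopScale f p h x * 2 ^ stopScale f p h x

/-- The good function of the multi-frequency Calderón–Zygmund decomposition: on each stopping
interval `f` is replaced by its projection onto the relevant frequencies. -/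
def goodPart (f : Cube N → ℂ) (p h : ℝ) (A : ℕ → Finset (Cube N)) (x : Cube N) : ℂ :=
  if x ∈ bigSet f p h then
    ∑ u ∈ freqs f p h A x, avg (stopScale f p h x) (fun z => f z * char u z) x * char u x
  else f x

theorem freqs_congr {f : Cube N → ℂ} {p h : ℝ} {A : ℕ → Finset (Cube N)} {x y : Cube N}
    (hx : x ∈ bigSet f p h) (hy : y ∈ cyl (stopScale f p h x) x) :
    freqs f p h A y = freqs f p h A x := by
  simp only [freqs, (stopScale_congr hx hy).2, cyl_eq_of_mem hy]

theorem goodPart_eq {f : Cube N → ℂ} {p h : ℝ} {A : ℕ → Finset (Cube N)} {x y : Cube N}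
    (hx : x ∈ bigSet f p h) (hy : y ∈ cyl (stopScale f p h x) x) :
    goodPart f p h A y = ∑ u ∈ freqs f p h A x,
      avg (stopScale f p h x) (fun z => f z * char u z) x * char u y := by
  rw [goodPart, if_pos (stopScale_congr hx hy).1, freqs_congr hx hy, (stopScale_congr hx hy).2]
  exact Finset.sum_congr rfl fun u _ => by rw [dependsOn_avg _ _ x y hy]

theorem lt_of_mem_freqs {f : Cube N → ℂ} {p h : ℝ} {A : ℕ → Finset (Cube N)} {x : Cube N}
    {u : ℕ} (hu : u ∈ freqs f p h A x) : u < 2 ^ N := by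
  obtain ⟨m, hm, rfl⟩ := Finset.mem_image.1 hu
  exact (Nat.div_mul_le_self _ _).trans_lt (Finset.mem_range.1 (Finset.mem_filter.1 hm).1)

theorem injOn_freqs {f : Cube N → ℂ} {p h : ℝ} {A : ℕ → Finset (Cube N)} {x : Cube N} :
    Set.InjOn (fun u => u / 2 ^ stopScale f p h x) (freqs f p h A x : Set ℕ) := by
  intro u hu v hv huv
  obtain ⟨m, -, rfl⟩ := Finset.mem_image.1 (Finset.mem_coe.1 hu)
  obtain ⟨m', -, rfl⟩ := Finset.mem_image.1 (Finset.mem_coe.1 hv)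
  have e : ∀ a, a / 2 ^ stopScale f p h x * 2 ^ stopScale f p h x / 2 ^ stopScale f p h x =
    a / 2 ^ stopScale f p h x := fun a => Nat.mul_div_cancel _ (by positivity)
  simp only [e] at huv
  simp only [huv]

/-- The good function has the same wave packet coefficients as `f` at the bitiles of a forest whose
time intervals are not contained in the exceptional set. -/
theorem coef_goodPart {f : Cube N → ℂ} {p h : ℝ} {A : ℕ → Finset (Cube N)} {k n : ℕ} {x : Cube N}
    (hf : ∃ m < 2 ^ N, n / 2 ^ (k + 1) = m / 2 ^ (k + 1) ∧ cyl k x ⊆ A m)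
    (hx : ∃ y ∈ cyl k x, y ∉ bigSet f p h) : coef (goodPart f p h A) k n x = coef f k n x := by
  obtain ⟨m, hm, hnm, hmA⟩ := hf
  obtain ⟨y0, hy0, hy0'⟩ := hx
  set u0 := hi k n with hu0
  have hu0lt : u0 < 2 ^ N := by rw [hu0, hi_congr hnm]; exact (hi_le _ _).trans_lt hm
  simp only [coef, avg]
  congr 1
  rw [← sub_eq_zero, ← Finset.sum_sub_distrib]
  set φ : Cube N → ℂ := fun z => goodPart f p h A z * char u0 z - f z * char u0 z with hφ
  have h1 : ∑ z ∈ cyl k x, φ z = ∑ z ∈ cyl k x ∩ bigSet f p h, φ z := by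
    refine (Finset.sum_subset Finset.inter_subset_left fun z hz hz' => ?_).symm
    have : z ∉ bigSet f p h := fun h' => hz' (Finset.mem_inter.2 ⟨hz, h'⟩)
    simp [hφ, goodPart, this]
  -- The stopping intervals inside `cyl k x` are strictly smaller.
  have hlt : ∀ z ∈ cyl k x, z ∈ bigSet f p h → k < stopScale f p h z := by
    intro z hz hzb
    by_contra! hle
    obtain ⟨h2, h3⟩ := stopScale_spec hzb
    refine hy0' (Finset.mem_filter.2 ⟨Finset.mem_univ _, _, h2, ?_⟩)
    refine (bigAvg_congr f p h (cyl_anti hle z ?_)).2 h3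
    rw [cyl_eq_of_mem hz]; exact hy0
  rw [h1, sum_eq_sum_avg_of_partition (fun z => cyl (stopScale f p h z) z)
    (fun z _ => self_mem_cyl _ z)]
  · refine Finset.sum_eq_zero fun z hz => ?_
    obtain ⟨hzk, hzb⟩ := Finset.mem_inter.1 hz
    have hkz := hlt z hzk hzb
    set K := stopScale f p h z with hK
    have hJ : cyl K z ⊆ cyl k x := by
      rw [← cyl_eq_of_mem hzk]; exact cyl_anti hkz.le z
    rw [Finset.sum_sub_distrib, sub_eq_zero.2, zero_div]
    set v := m / 2 ^ K * 2 ^ K with hv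
    have hvF : v ∈ freqs f p h A z := Finset.mem_image.2
      ⟨m, Finset.mem_filter.2 ⟨Finset.mem_range.2 hm, hJ.trans hmA⟩, rfl⟩
    have hvu : v / 2 ^ K = u0 / 2 ^ K := by
      rw [hv, Nat.mul_div_cancel _ (by positivity)]
      exact (div_two_pow_eq_of_le (show k + 1 ≤ K from hkz) (hi_div k n |>.trans hnm)).symm
    calc ∑ y ∈ cyl K z, goodPart f p h A y * char u0 y
        = ∑ y ∈ cyl K z, ∑ u ∈ freqs f p h A z,
            avg K (fun z => f z * char u z) z * (char u y * char u0 y) := by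
          refine Finset.sum_congr rfl fun y hy => ?_
          rw [goodPart_eq hzb hy, Finset.sum_mul]
          exact Finset.sum_congr rfl fun u _ => by ring
      _ = ∑ u ∈ freqs f p h A z,
            avg K (fun z => f z * char u z) z * ∑ y ∈ cyl K z, char u y * char u0 y := by
          rw [Finset.sum_comm]
          exact Finset.sum_congr rfl fun u _ => by rw [Finset.mul_sum]
      _ = avg K (fun z => f z * char v z) z * ∑ y ∈ cyl K z, char v y * char u0 y := by
          refine Finset.sum_eq_single_of_mem v hvF fun u hu huv => ?_
          rw [sum_cyl_char_mul_char (lt_of_mem_freqs hu) hu0lt, mul_zero]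
          intro e
          exact huv (injOn_freqs (f := f) (p := p) (h := h) (A := A) (x := z)
            (Finset.mem_coe.2 hu) (Finset.mem_coe.2 hvF) (e.trans hvu.symm))
      _ = ∑ y ∈ cyl K z, f y * char u0 y := by
          rw [Finset.sum_congr rfl fun y hy => char_mul_char_congr hvu hy, Finset.sum_const,
            nsmul_eq_mul, avg]
          have hc : ((cyl K z).card : ℂ) ≠ 0 := by exact_mod_cast (card_cyl_pos K z).ne'
          rw [div_mul_eq_mul_div, ← mul_assoc, mul_right_comm, mul_div_assoc, div_self hc,
            mul_one, Finset.sum_mul]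
          refine Finset.sum_congr rfl fun y hy => ?_
          rw [← char_mul_char_congr hvu hy]
          calc _ = f y * (char v y * char v y) * char u0 y := by ring
            _ = _ := by rw [char_mul_self, mul_one]
  · intro z hz y hy
    obtain ⟨hzk, hzb⟩ := Finset.mem_inter.1 hz
    obtain ⟨h2, h3⟩ := stopScale_partition z hzb y hy
    refine ⟨Finset.mem_inter.2 ⟨?_, h2⟩, h3⟩
    rw [← cyl_eq_of_mem hzk]
    exact cyl_anti (hlt z hzk hzb).le z hy

theorem rpow_le_rpow_mul_add_one {a M θ : ℝ} (ha : 0 ≤ a) (hM : 0 < M) (h0 : 0 ≤ θ) (h1 : θ ≤ 1) :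
    a ^ θ ≤ M ^ θ * (a / M + 1) := by
  have e : a ^ θ = M ^ θ * (a / M) ^ θ := by
    rw [← Real.mul_rpow hM.le (by positivity)]; congr 1; field_simp
  rw [e]
  refine mul_le_mul_of_nonneg_left ?_ (by positivity)
  have hq : 0 ≤ a / M := by positivity
  rcases le_total (a / M) 1 with h | h
  · have := Real.rpow_le_one hq h h0
    linarith
  · have := Real.rpow_le_rpow_of_exponent_le h h1
    rw [Real.rpow_one] at this
    linarith

/-- The `L²` bound for the good function; `M` is the expected number of trees over a point. -/
theorem sum_sq_goodPart_le {f : Cube N → ℂ} {p h M g : ℝ} {A : ℕ → Finset (Cube N)}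
    (hp1 : 1 < p) (hp2 : p ≤ 2) (hh : 0 < h) (hM : 1 ≤ M) (hg : 0 ≤ g)
    (h0 : ∀ x, ¬ BigAvg f p h 0 x) (hfg : ∑ x, ‖f x‖ ^ p ≤ h ^ p * g)
    (hA : ∑ m ∈ range (2 ^ N), ((A m).card : ℝ) ≤ 2 * M * g) :
    ∑ x, ‖goodPart f p h A x‖ ^ 2 ≤ 37 * h ^ 2 * M ^ (2 / p - 1) * g := by
  have hθ0 : 0 ≤ 2 / p - 1 := by
    rw [sub_nonneg, le_div_iff₀ (by linarith)]; linarith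
  have hθ1 : 2 / p - 1 ≤ 1 := by
    rw [sub_le_iff_le_add, div_le_iff₀ (by linarith)]; linarith
  have hM1 : 1 ≤ M ^ (2 / p - 1) := Real.one_le_rpow hM hθ0
  have hM0 : 0 < M := by linarith
  set E := bigSet f p h with hE
  have hEg : (E.card : ℝ) ≤ g := by
    have := (card_bigSet_le (f := f) (p := p) (h := h)).trans hfg
    exact le_of_mul_le_mul_left this (by positivity)
  rw [← Finset.sum_filter_add_sum_filter_not Finset.univ (· ∈ E)]
  have h1 : ∑ x ∈ Finset.univ.filter (· ∉ E), ‖goodPart f p h A x‖ ^ 2 ≤ h ^ 2 * g := by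
    calc ∑ x ∈ Finset.univ.filter (· ∉ E), ‖goodPart f p h A x‖ ^ 2
        ≤ ∑ x ∈ Finset.univ.filter (· ∉ E), h ^ (2 - p) * ‖f x‖ ^ p := by
          refine Finset.sum_le_sum fun x hx => ?_
          have hx := (Finset.mem_filter.1 hx).2
          rw [goodPart, if_neg hx]
          have hle := norm_le_of_notMem_bigSet (by linarith) hh.le hx
          rcases (norm_nonneg (f x)).eq_or_lt with e | hpos
          · rw [← e, zero_pow two_ne_zero]; positivity
          have : ‖f x‖ ^ 2 = ‖f x‖ ^ (2 - p) * ‖f x‖ ^ p := by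
            rw [← Real.rpow_add hpos, ← Real.rpow_natCast]; congr 1; push_cast; ring
          rw [this]
          exact mul_le_mul_of_nonneg_right
            (Real.rpow_le_rpow hpos.le hle (by linarith)) (by positivity)
      _ ≤ ∑ x, h ^ (2 - p) * ‖f x‖ ^ p :=
          Finset.sum_le_sum_of_subset_of_nonneg (Finset.subset_univ _)
            fun _ _ _ => by positivity
      _ ≤ h ^ (2 - p) * (h ^ p * g) := by
          rw [← Finset.mul_sum]
          exact mul_le_mul_of_nonneg_left hfg (by positivity)
      _ = h ^ 2 * g := by
          rw [← mul_assoc, ← Real.rpow_add hh, ← Real.rpow_natCast]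
          congr 2; push_cast; ring
  have h2 : ∑ x ∈ Finset.univ.filter (· ∈ E), ‖goodPart f p h A x‖ ^ 2 ≤
      12 * h ^ 2 * (M ^ (2 / p - 1) * (3 * g)) := by
    rw [Finset.filter_mem_eq_inter, Finset.univ_inter,
      sum_eq_sum_avg_of_partition (fun x => cyl (stopScale f p h x) x)
        (fun x _ => self_mem_cyl _ x) stopScale_partition]
    have h3 : ∀ x ∈ E, (∑ y ∈ cyl (stopScale f p h x) x, ‖goodPart f p h A y‖ ^ 2) /
        (cyl (stopScale f p h x) x).card ≤
        12 * h ^ 2 * (M ^ (2 / p - 1) * ((freqs f p h A x).card / M + 1)) := by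
      intro x hx
      rw [div_le_iff₀ (by exact_mod_cast card_cyl_pos _ x),
        Finset.sum_congr rfl fun y hy => by rw [goodPart_eq hx hy]]
      refine (sum_sq_avg_le hp1 hp2 hh (fun u hu => lt_of_mem_freqs hu) injOn_freqs
        (sum_cyl_stopScale_le h0 hx)).trans ?_
      refine mul_le_mul_of_nonneg_right ?_ (Nat.cast_nonneg _)
      exact mul_le_mul_of_nonneg_left
        (rpow_le_rpow_mul_add_one (Nat.cast_nonneg _) hM0 hθ0 hθ1) (by positivity)
    refine (Finset.sum_le_sum h3).trans ?_
    rw [← Finset.mul_sum, ← Finset.mul_sum]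
    refine mul_le_mul_of_nonneg_left (mul_le_mul_of_nonneg_left ?_ (by positivity))
      (by positivity)
    rw [Finset.sum_add_distrib, ← Finset.sum_div, Finset.sum_const, nsmul_eq_mul, mul_one]
    have h4 : ∑ x ∈ E, ((freqs f p h A x).card : ℝ) ≤ 2 * M * g := by
      refine le_trans ?_ hA
      calc ∑ x ∈ E, ((freqs f p h A x).card : ℝ)
          ≤ ∑ x ∈ E, ∑ m ∈ range (2 ^ N), if x ∈ A m then (1 : ℝ) else 0 := by
            refine Finset.sum_le_sum fun x _ => ?_
            rw [Finset.sum_boole]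
            refine Nat.cast_le.2 (Finset.card_image_le.trans (Finset.card_le_card ?_))
            exact Finset.monotone_filter_right _ fun m _ hm => hm (self_mem_cyl _ x)
        _ ≤ ∑ x, ∑ m ∈ range (2 ^ N), if x ∈ A m then (1 : ℝ) else 0 :=
            Finset.sum_le_sum_of_subset_of_nonneg (Finset.subset_univ _)
              fun _ _ _ => Finset.sum_nonneg fun _ _ => by split_ifs <;> norm_num
        _ = _ := by
            rw [Finset.sum_comm]
            exact Finset.sum_congr rfl fun m _ => by simp
    have h5 : (∑ x ∈ E, ((freqs f p h A x).card : ℝ)) / M ≤ 2 * g := by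
      rw [div_le_iff₀ hM0]; linarith
    linarith
  have h6 : h ^ 2 * g ≤ h ^ 2 * M ^ (2 / p - 1) * g := by
    have : 0 ≤ h ^ 2 * g := by positivity
    nlinarith
  linarith

/-! ### The weak type estimate on the cube -/

theorem form_congr {f g : Cube N → ℂ} {n : Cube N → ℕ} {G : Finset (Cube N)} {P : Set (Bitile N)}
    (h : ∀ k < N, ∀ x m, tile k x m ∈ P → coef g k m x = coef f k m x) :
    form f n G P = form g n G P := by
  refine Finset.sum_congr rfl fun x _ => congrArg _ (Finset.sum_congr rfl fun k hk => ?_)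
  split_ifs with h'
  · rw [h k (Finset.mem_range.1 hk) x _ h'.2]
  · rfl

/-- The contribution of the bitiles of density about `2 ^ (-i)` decays geometrically, at a rate
that degenerates linearly as `p` tends to `1`. -/
theorem form_density_class_le {f : Cube N → ℂ} {n : Cube N → ℕ} {G : Finset (Cube N)} {p h g : ℝ}
    {P : Set (Bitile N)} (hp1 : 1 < p) (hp2 : p ≤ 2) (hh : 0 < h) (hn : ∀ x, n x < 2 ^ N)
    (hg : (G.card : ℝ) ≤ g) (h0 : ∀ x, ¬ BigAvg f p h 0 x) (hfg : ∑ x, ‖f x‖ ^ p ≤ h ^ p * g)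
    (hP : ∀ k < N, ∀ x m, tile k x m ∈ P → ∃ y ∈ cyl k x, y ∉ bigSet f p h) (i : ℕ)
    (hl : P ⊆ light G n ((1 / 2) ^ i)) (hd : Disjoint P (light G n ((1 / 2) ^ (i + 1)))) :
    form f n G P ≤ 1500 * h * ((2 : ℝ) ^ (-(1 - 1 / p))) ^ i * g := by
  have hg0 : 0 ≤ g := (Nat.cast_nonneg _).trans hg
  obtain ⟨A, hA1, hA2⟩ := exists_density_forest hn (by positivity) hd
  set M : ℝ := 2 ^ i with hM
  have hM1 : 1 ≤ M := one_le_pow₀ (by norm_num)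
  have hM0 : 0 < M := by positivity
  have hA3 : ∑ m ∈ range (2 ^ N), ((A m).card : ℝ) ≤ 2 * M * g := by
    refine hA2.trans ?_
    rw [one_div, inv_pow, div_inv_eq_mul, pow_succ, ← hM]
    nlinarith
  rw [form_congr (g := goodPart f p h A)
    fun k hk x m hx => coef_goodPart (hA1 k hk x m hx) (hP k hk x m hx)]
  set r : ℝ := ((2 : ℝ) ^ (-(1 - 1 / p))) ^ i with hr
  have hr0 : 0 < r := by positivity
  have hrM : r = M ^ (-(1 - 1 / p)) := by
    rw [hr, hM, ← Real.rpow_natCast, ← Real.rpow_natCast, ← Real.rpow_mul (by norm_num),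
      ← Real.rpow_mul (by norm_num), mul_comm]
  have hr2 : M⁻¹ * M ^ (2 / p - 1) = r ^ 2 := by
    rw [hrM, ← Real.rpow_natCast (M ^ _), ← Real.rpow_mul hM0.le, ← Real.rpow_neg_one,
      ← Real.rpow_add hM0]
    congr 1; push_cast; ring
  have hδ : ((1 : ℝ) / 2) ^ i = M⁻¹ := by rw [hM, one_div, inv_pow]
  have h1 := form_le_of_density (f := goodPart f p h A) (σ := h * r) hn (by positivity)
    (by positivity) hA1 (densityLE_of_subset_light hl) hA3
  have h2 := sum_sq_goodPart_le hp1 hp2 hh hM1 hg0 h0 hfg hA3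
  refine h1.trans ?_
  rw [hδ]
  have h3 : 40 * M⁻¹ * (∑ x, ‖goodPart f p h A x‖ ^ 2) / (h * r) ≤
      40 * M⁻¹ * (37 * h ^ 2 * M ^ (2 / p - 1) * g) / (h * r) := by gcongr
  have h4 : 40 * M⁻¹ * (37 * h ^ 2 * M ^ (2 / p - 1) * g) / (h * r) = 1480 * h * r * g := by
    calc _ = 1480 * h ^ 2 * g * (M⁻¹ * M ^ (2 / p - 1)) / (h * r) := by ring
      _ = _ := by rw [hr2]; field_simp
  have h5 : 10 * M⁻¹ * (h * r) * (2 * M * g) = 20 * h * r * g := by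
    field_simp; ring
  linarith

theorem sum_pow_two_rpow_le {p : ℝ} (hp1 : 1 < p) (hp2 : p ≤ 2) (M : ℕ) :
    ∑ i ∈ range M, ((2 : ℝ) ^ (-(1 - 1 / p))) ^ i ≤ 4 / (p - 1) := by
  set t : ℝ := 1 - 1 / p with ht
  have htp : t * p = p - 1 := by rw [ht]; field_simp
  have ht0 : 0 < t := by nlinarith
  have ht1 : t ≤ 1 := by rw [ht]; have : 0 < 1 / p := by positivity
                         linarith
  have h1 : (2 : ℝ) ^ (-t) ≤ 1 - t / 2 := by
    have := rpow_one_add_le_one_add_mul_self (s := (-(1 / 2) : ℝ)) (by norm_num) ht0.le ht1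
    rw [Real.rpow_neg (by norm_num), ← Real.inv_rpow (by norm_num)]
    norm_num at this ⊢
    linarith
  set r : ℝ := (2 : ℝ) ^ (-t) with hr
  have hr0 : 0 < r := by positivity
  have hgeom : (∑ i ∈ range M, r ^ i) * (1 - r) = 1 - r ^ M := by
    have := geom_sum_mul r M
    linarith
  have h2 : (∑ i ∈ range M, r ^ i) * (1 - r) ≤ 1 := by
    rw [hgeom]; have : 0 < r ^ M := by positivity
    linarith
  have hS0 : 0 ≤ ∑ i ∈ range M, r ^ i := Finset.sum_nonneg fun _ _ => by positivity
  rw [le_div_iff₀ (by linarith)]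
  have h3 : p - 1 ≤ 4 * (1 - r) := by nlinarith
  nlinarith

/-- The weak type `(p, p)` estimate on the cube: `h` is, up to a constant, the ratio of the
`L ^ p` norm of `f` to the `p`-th root of the measure of `G`. -/
theorem le_of_le_norm_carlesonSum {f : Cube N → ℂ} {n : Cube N → ℕ} {G : Finset (Cube N)}
    {p h l : ℝ} (hp1 : 1 < p) (hp2 : p ≤ 2) (hh : 0 < h) (hn : ∀ x, n x < 2 ^ N)
    (hG : G.Nonempty) (hfG : 2 * ∑ x, ‖f x‖ ^ p ≤ h ^ p * G.card) (hl0 : 0 ≤ l)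
    (hl : ∀ x ∈ G, l ≤ ‖carlesonSum f n Set.univ x‖) : l ≤ 12000 / (p - 1) * h := by
  set E := bigSet f p h with hE
  have hhp : 0 < h ^ p := by positivity
  have hGpos : (0 : ℝ) < G.card := by exact_mod_cast Finset.card_pos.2 hG
  have hF0 : 0 ≤ ∑ x, ‖f x‖ ^ p := Finset.sum_nonneg fun _ _ => by positivity
  have hfG' : ∑ x, ‖f x‖ ^ p ≤ h ^ p * G.card := by linarith
  have h0 : ∀ x, ¬ BigAvg f p h 0 x := by
    intro x
    rw [BigAvg, not_lt, cyl_zero]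
    refine hfG'.trans (mul_le_mul_of_nonneg_left ?_ hhp.le)
    exact_mod_cast Finset.card_le_card (Finset.subset_univ G)
  have hEG : (E.card : ℝ) ≤ G.card / 2 := by
    have h1 := card_bigSet_le (f := f) (p := p) (h := h)
    refine le_of_mul_le_mul_left ?_ hhp
    linarith
  set G' := G \ E with hG'
  have hG'le : (G'.card : ℝ) ≤ G.card := by exact_mod_cast Finset.card_le_card Finset.sdiff_subset
  have hG'ge : (G.card : ℝ) / 2 ≤ G'.card := by
    have : G.card ≤ G'.card + E.card := by
      have := Finset.card_le_card (show G ⊆ G' ∪ E by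
        intro x hx; by_cases h : x ∈ E <;> simp [hG', hx, h])
      exact this.trans (Finset.card_union_le _ _)
    have : (G.card : ℝ) ≤ G'.card + E.card := by exact_mod_cast this
    linarith
  obtain ⟨M, hM⟩ : ∃ M : ℕ, ((1 : ℝ) / 2) ^ M * Fintype.card (Cube N) < 1 := by
    have hc : (0 : ℝ) < Fintype.card (Cube N) := by exact_mod_cast Fintype.card_pos
    obtain ⟨M, hM⟩ := exists_pow_lt_of_lt_one (x := (1 / (Fintype.card (Cube N) : ℝ)))
      (y := 1 / 2) (by positivity) (by norm_num)
    exact ⟨M, by rwa [lt_div_iff₀ hc] at hM⟩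
  set P : Set (Bitile N) := {s | (∀ k x m, tile k x m = s → ∃ y ∈ cyl k x, y ∉ E) ∧
    s ∉ light G' n ((1 / 2) ^ M)} with hP
  have hmem : ∀ x ∈ G', ∀ k < N, tile k x (n x) ∈ P := by
    intro x hx k hk
    have hxE : x ∉ E := (Finset.mem_sdiff.1 hx).2
    constructor
    · intro k' x' m he
      simp only [tile, Prod.mk.injEq] at he
      obtain ⟨rfl, he, -⟩ := he
      exact ⟨x, by rw [he]; exact self_mem_cyl _ x, hxE⟩
    · intro hlt
      have h1 := hlt k x (n x) rfl k le_rfl (n x) rfl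
      have h2 : 0 < (occupied G' n k x (n x)).card :=
        Finset.card_pos.2 ⟨x, Finset.mem_filter.2 ⟨self_mem_cyl _ x, hx, rfl⟩⟩
      have h3 : (1 : ℝ) ≤ (occupied G' n k x (n x)).card := by exact_mod_cast h2
      have h4 : ((cyl k x).card : ℝ) ≤ Fintype.card (Cube N) := by
        exact_mod_cast Finset.card_le_univ _
      have h5 := mul_le_mul_of_nonneg_left h4 (show (0 : ℝ) ≤ (1 / 2) ^ M by positivity)
      linarith
  have hlower : l * (G.card / 2) ≤ form f n G' P := by
    calc l * (G.card / 2) ≤ l * G'.card := mul_le_mul_of_nonneg_left hG'ge hl0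
      _ = ∑ x ∈ G', l := by rw [Finset.sum_const, nsmul_eq_mul, mul_comm]
      _ ≤ _ := by
        refine Finset.sum_le_sum fun x hx => (hl x (Finset.mem_sdiff.1 hx).1).trans (le_of_eq ?_)
        congr 1
        refine Finset.sum_congr rfl fun k hk => ?_
        have := hmem x hx k (Finset.mem_range.1 hk)
        simp only [Set.mem_univ, and_true, this]
  set T : ℕ → Set (Bitile N) := fun i =>
    P ∩ (light G' n ((1 / 2) ^ i) \ light G' n ((1 / 2) ^ (i + 1))) with hT
  have hanti : ∀ i j : ℕ, i ≤ j → light G' n ((1 / 2) ^ j) ⊆ light G' n ((1 / 2) ^ i) :=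
    fun i j hij => light_mono _ _ (pow_le_pow_of_le_one (by norm_num) (by norm_num) hij)
  have hupper : form f n G' P ≤ ∑ i ∈ range M, form f n G' (T i) := by
    refine form_le_sum (fun i _ => Set.inter_subset_left) ?_ ?_
    · intro k _ x m hx
      have hex : ∃ i, tile k x m ∉ light G' n ((1 / 2) ^ i) := ⟨M, hx.2⟩
      have hpos : Nat.find hex ≠ 0 := by
        intro h
        have := Nat.find_spec hex
        rw [h, pow_zero, light_one] at this
        exact this (Set.mem_univ _)
      obtain ⟨i, hi⟩ := Nat.exists_eq_succ_of_ne_zero hpos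
      have h1 := Nat.find_min' hex hx.2
      have h2 := Nat.find_spec hex
      have h3 := Nat.find_min hex (m := i) (by omega)
      rw [hi] at h2
      exact ⟨i, by omega, hx, not_not.1 h3, h2⟩
    · intro i _ j _ hij
      rw [Set.disjoint_left]
      rintro s ⟨-, h1, h2⟩ ⟨-, h3, h4⟩
      rcases lt_or_gt_of_ne hij with h | h
      · exact h2 (hanti (i + 1) j h h3)
      · exact h4 (hanti (j + 1) i h h1)
  have hclass : ∀ i, form f n G' (T i) ≤
      1500 * h * ((2 : ℝ) ^ (-(1 - 1 / p))) ^ i * G.card := fun i =>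
    form_density_class_le hp1 hp2 hh hn hG'le h0 hfG' (fun k _ x m hx => hx.1.1 k x m rfl) i
      (fun s hs => hs.2.1) (Set.disjoint_left.2 fun s hs => hs.2.2)
  have htotal : l * (G.card / 2) ≤ 1500 * h * (4 / (p - 1)) * G.card := by
    refine (hlower.trans hupper).trans ((Finset.sum_le_sum fun i _ => hclass i).trans ?_)
    rw [← Finset.sum_mul, ← Finset.mul_sum]
    have := sum_pow_two_rpow_le hp1 hp2 M
    gcongr
  have : l * G.card ≤ 12000 / (p - 1) * h * G.card := by
    calc l * G.card = 2 * (l * (G.card / 2)) := by ring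
      _ ≤ 2 * (1500 * h * (4 / (p - 1)) * G.card) := by linarith
      _ = _ := by ring
  exact le_of_mul_le_mul_right this hGpos

/-! ### Walsh partial sums as Carleson sums -/

theorem char_add {k a j : ℕ} (hj : j < 2 ^ k) (x : Cube N) :
    char (2 ^ k * a + j) x = char (2 ^ k * a) x * char j x := by
  simp only [char]
  rw [← Finset.prod_mul_distrib]
  refine Finset.prod_congr rfl fun i _ => ?_
  rw [Nat.testBit_two_pow_mul_add a hj]
  have h0 := Nat.testBit_two_pow_mul_add a (show 0 < 2 ^ k by positivity) i
  rw [add_zero, Nat.zero_testBit] at h0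
  rw [h0]
  by_cases hi : (i : ℕ) < k
  · simp [hi]
  · have : j.testBit i = false :=
      Nat.testBit_lt_two_pow (hj.trans_le (Nat.pow_le_pow_right (by norm_num) (not_lt.1 hi)))
    simp [hi, this]

theorem char_two_pow (k : Fin N) (x : Cube N) : char (2 ^ (k : ℕ)) x = if x k then -1 else 1 := by
  rw [char, Finset.prod_eq_single k]
  · simp
  · intro i _ hik
    have : (2 ^ (k : ℕ)).testBit (i : ℕ) = false := by
      rw [Nat.testBit_two_pow]; simpa using fun h => hik (Fin.ext h.symm)
    simp [this]
  · simp

theorem mem_cyl_succ {k : ℕ} (hk : k < N) {x y : Cube N} :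
    y ∈ cyl (k + 1) x ↔ y ∈ cyl k x ∧ y ⟨k, hk⟩ = x ⟨k, hk⟩ := by
  simp only [mem_cyl]
  constructor
  · exact fun h => ⟨fun i hi => h i (by omega), h _ (by simp)⟩
  · rintro ⟨h1, h2⟩ i hi
    rcases (Nat.lt_succ_iff.1 hi).eq_or_lt with h | h
    · rw [show i = ⟨k, hk⟩ from Fin.ext h, h2]
    · exact h1 i h

/-- The Dirichlet kernel of a dyadic number of terms. -/
theorem sum_range_two_pow_char {k : ℕ} (hk : k ≤ N) (x y : Cube N) :
    ∑ j ∈ range (2 ^ k), char j x * char j y = if y ∈ cyl k x then 2 ^ k else 0 := by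
  induction k with
  | zero => simp [cyl_zero, char]
  | succ k ih =>
    rw [pow_succ, mul_two, Finset.sum_range_add, ih (by omega)]
    have h1 : ∀ j ∈ range (2 ^ k), char (2 ^ k + j) x * char (2 ^ k + j) y =
        (char (2 ^ k) x * char (2 ^ k) y) * (char j x * char j y) := by
      intro j hj
      have h := fun z : Cube N => char_add (a := 1) (Finset.mem_range.1 hj) z
      simp only [mul_one] at h
      rw [h, h]; ring
    rw [Finset.sum_congr rfl h1, ← Finset.mul_sum, ih (by omega)]
    have h2 := fun z : Cube N => char_two_pow ⟨k, hk⟩ z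
    simp only at h2
    rw [h2, h2]
    by_cases h : y ∈ cyl k x
    · by_cases hb : y ⟨k, hk⟩ = x ⟨k, hk⟩
      · rw [if_pos ((mem_cyl_succ hk).2 ⟨h, hb⟩), if_pos h, hb]
        split_ifs <;> ring
      · rw [if_neg fun h' => hb ((mem_cyl_succ hk).1 h').2, if_pos h]
        revert hb
        cases x ⟨k, hk⟩ <;> cases y ⟨k, hk⟩ <;> simp
    · rw [if_neg fun h' => h ((mem_cyl_succ hk).1 h').1, if_neg h]; simp

theorem card_cyl_mul (k : ℕ) (hk : k ≤ N) (x : Cube N) : (cyl k x).card * 2 ^ k = 2 ^ N := by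
  induction k with
  | zero => simp [cyl_zero]
  | succ k ih =>
    rw [← ih (by omega), card_cyl_eq k hk x]; ring

theorem sum_range_eq_sum_blocks {M : Type*} [AddCommMonoid M] (a : ℕ → M) (n K : ℕ) :
    ∑ m ∈ range n, a m = ∑ m ∈ range (n / 2 ^ K * 2 ^ K), a m +
      ∑ k ∈ range K, if n.testBit k then ∑ j ∈ range (2 ^ k), a (hi k n + j) else 0 := by
  induction K with
  | zero => simp
  | succ K ih =>
    rw [ih, Finset.sum_range_succ, add_comm (∑ k ∈ range K, _), ← add_assoc]
    congr 1
    have h1 : n / 2 ^ K / 2 * 2 + n / 2 ^ K % 2 = n / 2 ^ K := by omega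
    have h2 : n / 2 ^ K / 2 = n / 2 ^ (K + 1) := by rw [Nat.div_div_eq_div_mul, pow_succ]
    have h3 : n / 2 ^ (K + 1) * 2 ^ (K + 1) = n / 2 ^ K / 2 * 2 * 2 ^ K := by
      rw [h2, pow_succ]; ring
    rw [Nat.testBit_eq_decide_div_mod_eq, hi, h3]
    rcases Nat.mod_two_eq_zero_or_one (n / 2 ^ K) with h | h
    · rw [h]
      simp only [zero_ne_one, decide_false, Bool.false_eq_true, if_false, add_zero]
      congr 3; omega
    · rw [h]
      simp only [decide_true, if_true]
      rw [← Finset.sum_range_add]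
      congr 2
      nth_rewrite 1 [← h1]
      rw [h]; ring

/-- The Walsh partial sum of order `n` is the Carleson sum over all bitiles at the frequency
`n`. -/
theorem sum_range_coeff_mul_char (f : Cube N → ℂ) (n : Cube N → ℕ) (x : Cube N)
    (hn : n x < 2 ^ N) :
    ∑ m ∈ range (n x), (∑ y, f y * char m y) / 2 ^ N * char m x = carlesonSum f n Set.univ x := by
  rw [sum_range_eq_sum_blocks _ _ N, Nat.div_eq_of_lt hn, zero_mul, Finset.range_zero,
    Finset.sum_empty, zero_add, carlesonSum]
  refine Finset.sum_congr rfl fun k hk => ?_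
  have hk := Finset.mem_range.1 hk
  simp only [Set.mem_univ, and_true]
  split_ifs
  · have hform : hi k (n x) = 2 ^ k * (2 * (n x / 2 ^ (k + 1))) := by
      rw [hi, pow_succ]; ring
    have h1 : ∀ j ∈ range (2 ^ k), (∑ y, f y * char (hi k (n x) + j) y) / 2 ^ N *
        char (hi k (n x) + j) x = ∑ y, f y * char (hi k (n x)) y * char (hi k (n x)) x / 2 ^ N *
          (char j x * char j y) := by
      intro j hj
      rw [Finset.sum_div, Finset.sum_mul]
      refine Finset.sum_congr rfl fun y _ => ?_
      rw [hform, char_add (Finset.mem_range.1 hj), char_add (Finset.mem_range.1 hj)]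
      ring
    rw [Finset.sum_congr rfl h1, Finset.sum_comm]
    simp only [← Finset.mul_sum, sum_range_two_pow_char hk.le]
    rw [coef, avg, Finset.sum_div, Finset.mul_sum]
    simp only [mul_ite, mul_zero, Finset.sum_ite_mem, Finset.univ_inter]
    refine Finset.sum_congr rfl fun y _ => ?_
    have h2 : ((cyl k x).card : ℂ) * 2 ^ k = 2 ^ N := by
      exact_mod_cast card_cyl_mul k hk.le x
    have h3 : ((cyl k x).card : ℂ) ≠ 0 := by exact_mod_cast (card_cyl_pos k x).ne'
    rw [← h2]
    field_simp
  · rfl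

/-! ### Transference to the unit interval -/

/-- The first `N` binary digits of a point of the unit interval. -/
def digits (N : ℕ) (x : ℝ) : Cube N := fun i => decide ¬ Even ⌊(2 : ℝ) ^ ((i : ℕ) + 1) * x⌋

theorem walsh_eq_char {n : ℕ} (hn : n < 2 ^ N) (x : ℝ) : (walsh n x : ℂ) = char n (digits N x) := by
  have h1 : walsh n x = ∏ k ∈ range N, if n.testBit k then rademacher k x else 1 := by
    refine Finset.prod_subset (Finset.range_mono (Nat.size_le.2 hn)) fun k _ hk => ?_
    have : n.testBit k = false := Nat.testBit_lt_two_pow <|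
      (Nat.lt_size_self n).trans_le (Nat.pow_le_pow_right (by norm_num)
        (not_lt.1 fun h => hk (Finset.mem_range.2 h)))
    simp [this]
  rw [h1, Complex.ofReal_prod, ← Fin.prod_univ_eq_prod_range
    (fun k => ((if n.testBit k then rademacher k x else 1 : ℝ) : ℂ)) N, char]
  refine Finset.prod_congr rfl fun i _ => ?_
  by_cases h : n.testBit i <;> by_cases h' : Even ⌊(2 : ℝ) ^ ((i : ℕ) + 1) * x⌋ <;>
    simp [h, h', rademacher, digits]

/-- The dyadic interval of length `2 ^ (-N)` with prescribed binary digits (extended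
periodically). -/
def cell (d : Cube N) : Set ℝ := digits N ⁻¹' {d}

theorem measurable_digits (N : ℕ) : Measurable (digits N) := by
  refine measurable_pi_iff.2 fun i => ?_
  have h1 : Measurable fun x : ℝ => ⌊(2 : ℝ) ^ ((i : ℕ) + 1) * x⌋ :=
    Int.measurable_floor.comp (measurable_const.mul measurable_id)
  exact (measurable_of_countable fun z : ℤ => decide ¬ Even z).comp h1

theorem measurableSet_cell (d : Cube N) : MeasurableSet (cell d) :=
  measurable_digits N (measurableSet_singleton d)

theorem pairwise_disjoint_cell : Pairwise (Function.onFun Disjoint (cell (N := N))) := by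
  intro d e hde
  exact Set.disjoint_left.2 fun x hx hx' => hde (hx.symm.trans hx')

theorem iUnion_cell : ⋃ d : Cube N, cell d = Set.univ :=
  Set.eq_univ_of_forall fun x => Set.mem_iUnion.2 ⟨digits N x, rfl⟩

instance : IsProbabilityMeasure torus := ⟨by simp [torus]⟩

/-- The binary digits of `x` are those of the integer part of `2 ^ N * x`, read backwards. -/
theorem digits_apply_eq (x : ℝ) (hx : 0 ≤ x) (i : Fin N) :
    digits N x i = (⌊(2 : ℝ) ^ N * x⌋₊).testBit (N - 1 - i) := by
  have hN : (2 : ℝ) ^ N = 2 ^ ((i : ℕ) + 1) * 2 ^ (N - 1 - i) := by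
    rw [← pow_add]; congr 1; have := i.2; omega
  have h1 : ⌊(2 : ℝ) ^ ((i : ℕ) + 1) * x⌋ = ((⌊(2 : ℝ) ^ N * x⌋₊ / 2 ^ (N - 1 - i) : ℕ) : ℤ) := by
    rw [← Nat.floor_div_natCast, Int.natCast_floor_eq_floor (by positivity)]
    congr 1
    push_cast
    rw [eq_div_iff (by positivity)]
    rw [hN]; ring
  simp only [digits, h1, Nat.testBit_eq_decide_div_mod_eq, Int.even_coe_nat, Nat.not_even_iff]

theorem torus_cell (d : Cube N) : torus (cell d) = (2 ^ N : ℝ≥0∞)⁻¹ := by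
  set φ : Fin (2 ^ N) → Cube N := fun j i => (j : ℕ).testBit (N - 1 - i) with hφ
  have hinj : Function.Injective φ := by
    intro a b hab
    refine Fin.ext (Nat.eq_of_testBit_eq fun i => ?_)
    by_cases hi : i < N
    · have := congrFun hab ⟨N - 1 - i, by omega⟩
      simp only [hφ, show N - 1 - (N - 1 - i) = i by omega] at this
      exact this
    · have h2 : 2 ^ N ≤ 2 ^ i := Nat.pow_le_pow_right (by norm_num) (not_lt.1 hi)
      rw [Nat.testBit_lt_two_pow (a.2.trans_le h2), Nat.testBit_lt_two_pow (b.2.trans_le h2)]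
  have hbij : Function.Bijective φ :=
    (Fintype.bijective_iff_injective_and_card φ).2 ⟨hinj, by simp⟩
  obtain ⟨j, rfl⟩ := hbij.2 d
  have h2N : (0 : ℝ) < 2 ^ N := by positivity
  have hset : cell (φ j) ∩ Ico (0 : ℝ) 1 =
      Ico ((j : ℕ) / (2 : ℝ) ^ N) (((j : ℕ) + 1) / (2 : ℝ) ^ N) := by
    have hfl : ∀ x : ℝ, 0 ≤ x → (⌊(2 : ℝ) ^ N * x⌋₊ = j ↔
        x ∈ Ico ((j : ℕ) / (2 : ℝ) ^ N) (((j : ℕ) + 1) / (2 : ℝ) ^ N)) := by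
      intro x hx
      rw [Nat.floor_eq_iff (by positivity), mem_Ico, div_le_iff₀ h2N, lt_div_iff₀ h2N, mul_comm x]
    ext x
    constructor
    · rintro ⟨hx, h0, h1⟩
      have hlt : ⌊(2 : ℝ) ^ N * x⌋₊ < 2 ^ N := by
        rw [Nat.floor_lt (by positivity)]; push_cast; nlinarith
      have : φ ⟨_, hlt⟩ = φ j := by
        rw [← show digits N x = φ j from hx]
        funext i; exact (digits_apply_eq x h0 i).symm
      exact (hfl x h0).1 (congrArg Fin.val (hinj this))
    · intro hx
      have h0 : 0 ≤ x := le_trans (by positivity) hx.1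
      have h1 : x < 1 := by
        refine hx.2.trans_le ?_
        rw [div_le_one h2N]
        exact_mod_cast j.2
      refine ⟨?_, h0, h1⟩
      change digits N x = φ j
      funext i
      rw [digits_apply_eq x h0 i, (hfl x h0).2 hx]
  rw [torus, Measure.restrict_apply (measurableSet_cell _), hset, Real.volume_Ico, ← sub_div,
    add_sub_cancel_left, one_div, ENNReal.ofReal_inv_of_pos h2N, ENNReal.ofReal_pow (by norm_num)]
  simp

theorem torus_preimage_digits (G : Finset (Cube N)) :
    torus (digits N ⁻¹' (G : Set (Cube N))) = G.card * (2 ^ N : ℝ≥0∞)⁻¹ := by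
  have h : digits N ⁻¹' (G : Set (Cube N)) = ⋃ d ∈ G, cell d := by
    ext x; simp [cell]
  rw [h, measure_biUnion_finset (fun d _ e _ hde => pairwise_disjoint_cell hde)
    fun d _ => measurableSet_cell d]
  simp [torus_cell]

/-- The averages of `f` over the dyadic intervals of length `2 ^ (-N)`. -/
def discretize (N : ℕ) (f : ℝ → ℂ) (d : Cube N) : ℂ := 2 ^ N * ∫ x in cell d, f x ∂torus

theorem integrable_mul_walsh {f : ℝ → ℂ} (hf : Integrable f torus) (k : ℕ) :
    Integrable (fun x => f x * (walsh k x : ℂ)) torus := by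
  simp only [walsh_eq_char (Nat.lt_two_pow_self (n := k))]
  refine hf.mul_bdd (c := 1) ?_ ?_
  · exact ((measurable_of_countable (char k)).comp (measurable_digits k)).aestronglyMeasurable
  · exact Filter.Eventually.of_forall fun x => (norm_char _ _).le

theorem walshCoeff_eq {f : ℝ → ℂ} (hf : Integrable f torus) {m : ℕ} (hm : m < 2 ^ N) :
    walshCoeff f m = (∑ d, discretize N f d * char m d) / 2 ^ N := by
  have h1 : ∀ d : Cube N, ∫ x in cell d, f x * (walsh m x : ℂ) ∂torus =
      (∫ x in cell d, f x ∂torus) * char m d := by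
    intro d
    rw [← integral_mul_const]
    refine setIntegral_congr_fun (measurableSet_cell d) fun x hx => ?_
    simp only [walsh_eq_char hm, show digits N x = d from hx]
  have h2 := integrable_mul_walsh hf m
  rw [walshCoeff, ← setIntegral_univ, ← iUnion_cell (N := N),
    integral_iUnion_fintype measurableSet_cell pairwise_disjoint_cell
      fun d => h2.integrableOn, Finset.sum_div]
  refine Finset.sum_congr rfl fun d _ => ?_
  rw [h1, discretize]
  field_simp

theorem walshPartialSum_eq {f : ℝ → ℂ} (hf : Integrable f torus) {m : ℕ} (hm : m < 2 ^ N) (x : ℝ)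
    {n : Cube N → ℕ} (hn : n (digits N x) = m) :
    walshPartialSum m f x = carlesonSum (discretize N f) n Set.univ (digits N x) := by
  rw [← sum_range_coeff_mul_char _ _ _ (hn ▸ hm), hn, walshPartialSum]
  refine Finset.sum_congr rfl fun k hk => ?_
  have hk := (Finset.mem_range.1 hk).trans hm
  rw [walshCoeff_eq hf hk, walsh_eq_char hk]

theorem sum_norm_discretize_le {f : ℝ → ℂ} {p : ℝ} (hp : 1 ≤ p)
    (hf : MemLp f (ENNReal.ofReal p) torus) :
    ∑ d, ‖discretize N f d‖ ^ p ≤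
      2 ^ N * (eLpNorm f (ENNReal.ofReal p) torus).toReal ^ p := by
  have hp0 : 0 < p := by linarith
  have hpt : (ENNReal.ofReal p).toReal = p := ENNReal.toReal_ofReal hp0.le
  have hpne : ENNReal.ofReal p ≠ 0 := by simpa using hp0
  have h2 : (2 ^ N : ℝ≥0∞) ≠ 0 := by positivity
  have h2' : (2 ^ N : ℝ≥0∞) ≠ ∞ := by finiteness
  have hpow : ∀ μ : Measure ℝ, eLpNorm f (ENNReal.ofReal p) μ ^ p = ∫⁻ x, ‖f x‖ₑ ^ p ∂μ := by
    intro μ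
    rw [eLpNorm_eq_lintegral_rpow_enorm_toReal hpne ENNReal.ofReal_ne_top, hpt, ← ENNReal.rpow_mul,
      one_div_mul_cancel hp0.ne', ENNReal.rpow_one]
  have h1 : ∀ d : Cube N, ‖discretize N f d‖ₑ ^ p ≤ 2 ^ N * ∫⁻ x in cell d, ‖f x‖ₑ ^ p ∂torus := by
    intro d
    have h3 : ‖discretize N f d‖ₑ ≤ (2 ^ N : ℝ≥0∞) *
        (eLpNorm f (ENNReal.ofReal p) (torus.restrict (cell d)) * (2 ^ N : ℝ≥0∞)⁻¹ ^ (1 - 1 / p)) := by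
      rw [discretize, enorm_mul, enorm_pow]
      have : ‖(2 : ℂ)‖ₑ = 2 := by
        rw [← ofReal_norm]; norm_num
      rw [this]
      gcongr
      refine (enorm_integral_le_lintegral_enorm _).trans ?_
      rw [← eLpNorm_one_eq_lintegral_enorm]
      refine (eLpNorm_le_eLpNorm_mul_rpow_measure_univ (q := ENNReal.ofReal p) ?_
        hf.1.restrict).trans ?_
      · simpa using hp
      · rw [Measure.restrict_apply_univ, torus_cell, hpt, ENNReal.toReal_one, div_one]
    calc ‖discretize N f d‖ₑ ^ p ≤ _ := ENNReal.rpow_le_rpow h3 hp0.le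
      _ = 2 ^ N * ∫⁻ x in cell d, ‖f x‖ₑ ^ p ∂torus := by
        rw [ENNReal.mul_rpow_of_nonneg _ _ hp0.le, ENNReal.mul_rpow_of_nonneg _ _ hp0.le, hpow,
          ← ENNReal.rpow_mul, ENNReal.inv_rpow, mul_left_comm, mul_comm (2 ^ N : ℝ≥0∞),
          ← ENNReal.rpow_neg, ← ENNReal.rpow_add _ _ h2 h2']
        congr 1
        rw [show p + -((1 - 1 / p) * p) = 1 by field_simp; ring, ENNReal.rpow_one]
  have h4 : ∑ d : Cube N, ‖discretize N f d‖ₑ ^ p ≤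
      2 ^ N * eLpNorm f (ENNReal.ofReal p) torus ^ p := by
    refine (Finset.sum_le_sum fun d _ => h1 d).trans (le_of_eq ?_)
    rw [← Finset.mul_sum, hpow, ← setLIntegral_univ, ← iUnion_cell (N := N),
      lintegral_iUnion measurableSet_cell pairwise_disjoint_cell, tsum_fintype]
  have h5 := ENNReal.toReal_mono (ENNReal.mul_ne_top h2'
    (ENNReal.rpow_ne_top_of_nonneg hp0.le hf.2.ne)) h4
  rw [ENNReal.toReal_sum fun d _ => ENNReal.rpow_ne_top_of_nonneg hp0.le enorm_ne_top,
    ENNReal.toReal_mul, ENNReal.toReal_pow, ← ENNReal.toReal_rpow] at h5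
  simpa only [← ENNReal.toReal_rpow, toReal_enorm, ENNReal.toReal_ofNat] using h5

theorem carlesonSum_congr (f : Cube N → ℂ) {n n' : Cube N → ℕ} (P : Set (Bitile N)) {x : Cube N}
    (h : n x = n' x) : carlesonSum f n P x = carlesonSum f n' P x := by
  simp only [carlesonSum, h]

/-- The points where a Walsh partial sum of order less than `2 ^ N` exceeds `t`. -/
def levelSet (f : ℝ → ℂ) (t : ℝ≥0) (N : ℕ) : Set ℝ :=
  {x | ∃ m < 2 ^ N, (t : ℝ≥0∞) < ‖walshPartialSum m f x‖ₑ}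

theorem mul_torus_levelSet_le {f : ℝ → ℂ} {p : ℝ} (hp1 : 1 < p) (hp2 : p ≤ 2)
    (hf : MemLp f (ENNReal.ofReal p) torus) (t : ℝ≥0) (N : ℕ) :
    (t : ℝ≥0∞) * torus (levelSet f t N) ^ (1 / p) ≤
      ENNReal.ofReal (24000 / (p - 1)) * eLpNorm f (ENNReal.ofReal p) torus := by
  have hp0 : 0 < p := by linarith
  have hint : Integrable f torus := hf.integrable (by simpa using hp1.le)
  set F := discretize N f with hF
  -- Where some partial sum is large, `n` chooses its order.
  set Q : Cube N → ℕ → Prop := fun d m => m < 2 ^ N ∧ (t : ℝ) < ‖carlesonSum F (fun _ => m)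
    Set.univ d‖ with hQ
  set n : Cube N → ℕ := fun d => if h : ∃ m, Q d m then h.choose else 0 with hn
  have hnQ : ∀ d, (∃ m, Q d m) → Q d (n d) := by
    intro d h
    simp only [hn, dif_pos h]
    exact h.choose_spec
  have hn2 : ∀ d, n d < 2 ^ N := by
    intro d
    by_cases h : ∃ m, Q d m
    · exact (hnQ d h).1
    · simp only [hn, dif_neg h]; positivity
  set G : Finset (Cube N) := Finset.univ.filter fun d => ∃ m, Q d m with hG
  have hset : levelSet f t N = digits N ⁻¹' (G : Set (Cube N)) := by
    ext x
    simp only [levelSet, mem_ofPred_eq, mem_preimage, hG, Finset.coe_filter, Finset.mem_univ,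
      true_and, hQ]
    refine exists_congr fun m => and_congr_right fun hm => ?_
    rw [walshPartialSum_eq hint hm x (n := fun _ => m) rfl, ← ofReal_norm,
      ← ENNReal.ofReal_coe_nnreal, ENNReal.ofReal_lt_ofReal_iff_of_nonneg t.coe_nonneg]
  rw [hset, torus_preimage_digits]
  rcases G.eq_empty_or_nonempty with hGe | hGne
  · rw [hGe]
    simp [hp0]
  have hGpos : (0 : ℝ) < G.card := by exact_mod_cast Finset.card_pos.2 hGne
  have hl : ∀ d ∈ G, (t : ℝ) ≤ ‖carlesonSum F n Set.univ d‖ := by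
    intro d hd
    rw [carlesonSum_congr F (n' := fun _ => n d) Set.univ rfl]
    exact (hnQ d (Finset.mem_filter.1 hd).2).2.le
  set I : ℝ := (eLpNorm f (ENNReal.ofReal p) torus).toReal with hI
  have hI0 : 0 ≤ I := ENNReal.toReal_nonneg
  set q : ℝ := G.card * (2 ^ N)⁻¹ with hq
  have hq0 : 0 < q := by positivity
  have hsum : ∑ d, ‖F d‖ ^ p ≤ 2 ^ N * I ^ p := sum_norm_discretize_le hp1.le hf
  set h0 : ℝ := 2 * I * q ^ (-(1 / p)) with hh0
  have hh00 : 0 ≤ h0 := by positivity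
  have hh0p : 2 * (2 ^ N * I ^ p) ≤ h0 ^ p * G.card := by
    rw [hh0, Real.mul_rpow (by positivity) (by positivity), Real.mul_rpow (by norm_num) hI0,
      ← Real.rpow_mul hq0.le, show -(1 / p) * p = -1 by field_simp, Real.rpow_neg_one, hq]
    have : (2 : ℝ) ≤ 2 ^ p := by
      simpa using Real.rpow_le_rpow_of_exponent_le (show (1 : ℝ) ≤ 2 by norm_num) hp1.le
    calc 2 * (2 ^ N * I ^ p) ≤ 2 ^ p * (2 ^ N * I ^ p) := by gcongr
      _ = _ := by field_simp
  have key : (t : ℝ) ≤ 12000 / (p - 1) * h0 := by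
    have hc : 0 < 12000 / (p - 1) := by have : 0 < p - 1 := by linarith
                                        positivity
    refine le_of_forall_pos_le_add fun ε hε => ?_
    have h1 := le_of_le_norm_carlesonSum (f := F) (h := h0 + ε / (12000 / (p - 1))) hp1 hp2
      (by positivity) hn2 hGne ?_ t.coe_nonneg hl
    · rwa [mul_add, mul_div_cancel₀ _ hc.ne'] at h1
    · refine le_trans (by linarith) (hh0p.trans ?_)
      gcongr
      linarith [div_pos hε hc]
  have key2 : (t : ℝ) * q ^ (1 / p) ≤ 24000 / (p - 1) * I := by
    calc (t : ℝ) * q ^ (1 / p) ≤ 12000 / (p - 1) * h0 * q ^ (1 / p) := by gcongr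
      _ = 24000 / (p - 1) * I * (q ^ (-(1 / p)) * q ^ (1 / p)) := by rw [hh0]; ring
      _ = _ := by rw [← Real.rpow_add hq0, neg_add_cancel, Real.rpow_zero, mul_one]
  have e1 : (G.card : ℝ≥0∞) * (2 ^ N : ℝ≥0∞)⁻¹ = ENNReal.ofReal q := by
    rw [hq, ENNReal.ofReal_mul (by positivity), ENNReal.ofReal_natCast,
      ENNReal.ofReal_inv_of_pos (by positivity), ENNReal.ofReal_pow (by norm_num)]
    simp
  rw [e1, ENNReal.ofReal_rpow_of_pos hq0, ← ENNReal.ofReal_coe_nnreal,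
    ← ENNReal.ofReal_mul t.coe_nonneg, ← ENNReal.ofReal_toReal hf.2.ne,
    ← ENNReal.ofReal_mul (by have : 0 < p - 1 := by linarith
                             positivity)]
  exact ENNReal.ofReal_le_ofReal key2

theorem weakNorm_walshMaximal_le {f : ℝ → ℂ} {p : ℝ} (hp1 : 1 < p) (hp2 : p ≤ 2)
    (hf : MemLp f (ENNReal.ofReal p) torus) :
    weakNorm (walshMaximal f) p torus ≤
      ENNReal.ofReal (24000 / (p - 1)) * eLpNorm f (ENNReal.ofReal p) torus := by
  refine iSup_le fun t => ?_
  have hU : {x | (t : ℝ≥0∞) < walshMaximal f x} = ⋃ N, levelSet f t N := by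
    ext x
    simp only [mem_ofPred_eq, walshMaximal, lt_iSup_iff, mem_iUnion, levelSet]
    exact ⟨fun ⟨n, hn⟩ => ⟨n, n, Nat.lt_two_pow_self, hn⟩, fun ⟨_, n, _, hn⟩ => ⟨n, hn⟩⟩
  have hmono : Monotone (levelSet f t) := fun M N hMN x ⟨m, hm, h⟩ =>
    ⟨m, hm.trans_le (Nat.pow_le_pow_right (by norm_num) hMN), h⟩
  rw [hU]
  have h1 := ((ENNReal.continuous_rpow_const (y := 1 / p)).tendsto _).comp
    (tendsto_measure_iUnion_atTop (μ := torus) hmono)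
  have h2 := ENNReal.Tendsto.const_mul (a := (t : ℝ≥0∞)) h1 (Or.inr ENNReal.coe_ne_top)
  exact le_of_tendsto' h2 fun N => mul_torus_levelSet_le hp1 hp2 hf t N

end Discrete

/-! ### The mixed estimate -/

theorem weakNorm_one_le {α : Type*} [MeasurableSpace α] (g : α → ℝ≥0∞) {p : ℝ} (hp : 1 ≤ p)
    (μ : Measure α) [IsProbabilityMeasure μ] : weakNorm g 1 μ ≤ weakNorm g p μ := by
  refine iSup_mono fun t => ?_
  refine mul_le_mul_right ?_ _
  refine ENNReal.rpow_le_rpow_of_exponent_ge (prob_le_one (μ := μ)) ?_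
  rw [div_le_iff₀ (by linarith)]; linarith

/-- The weak `L¹` bound obtained from the weak `L ^ p` bound by interpolating the `L ^ p` norm
between `L¹` and `L ^ ∞`. -/
theorem weakNorm_walshMaximal_one_le {f : ℝ → ℂ} {p B : ℝ} (hp1 : 1 < p) (hp2 : p ≤ 2)
    (hf : AEStronglyMeasurable f torus) (hB : ∀ᵐ x ∂torus, ‖f x‖ ≤ B) (hB0 : 0 ≤ B) :
    weakNorm (walshMaximal f) 1 torus ≤
      ENNReal.ofReal (24000 / (p - 1) * (B ^ (p - 1) * (eLpNorm f 1 torus).toReal) ^ (1 / p)) := by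
  have hp0 : 0 < p := by linarith
  have hmem : ∀ q, MemLp f q torus := fun q => MemLp.of_bound hf B hB
  refine (weakNorm_one_le _ hp1.le _).trans ((weakNorm_walshMaximal_le hp1 hp2 (hmem _)).trans ?_)
  rw [ENNReal.ofReal_mul (by have : 0 < p - 1 := by linarith
                             positivity)]
  gcongr
  rw [← ENNReal.ofReal_rpow_of_nonneg (by positivity) (by positivity),
    ENNReal.ofReal_mul (by positivity), ENNReal.ofReal_toReal (hmem 1).2.ne,
    eLpNorm_eq_lintegral_rpow_enorm_toReal (by simpa using hp0) ENNReal.ofReal_ne_top,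
    ENNReal.toReal_ofReal hp0.le, eLpNorm_one_eq_lintegral_enorm]
  gcongr ?_ ^ (1 / p)
  rw [← lintegral_const_mul' _ _ ENNReal.ofReal_ne_top]
  refine lintegral_mono_ae ?_
  filter_upwards [hB] with x hx
  have h1 : ‖f x‖ ^ p ≤ B ^ (p - 1) * ‖f x‖ := by
    have : ‖f x‖ ^ p = ‖f x‖ ^ (p - 1) * ‖f x‖ := by
      have h := Real.rpow_add_one' (x := ‖f x‖) (y := p - 1) (norm_nonneg _) (by linarith)
      rwa [sub_add_cancel] at h
    rw [this]
    gcongr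
  rw [← ofReal_norm, ENNReal.ofReal_rpow_of_nonneg (norm_nonneg _) hp0.le,
    ← ENNReal.ofReal_mul (by positivity)]
  exact ENNReal.ofReal_le_ofReal h1

theorem weakNorm_walshMaximal_one_le_log {f : ℝ → ℂ} (hf : MemLp f ∞ torus) :
    weakNorm (walshMaximal f) 1 torus ≤
      ENNReal.ofReal (72000 * (eLpNorm f 1 torus).toReal *
        Real.log (Real.exp 1 + (eLpNorm f ∞ torus).toReal / (eLpNorm f 1 torus).toReal)) := by
  set t := (eLpNorm f 1 torus).toReal with ht
  set M := (eLpNorm f ∞ torus).toReal with hM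
  have ht0 : 0 ≤ t := ENNReal.toReal_nonneg
  have hM0 : 0 ≤ M := ENNReal.toReal_nonneg
  have hbound : ∀ᵐ x ∂torus, ‖f x‖ ≤ M := by
    have h := ae_le_eLpNormEssSup (f := f) (μ := torus)
    filter_upwards [h] with x hx
    rw [← toReal_enorm, hM, eLpNorm_exponent_top]
    refine ENNReal.toReal_mono ?_ hx
    rw [← eLpNorm_exponent_top]; exact hf.2.ne
  set y := Real.exp 1 + M / t with hy
  have hy1 : Real.exp 1 ≤ y := by
    have : 0 ≤ M / t := by positivity
    linarith
  have hy0 : 0 < y := (Real.exp_pos 1).trans_le hy1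
  set Λ := Real.log y with hΛ
  have hΛ1 : 1 ≤ Λ := (Real.le_log_iff_exp_le hy0).2 hy1
  -- The exponent is chosen so that the `L ^ p` norm is comparable to the `L¹` norm.
  set p : ℝ := 1 + 1 / Λ with hp
  have hΛ0 : 0 < Λ := by linarith
  have hinv : 0 < 1 / Λ := by positivity
  have hinv1 : 1 / Λ ≤ 1 := by rw [div_le_one hΛ0]; exact hΛ1
  have hp1 : 1 < p := by linarith
  have hp0 : 0 < p := by linarith
  refine (weakNorm_walshMaximal_one_le hp1 (by linarith) hf.1 hbound hM0).trans
    (ENNReal.ofReal_le_ofReal ?_)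
  rw [← ht]
  have hpm : p - 1 = 1 / Λ := by rw [hp]; ring
  rcases ht0.eq_or_lt with h0 | htpos
  · rw [← h0, mul_zero, Real.zero_rpow (by positivity)]; simp
  have key : (M ^ (p - 1) * t) ^ (1 / p) ≤ Real.exp 1 * t := by
    have h1 : M ^ (p - 1) * t = (M / t) ^ (p - 1) * t ^ p := by
      rw [Real.div_rpow hM0 ht0, div_mul_eq_mul_div, mul_div_assoc, ← Real.rpow_sub htpos]
      norm_num
    rw [h1, Real.mul_rpow (by positivity) (by positivity), ← Real.rpow_mul ht0,
      mul_one_div_cancel hp0.ne', Real.rpow_one]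
    gcongr
    have h2 : (M / t) ^ (p - 1) ≤ Real.exp 1 := by
      calc (M / t) ^ (p - 1) ≤ y ^ (p - 1) :=
            Real.rpow_le_rpow (by positivity) (by rw [hy]; linarith [Real.exp_pos 1])
              (by linarith)
        _ = Real.exp 1 := by
            rw [Real.rpow_def_of_pos hy0, ← hΛ, hpm, mul_one_div_cancel hΛ0.ne']
    calc ((M / t) ^ (p - 1)) ^ (1 / p) ≤ Real.exp 1 ^ (1 / p) := by gcongr
      _ ≤ Real.exp 1 ^ (1 : ℝ) := by
          refine Real.rpow_le_rpow_of_exponent_le (Real.one_le_exp (by norm_num)) ?_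
          rw [div_le_one hp0]; exact hp1.le
      _ = _ := Real.rpow_one _
  have he : Real.exp 1 ≤ 3 := by linarith [Real.exp_one_lt_d9]
  rw [show 24000 / (p - 1) = 24000 * Λ by rw [hpm]; field_simp]
  calc 24000 * Λ * (M ^ (p - 1) * t) ^ (1 / p) ≤ 24000 * Λ * (Real.exp 1 * t) := by gcongr
    _ ≤ 24000 * Λ * (3 * t) := by gcongr
    _ = _ := by ring

/-! ### Countable sums in weak `L¹` -/

theorem le_inv_mul_add_sum {g s : ℝ≥0∞} (h : g ≤ s) (K : ℕ) :
    g ≤ 2⁻¹ ^ K * s + ∑ i ∈ range K, if 2⁻¹ ^ (i + 1) * s < g then 2⁻¹ ^ i * s else 0 := by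
  induction K with
  | zero => simpa using h
  | succ K ih =>
    rw [Finset.sum_range_succ]
    split_ifs with h1
    · refine ih.trans ?_
      rw [add_comm]
      exact le_add_self
    · exact (not_lt.1 h1).trans le_self_add

/-- The weight `1 + 2 * weight j` of the `j`-th summand is of logarithmic size. -/
def weight (j : ℕ) : ℕ := 2 * (j + 1).size

theorem tsum_inv_two_pow_weight_le : ∑' j, (2⁻¹ : ℝ≥0∞) ^ weight j ≤ 1 := by
  have hj : ∀ j, (2⁻¹ : ℝ≥0∞) ^ weight j ≤
      ENNReal.ofReal (1 / ((j : ℝ) + 1) - 1 / ((j : ℝ) + 2)) := by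
    intro j
    have h1 : ((j : ℝ) + 2) ≤ 2 ^ (j + 1).size := by
      exact_mod_cast Nat.lt_size_self (j + 1)
    have h2 : (2⁻¹ : ℝ≥0∞) ^ weight j = ENNReal.ofReal ((2 ^ weight j)⁻¹) := by
      rw [ENNReal.ofReal_inv_of_pos (by positivity), ENNReal.ofReal_pow (by norm_num),
        ENNReal.inv_pow]
      simp
    rw [h2]
    refine ENNReal.ofReal_le_ofReal ?_
    have h3 : ((j : ℝ) + 1) * ((j : ℝ) + 2) ≤ 2 ^ weight j := by
      rw [weight, mul_comm 2, pow_mul]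
      nlinarith
    calc ((2 : ℝ) ^ weight j)⁻¹ ≤ (((j : ℝ) + 1) * ((j : ℝ) + 2))⁻¹ := by gcongr
      _ = _ := by field_simp; ring
  refine ENNReal.tsum_le_of_sum_range_le fun n => ?_
  refine (Finset.sum_le_sum fun j _ => hj j).trans ?_
  have hnn : ∀ j : ℕ, 0 ≤ 1 / ((j : ℝ) + 1) - 1 / ((j : ℝ) + 2) := by
    intro j
    rw [sub_nonneg]
    gcongr
    norm_num
  rw [← ENNReal.ofReal_sum_of_nonneg fun j _ => hnn j, ← ENNReal.ofReal_one]
  refine ENNReal.ofReal_le_ofReal ?_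
  have h := Finset.sum_range_sub' (fun j : ℕ => 1 / ((j : ℝ) + 1)) n
  have e : ∀ j : ℕ, 1 / (((j + 1 : ℕ) : ℝ) + 1) = 1 / ((j : ℝ) + 2) := by
    intro j; push_cast; congr 1; ring
  simp only [e] at h
  rw [h]
  simp only [CharP.cast_eq_zero, zero_add, div_one]
  have : 0 ≤ 1 / ((n : ℝ) + 1) := by positivity
  linarith

theorem mul_measure_lt_le_weakNorm {α : Type*} [MeasurableSpace α] {μ : Measure α}
    (g : α → ℝ≥0∞) (s : ℝ≥0) : (s : ℝ≥0∞) * μ {x | (s : ℝ≥0∞) < g x} ≤ weakNorm g 1 μ := by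
  have h := le_iSup (fun t : ℝ≥0 => (t : ℝ≥0∞) * μ {x | (t : ℝ≥0∞) < g x} ^ (1 / (1 : ℝ))) s
  simpa [weakNorm] using h

/-- The logarithmic convexity of weak `L¹`: it behaves like a normed space up to a logarithmic
weight. -/
theorem weakNorm_le_tsum {α : Type*} [MeasurableSpace α] {μ : Measure α} {g : ℕ → α → ℝ≥0∞}
    (hg : ∀ j, Measurable (g j)) {h : α → ℝ≥0∞} (hh : ∀ x, h x ≤ ∑' j, g j x) :
    weakNorm h 1 μ ≤ 2 * ∑' j, (1 + 2 * weight j : ℕ) * weakNorm (g j) 1 μ := by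
  refine iSup_le fun t => ?_
  rw [div_one, ENNReal.rpow_one]
  set s : ℝ≥0 := t / 2 with hs
  have hts : (t : ℝ≥0∞) = 2 * s := by
    rw [hs]; norm_cast; field_simp
  rw [hts, mul_assoc]
  gcongr 2 * ?_
  set a : ℕ → ℝ≥0∞ := fun j => weakNorm (g j) 1 μ with ha
  set T : ℕ → α → ℝ≥0∞ := fun j x => ∑ i ∈ range (weight j),
    if 2⁻¹ ^ (i + 1) * (s : ℝ≥0∞) < g j x then 2⁻¹ ^ i * (s : ℝ≥0∞) else 0 with hT
  have hlevel : ∀ j i, MeasurableSet {x | 2⁻¹ ^ (i + 1) * (s : ℝ≥0∞) < g j x} :=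
    fun j i => measurableSet_lt measurable_const (hg j)
  have hTm : ∀ j, Measurable (T j) := fun j =>
    Finset.measurable_sum _ fun i _ => Measurable.ite (hlevel j i) measurable_const
      measurable_const
  have hTint : ∀ j, ∫⁻ x, T j x ∂μ ≤ (2 * weight j : ℕ) * a j := by
    intro j
    rw [hT, lintegral_finsetSum _ fun i _ => Measurable.ite (hlevel j i) measurable_const
      measurable_const]
    have hi : ∀ i ∈ range (weight j), ∫⁻ x, (if 2⁻¹ ^ (i + 1) * (s : ℝ≥0∞) < g j x then
        2⁻¹ ^ i * (s : ℝ≥0∞) else 0) ∂μ ≤ 2 * a j := by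
      intro i _
      have e1 : ∫⁻ x, (if 2⁻¹ ^ (i + 1) * (s : ℝ≥0∞) < g j x then
          2⁻¹ ^ i * (s : ℝ≥0∞) else 0) ∂μ =
          2⁻¹ ^ i * (s : ℝ≥0∞) * μ {x | 2⁻¹ ^ (i + 1) * (s : ℝ≥0∞) < g j x} := by
        rw [← lintegral_indicator_const (hlevel j i)]
        exact lintegral_congr fun x => by simp [Set.indicator_apply]
      have e2 : (2⁻¹ : ℝ≥0∞) ^ (i + 1) * (s : ℝ≥0∞) = ((2⁻¹ ^ (i + 1) * s : ℝ≥0) : ℝ≥0∞) := by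
        rw [ENNReal.coe_mul, ENNReal.coe_pow, ENNReal.coe_inv two_ne_zero, ENNReal.coe_ofNat]
      have e3 : (2⁻¹ : ℝ≥0∞) ^ i = 2 * 2⁻¹ ^ (i + 1) := by
        rw [pow_succ, mul_comm _ (2⁻¹ : ℝ≥0∞), ← mul_assoc,
          ENNReal.mul_inv_cancel two_ne_zero ENNReal.ofNat_ne_top, one_mul]
      rw [e1, e3, mul_assoc 2, mul_assoc 2, e2]
      gcongr 2 * ?_
      exact mul_measure_lt_le_weakNorm _ _
    refine (Finset.sum_le_sum hi).trans (le_of_eq ?_)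
    rw [Finset.sum_const, Finset.card_range, nsmul_eq_mul]
    push_cast; ring
  have hsub : {x | 2 * (s : ℝ≥0∞) < h x} ⊆ (⋃ j, {x | (s : ℝ≥0∞) < g j x}) ∪
      {x | (s : ℝ≥0∞) ≤ ∑' j, T j x} := by
    intro x hx
    by_cases hx' : ∃ j, (s : ℝ≥0∞) < g j x
    · exact Or.inl (Set.mem_iUnion.2 hx')
    · right
      push Not at hx'
      have h1 : 2 * (s : ℝ≥0∞) ≤ s + ∑' j, T j x := by
        calc 2 * (s : ℝ≥0∞) ≤ h x := (show 2 * (s : ℝ≥0∞) < h x from hx).le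
          _ ≤ ∑' j, g j x := hh x
          _ ≤ ∑' j, (2⁻¹ ^ weight j * s + T j x) :=
              ENNReal.tsum_le_tsum fun j => le_inv_mul_add_sum (hx' j) _
          _ = (∑' j, 2⁻¹ ^ weight j) * s + ∑' j, T j x := by
              rw [ENNReal.tsum_add, ENNReal.tsum_mul_right]
          _ ≤ 1 * s + ∑' j, T j x := by gcongr; exact tsum_inv_two_pow_weight_le
          _ = _ := by rw [one_mul]
      rw [two_mul] at h1
      exact (ENNReal.add_le_add_iff_left ENNReal.coe_ne_top).1 h1
  have h2 : (s : ℝ≥0∞) * μ {x | (s : ℝ≥0∞) ≤ ∑' j, T j x} ≤ ∑' j, (2 * weight j : ℕ) * a j := by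
    refine (mul_meas_ge_le_lintegral₀ (Measurable.tsum hTm).aemeasurable _).trans ?_
    rw [lintegral_tsum fun j => (hTm j).aemeasurable]
    exact ENNReal.tsum_le_tsum hTint
  have h3 : (s : ℝ≥0∞) * μ (⋃ j, {x | (s : ℝ≥0∞) < g j x}) ≤ ∑' j, a j := by
    refine (mul_le_mul_right (measure_iUnion_le _) _).trans ?_
    rw [← ENNReal.tsum_mul_left]
    exact ENNReal.tsum_le_tsum fun j => mul_measure_lt_le_weakNorm _ _
  calc (s : ℝ≥0∞) * μ {x | 2 * (s : ℝ≥0∞) < h x}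
      ≤ s * (μ (⋃ j, {x | (s : ℝ≥0∞) < g j x}) + μ {x | (s : ℝ≥0∞) ≤ ∑' j, T j x}) := by
        gcongr
        exact (measure_mono hsub).trans (measure_union_le _ _)
    _ ≤ ∑' j, a j + ∑' j, (2 * weight j : ℕ) * a j := by
        rw [mul_add]; exact add_le_add h3 h2
    _ = _ := by
        rw [← ENNReal.tsum_add]
        refine tsum_congr fun j => ?_
        push_cast; ring

/-! ### Antonov's Orlicz space -/

theorem measurable_walshMaximal (f : ℝ → ℂ) : Measurable (walshMaximal f) := by
  refine Measurable.iSup fun n => Measurable.enorm (Finset.measurable_sum _ fun k _ => ?_)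
  have h : (fun x => (walsh k x : ℂ)) = char k ∘ digits k :=
    funext fun x => walsh_eq_char Nat.lt_two_pow_self x
  refine Measurable.const_mul ?_ _
  rw [h]
  exact (measurable_of_countable (char k)).comp (measurable_digits k)

theorem walshMaximal_congr_ae {f g : ℝ → ℂ} (h : f =ᵐ[torus] g) :
    walshMaximal f = walshMaximal g := by
  have : ∀ k, walshCoeff f k = walshCoeff g k := fun k =>
    integral_congr_ae (h.mono fun x hx => by simp only [hx])
  funext x
  simp only [walshMaximal, walshPartialSum, this]

theorem walshMaximal_le_tsum {f : ℝ → ℂ} (hf : Integrable f torus) {E : ℕ → Set ℝ}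
    (hE : ∀ j, MeasurableSet (E j)) (hd : Pairwise (Function.onFun Disjoint E))
    (hU : ⋃ j, E j = Set.univ) (x : ℝ) :
    walshMaximal f x ≤ ∑' j, walshMaximal ((E j).indicator f) x := by
  refine iSup_le fun n => ?_
  have h1 : ∀ k, HasSum (fun j => walshCoeff ((E j).indicator f) k) (walshCoeff f k) := by
    intro k
    have h := hasSum_integral_iUnion hE hd (integrable_mul_walsh hf k).integrableOn
    rw [hU, setIntegral_univ] at h
    have e : (fun j => walshCoeff ((E j).indicator f) k) =
        fun j => ∫ y in E j, f y * (walsh k y : ℂ) ∂torus := by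
      funext j
      rw [← integral_indicator (hE j), walshCoeff]
      refine integral_congr_ae (Filter.Eventually.of_forall fun y => ?_)
      by_cases hy : y ∈ E j <;> simp [hy]
    rw [e]
    exact h
  have h2 : HasSum (fun j => walshPartialSum n ((E j).indicator f) x) (walshPartialSum n f x) :=
    hasSum_sum fun k _ => (h1 k).mul_right _
  rw [← h2.tsum_eq]
  exact enorm_tsum_le_tsum_enorm.trans
    (ENNReal.tsum_le_tsum fun j => le_iSup (fun n => ‖walshPartialSum n _ x‖ₑ) n)

/-- The triply logarithmic factor of `antonovΦ`. -/
def tripleLog (u : ℝ) : ℝ :=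
  Real.log (Real.log (Real.log (Real.exp (Real.exp (Real.exp 1)) + u)))

/-- The index of the band `exp (exp j) ≤ e + u < exp (exp (j + 1))` that contains `u`. -/
def band (u : ℝ) : ℕ := ⌊Real.log (Real.log (Real.exp 1 + u))⌋₊

section Band

variable {u : ℝ}

theorem one_le_log_exp_add (hu : 0 ≤ u) : 1 ≤ Real.log (Real.exp 1 + u) :=
  (Real.le_log_iff_exp_le (by positivity)).2 (by linarith)

theorem one_le_tripleLog (hu : 0 ≤ u) : 1 ≤ tripleLog u := by
  have h1 : Real.exp (Real.exp 1) ≤ Real.log (Real.exp (Real.exp (Real.exp 1)) + u) :=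
    (Real.le_log_iff_exp_le (by positivity)).2 (by linarith)
  have h1' := (Real.exp_pos (Real.exp 1)).trans_le h1
  have h2 : Real.exp 1 ≤ Real.log (Real.log (Real.exp (Real.exp (Real.exp 1)) + u)) :=
    (Real.le_log_iff_exp_le h1').2 h1
  exact (Real.le_log_iff_exp_le ((Real.exp_pos 1).trans_le h2)).2 h2

theorem le_antonovΦ (hu : 0 ≤ u) : u ≤ antonovΦ u := by
  have h1 := one_le_log_exp_add hu
  have h2 := one_le_tripleLog hu
  have : u * 1 * 1 ≤ u * Real.log (Real.exp 1 + u) * tripleLog u := by gcongr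
  simpa [antonovΦ, tripleLog] using this

theorem log_log_nonneg (hu : 0 ≤ u) : 0 ≤ Real.log (Real.log (Real.exp 1 + u)) :=
  Real.log_nonneg (one_le_log_exp_add hu)

theorem exp_band_le (hu : 0 ≤ u) : Real.exp (band u) ≤ Real.log (Real.exp 1 + u) := by
  have h := Nat.floor_le (log_log_nonneg hu)
  rwa [Real.le_log_iff_exp_le (by linarith [one_le_log_exp_add hu])] at h

theorem le_exp_exp_band (hu : 0 ≤ u) : u ≤ Real.exp (Real.exp (band u + 1)) := by
  have h := (Nat.lt_floor_add_one (Real.log (Real.log (Real.exp 1 + u)))).le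
  rw [Real.log_le_iff_le_exp (by linarith [one_le_log_exp_add hu]),
    Real.log_le_iff_le_exp (by positivity)] at h
  exact le_trans (by linarith [Real.exp_pos 1]) h

theorem band_le_exp_tripleLog (hu : 0 ≤ u) : (band u : ℝ) ≤ Real.exp (tripleLog u) := by
  have h1 := Nat.floor_le (log_log_nonneg hu)
  have h0 := one_le_log_exp_add hu
  have h2 : Real.log (Real.exp 1 + u) ≤ Real.log (Real.exp (Real.exp (Real.exp 1)) + u) := by
    refine Real.log_le_log (by positivity) ?_
    have : Real.exp 1 ≤ Real.exp (Real.exp (Real.exp 1)) := by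
      refine Real.exp_le_exp.2 (le_trans (by norm_num : (1 : ℝ) ≤ 2) ?_)
      have := Real.add_one_le_exp (Real.exp 1)
      have := Real.add_one_le_exp (1 : ℝ)
      linarith
    linarith
  have h3 := Real.log_le_log (by linarith) h2
  have h4 : 1 < Real.log (Real.log (Real.exp (Real.exp (Real.exp 1)) + u)) := by
    by_contra! hc
    have h5 := one_le_tripleLog hu
    have h6 : 0 ≤ Real.log (Real.log (Real.exp (Real.exp (Real.exp 1)) + u)) :=
      (log_log_nonneg hu).trans h3
    have := Real.log_nonpos h6 hc
    rw [tripleLog] at h5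
    linarith
  rw [tripleLog, Real.exp_log (by linarith)]
  exact h1.trans h3

theorem weight_le_tripleLog (hu : 0 ≤ u) : (1 + 2 * weight (band u) : ℕ) ≤ 17 * tripleLog u := by
  set s := (band u + 1).size with hs
  have hs0 : 0 < s := Nat.size_pos.2 (Nat.succ_pos _)
  have h1 : 2 ^ (s - 1) ≤ band u + 1 := Nat.lt_size.1 (by omega)
  have h2 : (2 : ℝ) ^ (s - 1) ≤ band u + 1 := by exact_mod_cast h1
  have h3 := band_le_exp_tripleLog hu
  have hΛ := one_le_tripleLog hu
  set Λ := tripleLog u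
  have h4 : (2 : ℝ) ^ (s - 1) ≤ Real.exp (Λ + 1) := by
    rw [Real.exp_add]
    have e1 := Real.add_one_le_exp (1 : ℝ)
    have e2 := Real.one_le_exp (show 0 ≤ Λ by linarith)
    nlinarith
  have h5 : ((s - 1 : ℕ) : ℝ) * Real.log 2 ≤ Λ + 1 := by
    rw [← Real.log_pow]
    exact (Real.log_le_iff_le_exp (by positivity)).2 h4
  have h6 : ((s - 1 : ℕ) : ℝ) = s - 1 := by rw [Nat.cast_sub hs0]; simp
  rw [h6] at h5
  have h7 : (0.69 : ℝ) ≤ Real.log 2 := by linarith [Real.log_two_gt_d9]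
  have h8 : (1 : ℝ) ≤ s := by exact_mod_cast hs0
  have h9 : ((s : ℝ) - 1) * 0.69 ≤ Λ + 1 := by nlinarith
  rw [weight, ← hs]
  push_cast
  linarith

theorem measurable_band : Measurable band :=
  Nat.measurable_floor.comp
    (Real.measurable_log.comp (Real.measurable_log.comp (measurable_const.add measurable_id)))

end Band

/-- A numerical bound for the contribution of one band; `v` is the normalised `L¹` norm. -/
theorem band_bound (j : ℕ) {v : ℝ} (hv : 0 ≤ v) :
    (1 + 2 * weight j : ℕ) * (24000 * Real.exp (j + 1) * (Real.exp 1 * v) ^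
      (1 / (1 + Real.exp (-((j : ℝ) + 1))))) ≤
    24000 * (27 * ((1 + 2 * weight j : ℕ) * (Real.exp j * v)) + 720 * (1 / 2) ^ (j + 1)) := by
  set y := Real.exp ((j : ℝ) + 1) with hy
  have hy0 : 0 < y := Real.exp_pos _
  set p := 1 + Real.exp (-((j : ℝ) + 1)) with hp
  have hyi : Real.exp (-((j : ℝ) + 1)) = y⁻¹ := Real.exp_neg _
  have hpy : (p - 1) * y = 1 := by rw [hp, hyi]; field_simp; ring
  have hp1 : 1 < p := by rw [hp]; linarith [Real.exp_pos (-((j : ℝ) + 1))]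
  have hp0 : 0 < p := by linarith
  have hp2 : p ≤ 2 := by
    have : Real.exp (-((j : ℝ) + 1)) ≤ 1 := Real.exp_le_one_iff.2 (by
      have : (0 : ℝ) ≤ j := Nat.cast_nonneg j
      linarith)
    linarith
  have he3 : Real.exp 1 ≤ 3 := by linarith [Real.exp_one_lt_d9]
  have he1 : 1 ≤ Real.exp 1 := Real.one_le_exp (by norm_num)
  have hip : 1 / p ≤ 1 := by rw [div_le_one hp0]; exact hp1.le
  have hip2 : 1 / 2 ≤ 1 / p := by gcongr
  have hv1 : v ^ (1 / p) ≤ Real.exp 1 * v + Real.exp (-(y / 2)) := by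
    rcases le_total v (Real.exp (-y)) with hle | hle
    · have : v ^ (1 / p) ≤ Real.exp (-(y / 2)) := by
        calc v ^ (1 / p) ≤ Real.exp (-y) ^ (1 / p) := by gcongr
          _ = Real.exp (-y * (1 / p)) := (Real.exp_mul _ _).symm
          _ ≤ _ := Real.exp_le_exp.2 (by nlinarith)
      have : 0 ≤ Real.exp 1 * v := by positivity
      linarith
    · have hvpos : 0 < v := (Real.exp_pos _).trans_le hle
      have h1 : v ^ (1 / p) = v * v ^ (1 / p - 1) := by
        nth_rewrite 2 [← Real.rpow_one v]
        rw [← Real.rpow_add hvpos]; congr 1; ring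
      have h2 : v ^ (1 / p - 1) ≤ Real.exp 1 := by
        calc v ^ (1 / p - 1) ≤ Real.exp (-y) ^ (1 / p - 1) :=
              Real.rpow_le_rpow_of_nonpos (Real.exp_pos _) hle (by linarith)
          _ = Real.exp (-y * (1 / p - 1)) := (Real.exp_mul _ _).symm
          _ ≤ _ := by
            refine Real.exp_le_exp.2 ?_
            have : -y * (1 / p - 1) = ((p - 1) * y) / p := by field_simp; ring
            rw [this, hpy]; exact hip
      rw [h1]
      have : v * v ^ (1 / p - 1) ≤ v * Real.exp 1 := by gcongr
      have := Real.exp_pos (-(y / 2))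
      linarith
  have hmul : (Real.exp 1 * v) ^ (1 / p) ≤ 3 * (3 * v + Real.exp (-(y / 2))) := by
    rw [Real.mul_rpow (by positivity) hv]
    have h1 : Real.exp 1 ^ (1 / p) ≤ 3 := by
      calc Real.exp 1 ^ (1 / p) ≤ Real.exp 1 ^ (1 : ℝ) :=
            Real.rpow_le_rpow_of_exponent_le he1 hip
        _ ≤ 3 := by rwa [Real.rpow_one]
    have h2 : v ^ (1 / p) ≤ 3 * v + Real.exp (-(y / 2)) := by nlinarith
    exact mul_le_mul h1 h2 (by positivity) (by norm_num)
  have hy3 : y = Real.exp 1 * Real.exp j := by rw [hy, Real.exp_add, mul_comm]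
  have hj1 : (j : ℝ) + 1 ≤ y := by
    have := Real.add_one_le_exp ((j : ℝ) + 1)
    linarith
  have hw : ((1 + 2 * weight j : ℕ) : ℝ) ≤ 5 * y := by
    have h1 : (j + 1).size ≤ j + 1 := Nat.size_le.2 Nat.lt_two_pow_self
    have h2 : ((j + 1).size : ℝ) ≤ j + 1 := by exact_mod_cast h1
    rw [weight]; push_cast
    have : (0 : ℝ) ≤ j := Nat.cast_nonneg j
    linarith
  have htail : ((1 + 2 * weight j : ℕ) : ℝ) * y * (3 * Real.exp (-(y / 2))) ≤
      720 * (1 / 2) ^ (j + 1) := by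
    have h1 : y ^ 3 / 48 ≤ Real.exp (y / 2) := by
      have := Real.pow_div_factorial_le_exp (y / 2) (by positivity) 3
      have e : (y / 2) ^ 3 / (Nat.factorial 3 : ℝ) = y ^ 3 / 48 := by
        norm_num [Nat.factorial]; ring
      rwa [e] at this
    have h2 : Real.exp (-(y / 2)) ≤ 48 / y ^ 3 := by
      rw [Real.exp_neg, le_div_iff₀ (by positivity), inv_mul_le_iff₀ (Real.exp_pos _)]
      linarith
    have h3 : 1 / y ≤ (1 / 2) ^ (j + 1) := by
      rw [one_div_pow]
      refine one_div_le_one_div_of_le (by positivity) ?_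
      have e2 : (2 : ℝ) ≤ Real.exp 1 := by linarith [Real.add_one_le_exp (1 : ℝ)]
      calc (2 : ℝ) ^ (j + 1) ≤ Real.exp 1 ^ (j + 1) := by gcongr
        _ = y := by rw [← Real.exp_nat_mul, hy]; push_cast; ring_nf
    calc ((1 + 2 * weight j : ℕ) : ℝ) * y * (3 * Real.exp (-(y / 2)))
        ≤ 5 * y * y * (3 * (48 / y ^ 3)) := by gcongr
      _ = 720 * (1 / y) := by field_simp; norm_num
      _ ≤ _ := by gcongr
  set w := ((1 + 2 * weight j : ℕ) : ℝ) with hwdef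
  have hw0 : 0 ≤ w := Nat.cast_nonneg _
  calc w * (24000 * y * (Real.exp 1 * v) ^ (1 / p))
      ≤ w * (24000 * y * (3 * (3 * v + Real.exp (-(y / 2))))) := by gcongr
    _ = 24000 * (9 * (w * (Real.exp 1 * Real.exp j * v)) + w * y * (3 * Real.exp (-(y / 2)))) := by
        rw [hy3]; ring
    _ ≤ 24000 * (9 * (w * (3 * Real.exp j * v)) + 720 * (1 / 2) ^ (j + 1)) := by gcongr
    _ = _ := by ring

theorem weakNorm_le_of_lintegral_antonovΦ_le {f : ℝ → ℂ} (hf : Measurable f) {l : ℝ≥0}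
    (hl : 0 < l) (h : ∫⁻ x, ENNReal.ofReal (antonovΦ (‖f x‖ / (l : ℝ))) ∂torus ≤ 1) :
    weakNorm (walshMaximal f) 1 torus ≤ ENNReal.ofReal 60000000 * l := by
  have hl' : (0 : ℝ) < l := hl
  set u : ℝ → ℝ := fun x => ‖f x‖ / l with hu
  have hu0 : ∀ x, 0 ≤ u x := fun x => by positivity
  have hum : Measurable u := hf.norm.div_const _
  have hnorm : ∀ x, ‖f x‖ₑ = l * ENNReal.ofReal (u x) := by
    intro x
    rw [← ENNReal.ofReal_coe_nnreal, ← ENNReal.ofReal_mul l.coe_nonneg, ← ofReal_norm]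
    congr 1
    simp only [hu]; field_simp
  have hu1 : ∫⁻ x, ENNReal.ofReal (u x) ∂torus ≤ 1 :=
    (lintegral_mono fun x => ENNReal.ofReal_le_ofReal (le_antonovΦ (hu0 x))).trans h
  have hfint : Integrable f torus := by
    refine ⟨hf.aestronglyMeasurable, ?_⟩
    rw [HasFiniteIntegral]
    simp only [hnorm]
    rw [lintegral_const_mul _ hum.ennreal_ofReal]
    exact ENNReal.mul_lt_top ENNReal.coe_lt_top (hu1.trans_lt ENNReal.one_lt_top)
  set E : ℕ → Set ℝ := fun j => (fun x => band (u x)) ⁻¹' {j} with hE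
  have hEm : ∀ j, MeasurableSet (E j) := fun j =>
    (measurable_band.comp hum) (measurableSet_singleton j)
  have hEd : Pairwise (Function.onFun Disjoint E) := fun i j hij =>
    Set.disjoint_left.2 fun x hx hx' => hij (hx.symm.trans hx')
  have hEU : ⋃ j, E j = Set.univ := Set.eq_univ_of_forall fun x => Set.mem_iUnion.2 ⟨_, rfl⟩
  set v : ℕ → ℝ := fun j => (∫⁻ x in E j, ENNReal.ofReal (u x) ∂torus).toReal with hv
  have hvlt : ∀ j, ∫⁻ x in E j, ENNReal.ofReal (u x) ∂torus ≠ ∞ := fun j =>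
    ((setLIntegral_le_lintegral _ _).trans hu1).trans_lt ENNReal.one_lt_top |>.ne
  have hv0 : ∀ j, 0 ≤ v j := fun j => ENNReal.toReal_nonneg
  -- Each band is estimated with its own exponent.
  have hband : ∀ j, (1 + 2 * weight j : ℕ) * weakNorm (walshMaximal ((E j).indicator f)) 1 torus ≤
      ENNReal.ofReal (l * 24000) * (ENNReal.ofReal 27 *
        ENNReal.ofReal ((1 + 2 * weight j : ℕ) * (Real.exp j * v j)) +
          ENNReal.ofReal 720 * 2⁻¹ ^ (j + 1)) := by
    intro j
    have hj0 : (0 : ℝ) ≤ j := Nat.cast_nonneg j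
    set p := 1 + Real.exp (-((j : ℝ) + 1)) with hp
    have hp1 : 1 < p := by rw [hp]; linarith [Real.exp_pos (-((j : ℝ) + 1))]
    have hp2 : p ≤ 2 := by
      have : Real.exp (-((j : ℝ) + 1)) ≤ 1 := Real.exp_le_one_iff.2 (by linarith)
      linarith
    have hp0 : 0 < p := by linarith
    set M := Real.exp (Real.exp ((j : ℝ) + 1)) with hM
    have hbd : ∀ x, ‖(E j).indicator f x‖ ≤ M * l := by
      intro x
      by_cases hx : x ∈ E j
      · rw [Set.indicator_of_mem hx]
        have h1 := le_exp_exp_band (hu0 x)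
        rw [show band (u x) = j from hx] at h1
        exact (div_le_iff₀ hl').1 h1
      · rw [Set.indicator_of_notMem hx, norm_zero]; positivity
    have h1 := weakNorm_walshMaximal_one_le hp1 hp2
      (hf.indicator (hEm j)).aestronglyMeasurable (Filter.Eventually.of_forall hbd)
      (by positivity)
    have h2 : (eLpNorm ((E j).indicator f) 1 torus).toReal = l * v j := by
      rw [eLpNorm_indicator_eq_eLpNorm_restrict (hEm j), eLpNorm_one_eq_lintegral_enorm]
      simp only [hnorm]
      rw [lintegral_const_mul _ hum.ennreal_ofReal, ENNReal.toReal_mul]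
      rfl
    have h3 : ((M * l) ^ (p - 1) * (l * v j)) ^ (1 / p) = l * (Real.exp 1 * v j) ^ (1 / p) := by
      have e1 : M ^ (p - 1) = Real.exp 1 := by
        rw [hM, ← Real.exp_mul, hp, add_sub_cancel_left, ← Real.exp_add, add_neg_cancel,
          Real.exp_zero]
      have e2 : (M * l) ^ (p - 1) * (l * v j) = (l : ℝ) ^ p * (Real.exp 1 * v j) := by
        rw [Real.mul_rpow (by positivity) hl'.le, e1]
        have : (l : ℝ) ^ p = (l : ℝ) ^ (p - 1) * l := by
          nth_rewrite 3 [← Real.rpow_one (l : ℝ)]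
          rw [← Real.rpow_add hl', sub_add_cancel]
        rw [this]; ring
      have := hv0 j
      rw [e2, Real.mul_rpow (by positivity) (by positivity), ← Real.rpow_mul hl'.le,
        mul_one_div_cancel hp0.ne', Real.rpow_one]
    have h4 : 24000 / (p - 1) = 24000 * Real.exp (j + 1) := by
      rw [hp, add_sub_cancel_left, Real.exp_neg, div_inv_eq_mul]
    rw [h2, h3, h4] at h1
    have h5 := mul_le_mul_of_nonneg_left (band_bound j (hv0 j)) hl'.le
    have e2 : (2⁻¹ : ℝ≥0∞) ^ (j + 1) = ENNReal.ofReal ((1 / 2) ^ (j + 1)) := by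
      rw [ENNReal.ofReal_pow (by norm_num), one_div, ENNReal.ofReal_inv_of_pos (by norm_num)]
      simp
    have hvj := hv0 j
    calc (1 + 2 * weight j : ℕ) * weakNorm (walshMaximal ((E j).indicator f)) 1 torus
        ≤ (1 + 2 * weight j : ℕ) * ENNReal.ofReal
          (24000 * Real.exp (j + 1) * (l * (Real.exp 1 * v j) ^ (1 / p))) := by gcongr
      _ = ENNReal.ofReal (l * ((1 + 2 * weight j : ℕ) *
          (24000 * Real.exp (j + 1) * (Real.exp 1 * v j) ^ (1 / p)))) := by
        rw [← ENNReal.ofReal_natCast, ← ENNReal.ofReal_mul (Nat.cast_nonneg _)]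
        congr 1; ring
      _ ≤ _ := ENNReal.ofReal_le_ofReal h5
      _ = _ := by
        rw [e2, ← ENNReal.ofReal_mul (by norm_num), ← ENNReal.ofReal_mul (by norm_num),
          ← ENNReal.ofReal_add (by positivity) (by positivity),
          ← ENNReal.ofReal_mul (by positivity)]
        congr 1; ring
  have hmain : ∑' j, ENNReal.ofReal ((1 + 2 * weight j : ℕ) * (Real.exp j * v j)) ≤
      ENNReal.ofReal 17 := by
    calc ∑' j, ENNReal.ofReal ((1 + 2 * weight j : ℕ) * (Real.exp j * v j))
        ≤ ∑' j, ∫⁻ x in E j, ENNReal.ofReal 17 * ENNReal.ofReal (antonovΦ (u x)) ∂torus := by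
          refine ENNReal.tsum_le_tsum fun j => ?_
          rw [← mul_assoc, ENNReal.ofReal_mul (by positivity), hv, ENNReal.ofReal_toReal (hvlt j),
            ← lintegral_const_mul _ hum.ennreal_ofReal]
          refine setLIntegral_mono' (hEm j) fun x hx => ?_
          rw [← ENNReal.ofReal_mul (by positivity), ← ENNReal.ofReal_mul (by positivity)]
          refine ENNReal.ofReal_le_ofReal ?_
          have e1 := weight_le_tripleLog (hu0 x)
          have e2 := exp_band_le (hu0 x)
          have e3 := one_le_tripleLog (hu0 x)
          have hx0 := hu0 x
          rw [show band (u x) = j from hx] at e1 e2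
          calc ((1 + 2 * weight j : ℕ) : ℝ) * Real.exp j * u x
              ≤ (17 * tripleLog (u x)) * Real.log (Real.exp 1 + u x) * u x := by gcongr
            _ = 17 * antonovΦ (u x) := by rw [antonovΦ, tripleLog]; ring
      _ = ∫⁻ x, ENNReal.ofReal 17 * ENNReal.ofReal (antonovΦ (u x)) ∂torus := by
          rw [← lintegral_iUnion hEm hEd, hEU, setLIntegral_univ]
      _ = ENNReal.ofReal 17 * ∫⁻ x, ENNReal.ofReal (antonovΦ (u x)) ∂torus :=
          lintegral_const_mul' _ _ ENNReal.ofReal_ne_top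
      _ ≤ ENNReal.ofReal 17 * 1 := by gcongr
      _ = _ := mul_one _
  have hgeom : ∑' j : ℕ, (2⁻¹ : ℝ≥0∞) ^ (j + 1) = 1 := by
    rw [ENNReal.tsum_geometric_add_one, ENNReal.one_sub_inv_two, inv_inv,
      ENNReal.inv_mul_cancel two_ne_zero ENNReal.ofNat_ne_top]
  calc weakNorm (walshMaximal f) 1 torus
      ≤ 2 * ∑' j, (1 + 2 * weight j : ℕ) *
        weakNorm (walshMaximal ((E j).indicator f)) 1 torus :=
        weakNorm_le_tsum (fun j => measurable_walshMaximal _)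
          (walshMaximal_le_tsum hfint hEm hEd hEU)
    _ ≤ 2 * ∑' j, ENNReal.ofReal (l * 24000) * (ENNReal.ofReal 27 *
        ENNReal.ofReal ((1 + 2 * weight j : ℕ) * (Real.exp j * v j)) +
          ENNReal.ofReal 720 * 2⁻¹ ^ (j + 1)) := by
        exact mul_le_mul_right (ENNReal.tsum_le_tsum hband) 2
    _ ≤ 2 * (ENNReal.ofReal (l * 24000) *
        (ENNReal.ofReal 27 * ENNReal.ofReal 17 + ENNReal.ofReal 720 * 1)) := by
        rw [ENNReal.tsum_mul_left, ENNReal.tsum_add, ENNReal.tsum_mul_left,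
          ENNReal.tsum_mul_left, hgeom]
        gcongr
    _ = ENNReal.ofReal (l * 56592000) := by
        rw [mul_one, ← ENNReal.ofReal_mul (by norm_num),
          ← ENNReal.ofReal_add (by norm_num) (by norm_num),
          ← ENNReal.ofReal_mul (by positivity),
          show (2 : ℝ≥0∞) = ENNReal.ofReal 2 by simp, ← ENNReal.ofReal_mul (by norm_num)]
        congr 1; ring
    _ ≤ ENNReal.ofReal (60000000 * l) := ENNReal.ofReal_le_ofReal (by linarith)
    _ = _ := by rw [ENNReal.ofReal_mul (by norm_num), ENNReal.ofReal_coe_nnreal]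

theorem weakNorm_walshMaximal_le_luxemburgNorm {f : ℝ → ℂ} (hf : AEStronglyMeasurable f torus) :
    weakNorm (walshMaximal f) 1 torus ≤
      ENNReal.ofReal 60000000 * luxemburgNorm antonovΦ f torus := by
  have hae := hf.aemeasurable.ae_eq_mk
  rw [walshMaximal_congr_ae hae, luxemburgNorm]
  have hc : ENNReal.ofReal 60000000 ≠ 0 := by norm_num
  rw [mul_comm, ← ENNReal.div_le_iff hc ENNReal.ofReal_ne_top]
  refine le_iInf fun l => le_iInf fun hl => le_iInf fun h => ?_
  rw [ENNReal.div_le_iff hc ENNReal.ofReal_ne_top, mul_comm]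
  refine weakNorm_le_of_lintegral_antonovΦ_le hf.aemeasurable.measurable_mk hl ?_
  refine le_trans (le_of_eq ?_) h
  exact lintegral_congr_ae (hae.mono fun x hx => by simp only [hx])

end WalshCarleson

end

theorem theorem1 :
    -- weak-type bound with constant `c / (p - 1)`
    (∃ c : ℝ, 0 < c ∧ ∀ p : ℝ, 1 < p → p ≤ 2 → ∀ f : ℝ → ℂ,
      MemLp f (ENNReal.ofReal p) WalshCarleson.torus →
      WalshCarleson.weakNorm (WalshCarleson.walshMaximal f) p WalshCarleson.torus ≤
        ENNReal.ofReal (c / (p - 1)) * eLpNorm f (ENNReal.ofReal p) WalshCarleson.torus) ∧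
    -- mixed estimate with `L^1` and `L^∞` norms
    (∃ c : ℝ, 0 < c ∧ ∀ f : ℝ → ℂ, MemLp f ∞ WalshCarleson.torus →
      WalshCarleson.weakNorm (WalshCarleson.walshMaximal f) 1 WalshCarleson.torus ≤
        ENNReal.ofReal (c * (eLpNorm f 1 WalshCarleson.torus).toReal *
          Real.log (Real.exp 1 + (eLpNorm f ∞ WalshCarleson.torus).toReal /
            (eLpNorm f 1 WalshCarleson.torus).toReal))) ∧
    -- boundedness from `L log L log log log L` to weak `L^1`
    (∃ c : ℝ, 0 < c ∧ ∀ f : ℝ → ℂ, AEStronglyMeasurable f WalshCarleson.torus →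
      WalshCarleson.luxemburgNorm WalshCarleson.antonovΦ f WalshCarleson.torus < ∞ →
      WalshCarleson.weakNorm (WalshCarleson.walshMaximal f) 1 WalshCarleson.torus ≤
        ENNReal.ofReal c *
          WalshCarleson.luxemburgNorm WalshCarleson.antonovΦ f WalshCarleson.torus) := by
  refine ⟨⟨24000, by norm_num, fun p hp1 hp2 f hf => ?_⟩, ⟨72000, by norm_num, fun f hf => ?_⟩,
    ⟨60000000, by norm_num, fun f hf _ => ?_⟩⟩
  · exact WalshCarleson.weakNorm_walshMaximal_le hp1 hp2 hf
  · exact WalshCarleson.weakNorm_walshMaximal_one_le_log hf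
  · exact WalshCarleson.weakNorm_walshMaximal_le_luxemburgNorm hf
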